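/- Let $p$ be an odd prime, let $S$ be a Sylow $p$-subgroup of $SU_4(p)$ (the special unitary group of dimension $4$ over the field with $p^2$ elements), and let $\mathcal F$ be a saturated fusion system on $S$. Let $O_p(\mathcal F)$ be the largest subgroup of $S$ that is normal in $\mathcal F$, and suppose that $O_p(\mathcal F)\neq 1$. Then $\mathcal F$ has at most one $\mathcal F$-essential subgroup, and such a subgroup, if it exists, is normal in $\mathcal F$ and $\mathcal F$-centric. Moreover, $\mathcal F$ is constrained (that is, some subgroup of $S$ is both normal in $\mathcal F$ and $\mathcal F$-centric), and $\mathcal F$ has a model: there is a finite group $G$ with $S$ as a Sylow $p$-subgroup such that $\mathcal F=\mathcal F_S(G)$ and $C_G(O_p(G))\leq O_p(G)$, where $O_p(G)$ is the largest normal $p$-subgroup of $G$. In particular, $\mathcal F$ is realizable by a finite group. -/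

import Mathlib

/- Fusion systems on a group `S` (in the applications a finite `p`-group).  Maps are written on
the left, and `g` acts by conjugation as `x ↦ g * x * g⁻¹`.
-/

universe u

/-- `H` is strongly `p`-embedded in `G`: a proper subgroup of order divisible by `p` such that
`p` does not divide the order of `H ∩ gHg⁻¹` for `g ∉ H`. -/
def IsStronglyEmbedded (p : ℕ) {G : Type u} [Group G] (H : Subgroup G) : Prop :=
  H ≠ ⊤ ∧ p ∣ Nat.card H ∧
    ∀ g : G, g ∉ H → ¬ p ∣ Nat.card ↥(H ⊓ H.map (MulAut.conj g).toMonoidHom)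

/-- `O_p(G)`, the subgroup generated by all normal `p`-subgroups of `G`; for finite `G` it is the
largest normal `p`-subgroup. -/
def groupOp (p : ℕ) (G : Type u) [Group G] : Subgroup G :=
  sSup {N : Subgroup G | N.Normal ∧ IsPGroup p N}

/-- A fusion system on `S`: a category whose objects are the subgroups of `S`, whose morphisms are
injective group homomorphisms, among them all those induced by conjugation in `S`, and in
which every morphism is an isomorphism of the category followed by an inclusion. -/
@[ext]
structure FusionSystem (S : Type u) [Group S] where
  /-- the morphisms of the fusion system -/
  hom : ∀ P Q : Subgroup S, Set (P →* Q)
  injective_of_mem : ∀ {P Q : Subgroup S} {φ : P →* Q}, φ ∈ hom P Q → Function.Injective φ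
  conj_mem : ∀ {P Q : Subgroup S} (φ : P →* Q) (g : S),
    (∀ x : P, (φ x : S) = g * x * g⁻¹) → φ ∈ hom P Q
  comp_mem : ∀ {P Q R : Subgroup S} {φ : P →* Q} {ψ : Q →* R},
    φ ∈ hom P Q → ψ ∈ hom Q R → ψ.comp φ ∈ hom P R
  exists_iso : ∀ {P Q : Subgroup S} {φ : P →* Q}, φ ∈ hom P Q →
    ∃ (R : Subgroup S) (hR : R ≤ Q) (e : P ≃* R),
      e.toMonoidHom ∈ hom P R ∧ e.symm.toMonoidHom ∈ hom R P ∧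
        φ = (Subgroup.inclusion hR).comp e.toMonoidHom

namespace FusionSystem

variable {S : Type u} [Group S]

/-- `Aut_S(P)`: the automorphisms of `P` induced by conjugation by elements of `N_S(P)`. -/
def autBase (P : Subgroup S) : Subgroup (MulAut P) := P.normalizerMonoidHom.range

/-- `Inn(P)`. -/
def inn (P : Subgroup S) : Subgroup (MulAut P) := (MulAut.conj : P →* MulAut P).range

instance inn_normal (P : Subgroup S) : (inn P).Normal := by
  constructor
  rintro _ ⟨x, rfl⟩ α
  refine ⟨α x, ?_⟩
  ext y
  simp [MulAut.conj_apply]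

theorem symm_mem (F : FusionSystem S) {P Q : Subgroup S} (e : P ≃* Q)
    (he : e.toMonoidHom ∈ F.hom P Q) : e.symm.toMonoidHom ∈ F.hom Q P := by
  obtain ⟨R, hR, f, -, hf, h⟩ := F.exists_iso he
  have key : ∀ x, (e x : S) = f x := fun x => by
    have := DFunLike.congr_fun h x
    exact congrArg Subtype.val this
  have hRQ : R = Q := by
    refine le_antisymm hR fun y hy => ?_
    have := key (e.symm ⟨y, hy⟩)
    simp only [MulEquiv.apply_symm_apply] at this
    rw [this]
    exact (f _).2
  subst hRQ
  have : e = f := by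
    ext x
    exact key x
  rw [this]
  exact hf

/-- `Aut_F(P)`. -/
def aut (F : FusionSystem S) (P : Subgroup S) : Subgroup (MulAut P) where
  carrier := {α | α.toMonoidHom ∈ F.hom P P}
  mul_mem' {a b} ha hb := F.comp_mem hb ha
  one_mem' := F.conj_mem _ 1 fun x => by simp
  inv_mem' {a} ha := F.symm_mem a ha

/-- `Out_F(P) = Aut_F(P) / Inn(P)`; note that `Inn(P) ≤ Aut_F(P)`. -/
abbrev Out (F : FusionSystem S) (P : Subgroup S) : Type u :=
  ↥(F.aut P) ⧸ (inn P).subgroupOf (F.aut P)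

/-- `P` and `Q` are isomorphic in `F`, that is, `Q` belongs to the `F`-conjugacy class of `P`. -/
def IsConj (F : FusionSystem S) (P Q : Subgroup S) : Prop :=
  ∃ e : P ≃* Q, e.toMonoidHom ∈ F.hom P Q

/-- `P` is fully `F`-automized: `Aut_S(P)` is a Sylow `p`-subgroup of `Aut_F(P)`. -/
def IsFullyAutomized (p : ℕ) (F : FusionSystem S) (P : Subgroup S) : Prop :=
  ∃ T : Sylow p (F.aut P), (T : Subgroup (F.aut P)) = (autBase P).subgroupOf (F.aut P)

/-- `P` is fully `F`-normalized. -/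
def IsFullyNormalized (F : FusionSystem S) (P : Subgroup S) : Prop :=
  ∀ Q, F.IsConj P Q →
    Nat.card (Subgroup.normalizer (Q : Set S)) ≤ Nat.card (Subgroup.normalizer (P : Set S))

/-- `P` is `F`-centric: `C_S(Q) = Z(Q)` for every `F`-conjugate `Q` of `P`. -/
def IsCentric (F : FusionSystem S) (P : Subgroup S) : Prop :=
  ∀ Q, F.IsConj P Q →
    Subgroup.centralizer (Q : Set S) = (Subgroup.center Q).map Q.subtype

/-- `P` is `F`-essential. -/
def IsEssential (p : ℕ) (F : FusionSystem S) (P : Subgroup S) : Prop :=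
  F.IsCentric P ∧ F.IsFullyNormalized P ∧ ∃ H : Subgroup (F.Out P), IsStronglyEmbedded p H

/-- For an isomorphism `α : P → Q`, the group `N_α` of all `g ∈ N_S(P)` such that
`α c_g α⁻¹ ∈ Aut_S(Q)`, where `c_g` is conjugation by `g` on `P`. -/
def extender {P Q : Subgroup S} (α : P ≃* Q) : Subgroup S :=
  ((autBase Q).comap
    ((MulAut.congr α).toMonoidHom.comp P.normalizerMonoidHom)).map
      (Subgroup.normalizer (P : Set S)).subtype

theorem le_extender {P Q : Subgroup S} (α : P ≃* Q) : P ≤ extender α := by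
  intro x hx
  refine ⟨⟨x, Subgroup.le_normalizer hx⟩, ?_, rfl⟩
  refine ⟨⟨α ⟨x, hx⟩, Subgroup.le_normalizer (α ⟨x, hx⟩).2⟩, ?_⟩
  ext y
  have h : (⟨x, hx⟩ * α.symm y * ⟨x, hx⟩⁻¹ : P) =
      P.normalizerMonoidHom ⟨x, Subgroup.le_normalizer hx⟩ (α.symm y) := by
    ext; rfl
  change _ = ((α (P.normalizerMonoidHom ⟨x, _⟩ (α.symm y)) : Q) : S)
  rw [← h]
  simp only [map_mul, map_inv, MulEquiv.apply_symm_apply]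
  rfl

/-- `Q` is `F`-receptive: every isomorphism `α : P → Q` in `F` extends to a morphism
`N_α → S` in `F`. -/
def IsReceptive (F : FusionSystem S) (Q : Subgroup S) : Prop :=
  ∀ (P : Subgroup S) (α : P ≃* Q), α.toMonoidHom ∈ F.hom P Q →
    ∃ β ∈ F.hom (extender α) ⊤,
      ∀ x : P, ((β (Subgroup.inclusion (le_extender α) x) : (⊤ : Subgroup S)) : S) = α x

/-- `F` is saturated: every subgroup of `S` is `F`-conjugate to one that is both fully
`F`-automized and `F`-receptive. -/
def IsSaturated (p : ℕ) (F : FusionSystem S) : Prop :=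
  ∀ P, ∃ Q, F.IsConj P Q ∧ F.IsFullyAutomized p Q ∧ F.IsReceptive Q

/-- `Q` is normal in `F`: it is normal in `S`, and every `φ : P → R` in `F` extends to a morphism
`PQ → RQ` in `F` that maps `Q` onto `Q`. -/
def IsNormal (F : FusionSystem S) (Q : Subgroup S) : Prop :=
  Q.Normal ∧ ∀ P R : Subgroup S, ∀ φ ∈ F.hom P R,
    ∃ ψ ∈ F.hom (P ⊔ Q) (R ⊔ Q),
      (∀ x : P, (ψ (Subgroup.inclusion le_sup_left x) : S) = φ x) ∧
      (Q.subgroupOf (P ⊔ Q)).map ψ = Q.subgroupOf (R ⊔ Q)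

/-- `O_p(F)`, the subgroup generated by all subgroups of `S` normal in `F`; for finite `S` it is
the largest subgroup of `S` that is normal in `F` (see `isGreatest_Op`). -/
def Op (F : FusionSystem S) : Subgroup S := sSup {Q | F.IsNormal Q}

/-- `F` is constrained: some subgroup of `S` is both normal in `F` and `F`-centric. -/
def IsConstrained (F : FusionSystem S) : Prop := ∃ Q, F.IsNormal Q ∧ F.IsCentric Q

/-- The fusion system on `S` of a group `G` containing (via `ι`) the group `S`: its morphisms are
the maps induced by conjugation by elements of `G`. -/
def ofGroup {G : Type u} [Group G] (ι : S →* G) (hι : Function.Injective ι) :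
    FusionSystem S where
  hom P Q := {φ | ∃ g : G, ∀ x : P, ι (φ x) = g * ι x * g⁻¹}
  injective_of_mem := by
    rintro P Q φ ⟨g, hg⟩ x y hxy
    have h : g * ι x * g⁻¹ = g * ι y * g⁻¹ := by rw [← hg, ← hg, hxy]
    simpa [hι.eq_iff] using h
  conj_mem φ g h := ⟨ι g, fun x => by simp [h]⟩
  comp_mem := by
    rintro P Q R φ ψ ⟨g, hg⟩ ⟨k, hk⟩
    refine ⟨k * g, fun x => ?_⟩
    rw [MonoidHom.comp_apply, hk, hg]
    group
  exists_iso := by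
    rintro P Q φ ⟨g, hg⟩
    have inj : Function.Injective (Q.subtype.comp φ) := by
      intro x y hxy
      have h : g * ι x * g⁻¹ = g * ι y * g⁻¹ := by
        rw [← hg, ← hg]
        exact congrArg ι hxy
      simpa [hι.eq_iff] using h
    have he : ∀ x, ((MonoidHom.ofInjective inj x : (Q.subtype.comp φ).range) : S) = φ x :=
      fun x => rfl
    refine ⟨(Q.subtype.comp φ).range, ?_, MonoidHom.ofInjective inj, ⟨g, ?_⟩, ⟨g⁻¹, ?_⟩, ?_⟩
    · rintro _ ⟨x, rfl⟩
      exact (φ x).2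
    · intro x
      exact hg x
    · intro y
      obtain ⟨x, rfl⟩ := (MonoidHom.ofInjective inj).surjective y
      have h1 : (MonoidHom.ofInjective inj).symm.toMonoidHom (MonoidHom.ofInjective inj x) = x :=
        (MonoidHom.ofInjective inj).symm_apply_apply x
      rw [h1, he, hg]
      group
    · ext x
      rfl

/-- The finite group `G` realizes `F` via `ι : S → G`: the map `ι` identifies `S` with a Sylow
`p`-subgroup of `G`, and `F` is the fusion system of `G` on `S`. -/
def IsRealizedBy (p : ℕ) (F : FusionSystem S) {G : Type u} [Group G] (ι : S →* G) : Prop :=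
  ∃ hι : Function.Injective ι,
    (∃ T : Sylow p G, (T : Subgroup G) = ι.range) ∧ F = ofGroup ι hι

/-- `F` is realizable by a finite group. -/
def IsRealizable (p : ℕ) (F : FusionSystem S) : Prop :=
  ∃ (G : Type u) (_ : Group G) (_ : Finite G) (ι : S →* G), F.IsRealizedBy p ι

/-- `F` has a model: a finite group `G` that realizes `F` and has `C_G(O_p(G)) ≤ O_p(G)`. -/
def HasModel (p : ℕ) (F : FusionSystem S) : Prop :=
  ∃ (G : Type u) (_ : Group G) (_ : Finite G) (ι : S →* G), F.IsRealizedBy p ι ∧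
    Subgroup.centralizer (groupOp p G : Set G) ≤ groupOp p G

theorem isNormal_bot (F : FusionSystem S) : F.IsNormal ⊥ := by
  refine ⟨inferInstance, fun P R φ hφ => ?_⟩
  have h1 : P ⊔ ⊥ ≤ P := by simp
  have h2 : R ≤ R ⊔ ⊥ := le_sup_left
  have m1 : Subgroup.inclusion h1 ∈ F.hom _ _ := F.conj_mem _ 1 fun x => by simp
  have m2 : Subgroup.inclusion h2 ∈ F.hom _ _ := F.conj_mem _ 1 fun x => by simp
  refine ⟨_, F.comp_mem (F.comp_mem m1 hφ) m2, fun x => rfl, ?_⟩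
  simp [Subgroup.map_bot]

theorem IsNormal.sup {F : FusionSystem S} {Q₁ Q₂ : Subgroup S} (h₁ : F.IsNormal Q₁)
    (h₂ : F.IsNormal Q₂) : F.IsNormal (Q₁ ⊔ Q₂) := by
  have n₁ := h₁.1
  have n₂ := h₂.1
  refine ⟨inferInstance, fun P R φ hφ => ?_⟩
  obtain ⟨ψ, hψ, e₁, i₁⟩ := h₁.2 P R φ hφ
  obtain ⟨χ, hχ, e₂, i₂⟩ := h₂.2 _ _ ψ hψ
  have a : P ⊔ (Q₁ ⊔ Q₂) ≤ P ⊔ Q₁ ⊔ Q₂ := (sup_assoc _ _ _).ge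
  have b : R ⊔ Q₁ ⊔ Q₂ ≤ R ⊔ (Q₁ ⊔ Q₂) := (sup_assoc _ _ _).le
  have m1 : Subgroup.inclusion a ∈ F.hom _ _ := F.conj_mem _ 1 fun x => by simp
  have m2 : Subgroup.inclusion b ∈ F.hom _ _ := F.conj_mem _ 1 fun x => by simp
  refine ⟨_, F.comp_mem (F.comp_mem m1 hχ) m2, fun x => ?_, ?_⟩
  · rw [← e₁ x, ← e₂]
    rfl
  · have l₁ : Q₁ ≤ P ⊔ (Q₁ ⊔ Q₂) := le_sup_left.trans le_sup_right
    have l₂ : Q₂ ≤ P ⊔ (Q₁ ⊔ Q₂) := le_sup_right.trans le_sup_right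
    apply Subgroup.map_injective (Subgroup.subtype_injective (R ⊔ (Q₁ ⊔ Q₂)))
    rw [Subgroup.map_map, Subgroup.subgroupOf_map_subtype, inf_of_le_left le_sup_right,
      Subgroup.subgroupOf_sup l₁ l₂, Subgroup.map_sup]
    congr 1
    · ext y
      constructor
      · rintro ⟨x, hx, rfl⟩
        have hx' : (x : S) ∈ Q₁ := hx
        have h : ψ ⟨x, le_sup_right (a := P) hx'⟩ ∈ Q₁.subgroupOf (R ⊔ Q₁) :=
          i₁ ▸ Subgroup.mem_map_of_mem ψ hx'
        have h' := e₂ ⟨x, le_sup_right (a := P) hx'⟩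
        change ((χ (Subgroup.inclusion a x) : (R ⊔ Q₁ ⊔ Q₂ : Subgroup S)) : S) ∈ Q₁
        exact h' ▸ h
      · intro hy
        have hy' : (⟨y, le_sup_right (a := R) hy⟩ : (R ⊔ Q₁ : Subgroup S)) ∈
            Q₁.subgroupOf (R ⊔ Q₁) := hy
        rw [← i₁] at hy'
        obtain ⟨x, hx, hxy⟩ := hy'
        have hx' : (x : S) ∈ Q₁ := hx
        refine ⟨⟨x, l₁ hx'⟩, hx', ?_⟩
        exact (e₂ x).trans (congrArg Subtype.val hxy)
    · ext y
      constructor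
      · rintro ⟨x, hx, rfl⟩
        have h : χ (Subgroup.inclusion a x) ∈ Q₂.subgroupOf (R ⊔ Q₁ ⊔ Q₂) :=
          i₂ ▸ Subgroup.mem_map_of_mem χ hx
        exact h
      · intro hy
        have hy' : (⟨y, le_sup_right (a := R ⊔ Q₁) hy⟩ : (R ⊔ Q₁ ⊔ Q₂ : Subgroup S)) ∈
            Q₂.subgroupOf (R ⊔ Q₁ ⊔ Q₂) := hy
        rw [← i₂] at hy'
        obtain ⟨x, hx, hxy⟩ := hy'
        exact ⟨⟨x, l₂ hx⟩, hx, congrArg Subtype.val hxy⟩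

theorem isGreatest_Op [Finite S] (F : FusionSystem S) :
    IsGreatest {Q | F.IsNormal Q} F.Op := by
  refine ⟨?_, fun Q hQ => le_sSup hQ⟩
  obtain ⟨M, hM, hmax⟩ := Set.Finite.exists_maximal (Set.toFinite {Q | F.IsNormal Q})
    ⟨⊥, F.isNormal_bot⟩
  have h : F.Op = M := le_antisymm
    (sSup_le fun Q hQ => le_sup_right.trans (hmax (hM.sup hQ) le_sup_left)) (le_sSup hM)
  exact h ▸ hM

end FusionSystem

/-- On the field with `p ^ 2` elements, `star` is the automorphism `x ↦ x ^ p` of order two, so that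
`Matrix.specialUnitaryGroup (Fin n) (GaloisField p 2)` is the finite unitary group `SU_n(p)`, taken
with respect to the standard Hermitian form. -/
noncomputable instance galoisFieldStarRing (p : ℕ) [Fact p.Prime] :
    StarRing (GaloisField p 2) where
  star x := x ^ p
  star_involutive x := by
    have := Fintype.ofFinite (GaloisField p 2)
    have h : Fintype.card (GaloisField p 2) = p ^ 2 := by
      rw [← Nat.card_eq_fintype_card, GaloisField.card p 2 two_ne_zero]
    change (x ^ p) ^ p = x
    rw [← pow_mul, ← sq, ← h, FiniteField.pow_card]
  star_mul x y := by
    change (x * y) ^ p = y ^ p * x ^ p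
    rw [mul_pow, mul_comm]
  star_add x y := by
    change (x + y) ^ p = x ^ p + y ^ p
    exact add_pow_char x y p

/-!
The Sylow `p`-subgroup `S` of `SU₄(p)`, `p` odd, has order `p ^ 6`.  It is described by explicit
coordinates (`UnitaryUnipotent`, identified with `S` in `nonempty_sylow_mulEquiv`).  Four subgroups
matter: the centre `Z` of order `p`, the second centre `W` of order `p ^ 3`, the abelian subgroup `V`
of order `p ^ 4` and the extraspecial subgroup `Q` of order `p ^ 5`, with `W = V ∩ Q`.

The main tool for restricting essential subgroups `E` is `IsEssential.mem_of_chain`: since `Out_F(E)`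
has a strongly embedded subgroup, it has no nontrivial normal `p`-subgroup, so an element of `S` that
stabilizes a chain of `Aut_F(E)`-invariant subgroups of `E` already lies in `E`.  Suppose that
`N = O_p(F)` is not trivial.  Then `N ≤ E` is invariant, and `Z ≤ Z(N) ≤ V`, because `V` contains
all abelian normal subgroups of `S`.  So `W` stabilizes the chain `E ≥ Z(N) ≥ 1`, whence `W ≤ E`.
Chains built from characteristic subgroups of `E` then leave only `E = V` and `E = Q`
(`IsEssential.eq_V_or_eq_Q`).  If both were essential, then `Z ≤ N ≤ W`.  If `N = Z`, then
Sylow's theorem in `Aut_F(V)` gives a contradiction (`not_isEssential_V_of_invariant`).  If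
`N / Z` has order `p`, the automorphisms of `V` that act trivially on `N` and those that act
trivially on `V / N` form two commuting normal subgroups of order divisible by `p`, which a strongly
embedded subgroup does not allow (`IsEssential.mem_or_mem`).  If `N = W`, the chain `Q ≥ W ≥ Z ≥ 1`
forces `S ≤ Q`.

Thus there is at most one essential subgroup, and as `V` and `Q` are invariant under `Aut_F(S)`,
Alperin's fusion theorem (`IsSaturated.morphism_induction`) shows that it is normal in `F`; if there is
none, then `S` itself is normal.  In both cases `F` is constrained.

The existence of a model of a saturated fusion system with a normal centric subgroup `D`
(`IsNormal.hasModel`) is proved without cohomology.  An `S`-`S`-biset over `Aut_F(D)` is assembled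
from one piece for each double coset of `Aut_S(D)` (`IsReceptive.nonempty_modelBiset`).  Its
permutations that commute with the right action of `S` and lie over left multiplications in
`Aut_F(D)` form an extension of `Aut_F(D)` by a module induced from `Z(D)`, and dividing out the
kernel of the norm map of this module leaves an extension of `Aut_F(D)` by `Z(D)`, which is the
model.
-/


/-! ### Morphisms of a fusion system as functions on `S` -/

namespace FusionSystem

variable {S : Type u} [Group S]

/-- `F.Mor P f`: the restriction of `f : S → S` to `P` is a morphism `P → S` of `F`.  The values of
`f` outside `P` are irrelevant; working with total functions avoids maps between subtypes. -/
def Mor (F : FusionSystem S) (P : Subgroup S) (f : S → S) : Prop :=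
  ∃ φ ∈ F.hom P ⊤, ∀ x : P, ((φ x : (⊤ : Subgroup S)) : S) = f x

/-- `F.IsoOn P Q f`: the function `f` restricts to an isomorphism `P → Q` of `F`. -/
def IsoOn (F : FusionSystem S) (P Q : Subgroup S) (f : S → S) : Prop :=
  F.Mor P f ∧ f '' P = Q

open Classical in
/-- The total function that agrees with `φ` on `P` and with the identity elsewhere. -/
noncomputable def total {P Q : Subgroup S} (φ : P → Q) : S → S :=
  fun x => if h : x ∈ P then φ ⟨x, h⟩ else x

theorem total_apply {P Q : Subgroup S} (φ : P → Q) (x : P) : total φ x = φ x := by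
  simp [total]

theorem total_of_mem {P Q : Subgroup S} (φ : P → Q) {x : S} (h : x ∈ P) :
    total φ x = φ ⟨x, h⟩ := by
  simp [total, h]

variable {F : FusionSystem S} {P Q R : Subgroup S} {f g : S → S}

theorem Mor.congr (h : F.Mor P f) (e : ∀ x ∈ P, f x = g x) : F.Mor P g := by
  obtain ⟨φ, hφ, hf⟩ := h
  exact ⟨φ, hφ, fun x => (hf x).trans (e x x.2)⟩

theorem inclusion_mem (F : FusionSystem S) (h : P ≤ Q) : Subgroup.inclusion h ∈ F.hom P Q :=
  F.conj_mem _ 1 fun x => by simp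

theorem Mor.mono (h : F.Mor P f) (hR : R ≤ P) : F.Mor R f := by
  obtain ⟨φ, hφ, hf⟩ := h
  exact ⟨_, F.comp_mem (F.inclusion_mem hR) hφ, fun x => hf (Subgroup.inclusion hR x)⟩

theorem mor_of_mem_hom {φ : P →* Q} (hφ : φ ∈ F.hom P Q) (hf : ∀ x : P, (φ x : S) = f x) :
    F.Mor P f :=
  ⟨_, F.comp_mem hφ (F.inclusion_mem le_top), hf⟩

theorem mem_hom_of_mor {φ : P →* Q} (h : F.Mor P f) (hf : ∀ x : P, (φ x : S) = f x) :
    φ ∈ F.hom P Q := by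
  obtain ⟨ψ, hψ, hψf⟩ := h
  obtain ⟨R, hR, e, he, -, rfl⟩ := F.exists_iso hψ
  have key : ∀ x : P, (e x : S) = φ x := fun x => by rw [hf, ← hψf]; rfl
  have hRQ : R ≤ Q := fun y hy => by
    have := key (e.symm ⟨y, hy⟩)
    simp only [MulEquiv.apply_symm_apply] at this
    exact this ▸ (φ _).2
  have : φ = (Subgroup.inclusion hRQ).comp e.toMonoidHom := by
    ext x
    exact (key x).symm
  rw [this]
  exact F.comp_mem he (F.inclusion_mem hRQ)

theorem Mor.map_mul (h : F.Mor P f) {x y : S} (hx : x ∈ P) (hy : y ∈ P) :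
    f (x * y) = f x * f y := by
  obtain ⟨φ, -, hf⟩ := h
  have := hf (⟨x, hx⟩ * ⟨y, hy⟩)
  rw [_root_.map_mul, Subgroup.coe_mul, hf, hf] at this
  exact this.symm

theorem Mor.map_one (h : F.Mor P f) : f 1 = 1 := by
  have := h.map_mul P.one_mem P.one_mem
  simpa using this

theorem Mor.map_inv (h : F.Mor P f) {x : S} (hx : x ∈ P) : f x⁻¹ = (f x)⁻¹ := by
  rw [eq_inv_iff_mul_eq_one, ← h.map_mul (P.inv_mem hx) hx, inv_mul_cancel, h.map_one]

theorem Mor.map_conj (h : F.Mor P f) {x y : S} (hx : x ∈ P) (hy : y ∈ P) :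
    f (x * y * x⁻¹) = f x * f y * (f x)⁻¹ := by
  rw [h.map_mul (P.mul_mem hx hy) (P.inv_mem hx), h.map_mul hx hy, h.map_inv hx]

theorem Mor.injOn (h : F.Mor P f) : Set.InjOn f P := by
  obtain ⟨φ, hφ, hf⟩ := h
  intro x hx y hy hxy
  have := F.injective_of_mem hφ (a₁ := ⟨x, hx⟩) (a₂ := ⟨y, hy⟩)
    (Subtype.ext ((hf ⟨x, hx⟩).trans (hxy.trans (hf ⟨y, hy⟩).symm)))
  exact congrArg Subtype.val this

theorem mor_conj (F : FusionSystem S) (P : Subgroup S) (s : S) :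
    F.Mor P fun x => s * x * s⁻¹ :=
  ⟨(Subgroup.inclusion le_top).comp ((MulAut.conj s).toMonoidHom.comp P.subtype |>.codRestrict ⊤
    fun _ => Subgroup.mem_top _), F.conj_mem _ s fun _ => rfl, fun _ => rfl⟩

theorem mor_id (F : FusionSystem S) (P : Subgroup S) : F.Mor P id :=
  (F.mor_conj P 1).congr fun x _ => by simp

theorem Mor.comp (hg : F.Mor Q g) (hf : F.Mor P f) (hPQ : ∀ x ∈ P, f x ∈ Q) :
    F.Mor P fun x => g (f x) := by
  let φ : P →* Q := MonoidHom.mk' (fun x => ⟨f x, hPQ x x.2⟩) fun x y =>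
    Subtype.ext (hf.map_mul x.2 y.2)
  have hφ : φ ∈ F.hom P Q := mem_hom_of_mor hf fun x => rfl
  obtain ⟨ψ, hψ, hψg⟩ := hg
  exact ⟨_, F.comp_mem hφ hψ, fun x => hψg (φ x)⟩

/-- The image of a morphism. -/
def Mor.im (h : F.Mor P f) : Subgroup S where
  carrier := f '' P
  mul_mem' := by
    rintro _ _ ⟨x, hx, rfl⟩ ⟨y, hy, rfl⟩
    exact ⟨x * y, P.mul_mem hx hy, h.map_mul hx hy⟩
  one_mem' := ⟨1, P.one_mem, h.map_one⟩
  inv_mem' := by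
    rintro _ ⟨x, hx, rfl⟩
    exact ⟨x⁻¹, P.inv_mem hx, h.map_inv hx⟩

theorem Mor.isoOn (h : F.Mor P f) : F.IsoOn P h.im f := ⟨h, rfl⟩

theorem IsoOn.mem (h : F.IsoOn P Q f) {x : S} (hx : x ∈ P) : f x ∈ Q := by
  rw [← SetLike.mem_coe, ← h.2]
  exact ⟨x, hx, rfl⟩

theorem IsoOn.exists_eq (h : F.IsoOn P Q f) {y : S} (hy : y ∈ Q) : ∃ x ∈ P, f x = y := by
  rw [← SetLike.mem_coe, ← h.2] at hy
  exact hy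

theorem isoOn_of_forall (h : F.Mor P f) (h1 : ∀ x ∈ P, f x ∈ Q) (h2 : ∀ y ∈ Q, ∃ x ∈ P, f x = y) :
    F.IsoOn P Q f :=
  ⟨h, Set.Subset.antisymm (by rintro _ ⟨x, hx, rfl⟩; exact h1 x hx) h2⟩

theorem IsoOn.congr (h : F.IsoOn P Q f) (e : ∀ x ∈ P, f x = g x) : F.IsoOn P Q g :=
  ⟨h.1.congr e, by rw [← h.2]; exact (Set.image_congr e).symm⟩

theorem IsoOn.comp (hg : F.IsoOn Q R g) (hf : F.IsoOn P Q f) : F.IsoOn P R fun x => g (f x) :=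
  isoOn_of_forall (hg.1.comp hf.1 fun _ => hf.mem) (fun _ hx => hg.mem (hf.mem hx)) fun y hy => by
    obtain ⟨z, hz, rfl⟩ := hg.exists_eq hy
    obtain ⟨x, hx, rfl⟩ := hf.exists_eq hz
    exact ⟨x, hx, rfl⟩

theorem isoOn_of_mem_hom {e : P ≃* Q} (he : e.toMonoidHom ∈ F.hom P Q)
    (hf : ∀ x : P, (e x : S) = f x) : F.IsoOn P Q f :=
  isoOn_of_forall (mor_of_mem_hom he hf) (fun x hx => hf ⟨x, hx⟩ ▸ (e _).2) fun y hy =>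
    ⟨e.symm ⟨y, hy⟩, (e.symm ⟨y, hy⟩).2, by rw [← hf]; simp⟩

/-- The isomorphism of groups given by an isomorphism of `F`. -/
noncomputable def IsoOn.equiv (h : F.IsoOn P Q f) : P ≃* Q :=
  MulEquiv.ofBijective (MonoidHom.mk' (fun x => ⟨f x, h.mem x.2⟩) fun x y =>
    Subtype.ext (h.1.map_mul x.2 y.2))
    ⟨fun x y hxy => Subtype.ext (h.1.injOn x.2 y.2 (congrArg Subtype.val hxy)), fun y => by
      obtain ⟨x, hx, hxy⟩ := h.exists_eq y.2
      exact ⟨⟨x, hx⟩, Subtype.ext hxy⟩⟩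

theorem IsoOn.equiv_apply (h : F.IsoOn P Q f) (x : P) : (h.equiv x : S) = f x := rfl

theorem IsoOn.equiv_mem (h : F.IsoOn P Q f) : h.equiv.toMonoidHom ∈ F.hom P Q :=
  mem_hom_of_mor h.1 h.equiv_apply

theorem IsoOn.symm (h : F.IsoOn P Q f) :
    ∃ g, F.IsoOn Q P g ∧ (∀ x ∈ P, g (f x) = x) ∧ ∀ y ∈ Q, f (g y) = y := by
  refine ⟨total h.equiv.symm, isoOn_of_mem_hom (F.symm_mem _ h.equiv_mem) fun x =>
    (total_apply _ _).symm, fun x hx => ?_, fun y hy => ?_⟩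
  · rw [total_of_mem _ (h.mem hx)]
    exact congrArg Subtype.val (h.equiv.symm_apply_apply ⟨x, hx⟩)
  · rw [total_of_mem _ hy, ← h.equiv_apply]
    simp

theorem IsConj.exists_isoOn (h : F.IsConj P Q) : ∃ f, F.IsoOn P Q f := by
  obtain ⟨e, he⟩ := h
  exact ⟨total e, isoOn_of_mem_hom he fun x => (total_apply e x).symm⟩

theorem IsoOn.card_eq (h : F.IsoOn P Q f) : Nat.card P = Nat.card Q :=
  Nat.card_congr h.equiv.toEquiv

theorem isoOn_self [Finite S] (h : F.Mor P f) (hP : ∀ x ∈ P, f x ∈ P) : F.IsoOn P P f := by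
  refine ⟨h, Set.eq_of_subset_of_ncard_le ?_ ?_⟩
  · rintro _ ⟨x, hx, rfl⟩
    exact hP x hx
  · rw [h.injOn.ncard_image]

theorem IsoOn.mem_aut (h : F.IsoOn P P f) : (h.equiv : MulAut P) ∈ F.aut P := h.equiv_mem

theorem isoOn_total (α : F.aut P) : F.IsoOn P P (total (α : MulAut P)) :=
  isoOn_of_mem_hom α.2 fun x => (total_apply _ x).symm

/-- Every automorphism induced by conjugation in `S` belongs to `F`. -/
theorem autBase_le (F : FusionSystem S) (P : Subgroup S) : autBase P ≤ F.aut P := by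
  rintro _ ⟨s, rfl⟩
  exact F.conj_mem _ s fun x => rfl

theorem inn_le_autBase (P : Subgroup S) : inn P ≤ autBase P := by
  rintro _ ⟨x, rfl⟩
  exact ⟨⟨x, Subgroup.le_normalizer x.2⟩, by ext; rfl⟩

theorem mem_autBase_iff {α : MulAut P} :
    α ∈ autBase P ↔ ∃ s : S, ∀ x : P, (α x : S) = s * x * s⁻¹ := by
  constructor
  · rintro ⟨s, rfl⟩
    exact ⟨s, fun x => rfl⟩
  · rintro ⟨s, hs⟩
    have : s ∈ Subgroup.normalizer (P : Set S) := by
      rw [Subgroup.mem_normalizer_iff]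
      refine fun x => ⟨fun hx => hs ⟨x, hx⟩ ▸ (α _).2, fun hx => ?_⟩
      have h := hs (α.symm ⟨_, hx⟩)
      rw [MulEquiv.apply_symm_apply] at h
      have : x = (α.symm ⟨s * x * s⁻¹, hx⟩ : P) := by simpa using h
      rw [this]
      exact (α.symm _).2
    exact ⟨⟨s, this⟩, by ext x; exact (hs x).symm⟩

theorem mem_inn_iff {α : MulAut P} :
    α ∈ inn P ↔ ∃ s ∈ P, ∀ x : P, (α x : S) = s * x * s⁻¹ := by
  constructor
  · rintro ⟨s, rfl⟩
    exact ⟨s, s.2, fun x => rfl⟩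
  · rintro ⟨s, hs, h⟩
    exact ⟨⟨s, hs⟩, by ext x; exact (h x).symm⟩

/-- Receptiveness in terms of elements: an isomorphism `f : P → Q` extends to any `R ≥ P` whose
elements `r` satisfy `f c_r f⁻¹ ∈ Aut_S(Q)`. -/
theorem IsReceptive.exists_extension (hQ : F.IsReceptive Q) (hf : F.IsoOn P Q f)
    (hR : ∀ r ∈ R, ∀ x ∈ P, r * x * r⁻¹ ∈ P)
    (h : ∀ r ∈ R, ∃ q : S, ∀ x ∈ P, f (r * x * r⁻¹) = q * f x * q⁻¹) :
    ∃ g, F.Mor R g ∧ ∀ x ∈ P, g x = f x := by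
  obtain ⟨β, hβ, hβf⟩ := hQ P hf.equiv hf.equiv_mem
  have hle : R ≤ extender hf.equiv := by
    intro r hr
    have hn : r ∈ Subgroup.normalizer (P : Set S) := by
      rw [Subgroup.mem_normalizer_iff]
      refine fun x => ⟨hR r hr x, fun hx => ?_⟩
      have := hR r⁻¹ (R.inv_mem hr) _ hx
      simpa [mul_assoc] using this
    refine ⟨⟨r, hn⟩, ?_, rfl⟩
    obtain ⟨q, hq⟩ := h r hr
    refine mem_autBase_iff.2 ⟨q, fun y => ?_⟩
    have h1 := hq (hf.equiv.symm y) (hf.equiv.symm y).2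
    rw [← hf.equiv_apply (hf.equiv.symm y), MulEquiv.apply_symm_apply] at h1
    rw [← h1]
    rfl
  refine ⟨total β, (mor_of_mem_hom hβ fun x => (total_apply _ _).symm).mono hle, fun x hx => ?_⟩
  rw [total_of_mem _ (le_extender hf.equiv hx)]
  exact hβf ⟨x, hx⟩

end FusionSystem

/-! ### Fully automized, receptive and centric subgroups -/

namespace FusionSystem

variable {S : Type u} [Group S] {F : FusionSystem S} {P Q R : Subgroup S} {f g : S → S} {p : ℕ}

/-- If `Q` is fully automized and receptive, then every isomorphism `P → Q` of `F` can be extended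
to `N_S(P)` after composing it with an automorphism of `Q`: by Sylow's theorem in `Aut_F(Q)`, some
automorphism moves the image of `Aut_S(P)` into `Aut_S(Q)`. -/
theorem IsoOn.exists_normalizer_extension [Finite S] [Fact p.Prime] (hS : IsPGroup p S)
    (hQ : F.IsFullyAutomized p Q) (hQ' : F.IsReceptive Q) (hf : F.IsoOn P Q f) :
    ∃ χ g, F.IsoOn Q Q χ ∧ F.Mor (Subgroup.normalizer (P : Set S)) g ∧
      ∀ x ∈ P, g x = χ (f x) := by
  obtain ⟨T, hT⟩ := hQ
  let θ : Subgroup.normalizer (P : Set S) →* F.aut Q :=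
    ((MulAut.congr hf.equiv).toMonoidHom.comp P.normalizerMonoidHom).codRestrict (F.aut Q)
      fun s => F.comp_mem (F.comp_mem (F.symm_mem _ hf.equiv_mem)
        (F.autBase_le P ⟨s, rfl⟩)) hf.equiv_mem
  have hθ : ∀ s x, ((θ s : MulAut Q) (hf.equiv x) : S) = f (s * x * (s : S)⁻¹) := fun s x => by
    change ((hf.equiv (P.normalizerMonoidHom s (hf.equiv.symm (hf.equiv x)))) : S) = _
    rw [MulEquiv.symm_apply_apply, hf.equiv_apply]
    rfl
  have hp : IsPGroup p θ.range :=
    (hS.to_subgroup _).of_surjective θ.rangeRestrict θ.rangeRestrict_surjective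
  obtain ⟨T', hT'⟩ := hp.exists_le_sylow
  obtain ⟨c, hc⟩ := MulAction.exists_smul_eq (F.aut Q) T' T
  have hχ := isoOn_total c
  have hχf := hχ.comp hf
  obtain ⟨g, hg, hgf⟩ := hQ'.exists_extension (R := Subgroup.normalizer (P : Set S)) hχf
    (fun r hr x hx => ((Subgroup.mem_normalizer_iff.1 hr) x).1 hx) fun r hr => by
      have h1 : c * θ ⟨r, hr⟩ * c⁻¹ ∈ (T : Subgroup (F.aut Q)) := by
        rw [← hc]
        exact Subgroup.smul_mem_pointwise_smul _ (MulAut.conj c) _ (hT' ⟨_, rfl⟩)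
      rw [hT] at h1
      obtain ⟨q, hq⟩ := mem_autBase_iff.1 (Subgroup.mem_subgroupOf.1 h1)
      refine ⟨q, fun x hx => ?_⟩
      have h2 := hq ((c : MulAut Q) (hf.equiv ⟨x, hx⟩))
      have h3 : ((c * θ ⟨r, hr⟩ * c⁻¹ : F.aut Q) : MulAut Q) ((c : MulAut Q) (hf.equiv ⟨x, hx⟩)) =
          (c : MulAut Q) ((θ ⟨r, hr⟩ : MulAut Q) (hf.equiv ⟨x, hx⟩)) := by
        simp [MulAut.mul_apply]
      rw [h3, ← total_apply (c : MulAut Q), ← total_apply (c : MulAut Q), hθ] at h2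
      exact h2
  exact ⟨_, g, hχ, hg, hgf⟩

theorem Mor.map_normalizer (hg : F.Mor (Subgroup.normalizer (P : Set S)) g) (hPQ : F.IsoOn P Q g)
    {s : S} (hs : s ∈ Subgroup.normalizer (P : Set S)) :
    g s ∈ Subgroup.normalizer (Q : Set S) := by
  have key : ∀ t ∈ Subgroup.normalizer (P : Set S), ∀ y ∈ Q, g t * y * (g t)⁻¹ ∈ Q := by
    intro t ht y hy
    obtain ⟨x, hx, rfl⟩ := hPQ.exists_eq hy
    rw [← hg.map_conj ht (Subgroup.le_normalizer hx)]
    exact hPQ.mem ((Subgroup.mem_normalizer_iff.1 ht x).1 hx)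
  rw [Subgroup.mem_normalizer_iff]
  refine fun y => ⟨key s hs y, fun hy => ?_⟩
  have := key s⁻¹ (inv_mem hs) _ hy
  simpa [hg.map_inv hs, mul_assoc] using this

theorem card_normalizer_le [Finite S] [Fact p.Prime] (hS : IsPGroup p S)
    (hQ : F.IsFullyAutomized p Q) (hQ' : F.IsReceptive Q) (hf : F.IsoOn P Q f) :
    Nat.card (Subgroup.normalizer (P : Set S)) ≤ Nat.card (Subgroup.normalizer (Q : Set S)) := by
  obtain ⟨χ, g, hχ, hg, hgf⟩ := hf.exists_normalizer_extension hS hQ hQ'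
  have hPQ : F.IsoOn P Q g := (hχ.comp hf).congr fun x hx => (hgf x hx).symm
  refine Nat.card_le_card_of_injective
    (fun s => (⟨g s, hg.map_normalizer hPQ s.2⟩ : Subgroup.normalizer (Q : Set S))) ?_
  intro s t hst
  exact Subtype.ext (hg.injOn s.2 t.2 (congrArg Subtype.val hst))

theorem isFullyNormalized_of_isReceptive [Finite S] [Fact p.Prime] (hS : IsPGroup p S)
    (hQ : F.IsFullyAutomized p Q) (hQ' : F.IsReceptive Q) : F.IsFullyNormalized Q := by
  rintro P hP
  obtain ⟨f, hf⟩ := hP.exists_isoOn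
  obtain ⟨g, hg, -⟩ := hf.symm
  exact card_normalizer_le hS hQ hQ' hg

theorem IsSaturated.exists_isoOn (hF : F.IsSaturated p) (P : Subgroup S) :
    ∃ Q f, F.IsoOn P Q f ∧ F.IsFullyAutomized p Q ∧ F.IsReceptive Q := by
  obtain ⟨Q, h, h1, h2⟩ := hF P
  obtain ⟨f, hf⟩ := h.exists_isoOn
  exact ⟨Q, f, hf, h1, h2⟩

/-- A normal subgroup of `S` that is invariant under `Aut_F(S)` is fully automized and receptive:
the extension of an isomorphism onto a fully automized receptive conjugate is defined on `S`. -/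
theorem IsSaturated.isFullyAutomized_of_invariant [Finite S] [Fact p.Prime] (hS : IsPGroup p S)
    (hF : F.IsSaturated p) [hQ : Q.Normal]
    (h : ∀ f, F.Mor ⊤ f → ∀ x ∈ Q, f x ∈ Q) : F.IsFullyAutomized p Q ∧ F.IsReceptive Q := by
  obtain ⟨R, f, hf, h1, h2⟩ := hF.exists_isoOn Q
  obtain ⟨χ, g, hχ, hg, hgf⟩ := hf.exists_normalizer_extension hS h1 h2
  rw [Subgroup.normalizer_eq_top] at hg
  have hQR : F.IsoOn Q R g := (hχ.comp hf).congr fun x hx => (hgf x hx).symm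
  have hQQ : F.IsoOn Q Q g := isoOn_self (hg.mono le_top) (h g hg)
  have : R = Q := SetLike.coe_injective (hQR.2.symm.trans hQQ.2)
  subst this
  exact ⟨h1, h2⟩

theorem IsCentric.centralizer_le (h : F.IsCentric P) :
    Subgroup.centralizer (P : Set S) ≤ P := by
  rw [h P ⟨MulEquiv.refl P, F.inclusion_mem le_rfl⟩]
  exact Subgroup.map_subtype_le _

theorem centralizer_eq_map_center (h : Subgroup.centralizer (P : Set S) ≤ P) :
    Subgroup.centralizer (P : Set S) = (Subgroup.center P).map P.subtype := by
  ext x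
  simp only [Subgroup.mem_centralizer_iff, Subgroup.mem_map, Subgroup.mem_center_iff]
  constructor
  · intro hx
    exact ⟨⟨x, h hx⟩, fun y => Subtype.ext (hx y y.2), rfl⟩
  · rintro ⟨y, hy, rfl⟩ z hz
    exact congrArg Subtype.val (hy ⟨z, hz⟩)

/-- A receptive subgroup that contains its centralizer is centric: an isomorphism from a conjugate
`P` extends to `P C_S(P)`, which it maps into `Q C_S(Q) = Q`. -/
theorem IsReceptive.isCentric (hQ : F.IsReceptive Q)
    (h : Subgroup.centralizer (Q : Set S) ≤ Q) : F.IsCentric Q := by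
  rintro P hP
  apply centralizer_eq_map_center
  obtain ⟨f₀, hf₀⟩ := hP.exists_isoOn
  obtain ⟨f, hf, -⟩ := hf₀.symm
  have hconj : ∀ r ∈ P ⊔ Subgroup.centralizer (P : Set S), ∃ q ∈ P, ∀ x ∈ P,
      r * x * r⁻¹ = q * x * q⁻¹ := by
    intro r hr
    rw [Subgroup.sup_eq_closure] at hr
    induction hr using Subgroup.closure_induction with
    | mem r hr =>
      rcases hr with hr | hr
      · exact ⟨r, hr, fun x _ => rfl⟩
      · refine ⟨1, P.one_mem, fun x hx => ?_⟩
        rw [← Subgroup.mem_centralizer_iff.1 hr x hx]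
        simp
    | inv r hr ihr =>
      obtain ⟨q, hq, h1⟩ := ihr
      refine ⟨q⁻¹, P.inv_mem hq, fun x hx => ?_⟩
      have h2 := h1 _ (P.mul_mem (P.mul_mem (P.inv_mem hq) hx) hq)
      rw [show q * (q⁻¹ * x * q) * q⁻¹ = x by group] at h2
      nth_rw 1 [← h2]
      group
    | one => exact ⟨1, P.one_mem, fun x _ => rfl⟩
    | mul r s hr hs ihr ihs =>
      obtain ⟨q, hq, h1⟩ := ihr
      obtain ⟨t, ht, h2⟩ := ihs
      refine ⟨q * t, P.mul_mem hq ht, fun x hx => ?_⟩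
      have h3 := h1 _ (P.mul_mem (P.mul_mem ht hx) (P.inv_mem ht))
      rw [← h2 x hx] at h3
      rw [mul_inv_rev, mul_inv_rev, show r * s * x * (s⁻¹ * r⁻¹) = r * (s * x * s⁻¹) * r⁻¹ by group,
        h3, h2 x hx]
      group
  obtain ⟨g, hg, hgf⟩ := hQ.exists_extension (R := P ⊔ Subgroup.centralizer (P : Set S)) hf
    (fun r hr x hx => by
      obtain ⟨q, hq, h1⟩ := hconj r hr
      rw [h1 x hx]
      exact P.mul_mem (P.mul_mem hq hx) (P.inv_mem hq))
    fun r hr => by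
      obtain ⟨q, hq, h1⟩ := hconj r hr
      refine ⟨f q, fun x hx => ?_⟩
      rw [h1 x hx, hf.1.map_conj hq hx]
  intro c hc
  have hc' := (le_sup_right : _ ≤ P ⊔ Subgroup.centralizer (P : Set S)) hc
  have h1 : g c ∈ Q := by
    apply h
    rw [Subgroup.mem_centralizer_iff]
    intro y hy
    obtain ⟨x, hx, rfl⟩ := hf.exists_eq hy
    have hx' := (le_sup_left : P ≤ P ⊔ Subgroup.centralizer (P : Set S)) hx
    rw [← hgf x hx, ← hg.map_mul hx' hc', ← hg.map_mul hc' hx',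
      Subgroup.mem_centralizer_iff.1 hc x hx]
  obtain ⟨x, hx, hxc⟩ := hf.exists_eq h1
  rw [← hgf x hx] at hxc
  rw [← hg.injOn ((le_sup_left : P ≤ P ⊔ Subgroup.centralizer (P : Set S)) hx) hc' hxc]
  exact hx

/-! ### Normal subgroups of a fusion system -/

theorem IsNormal.exists_extension (hQ : F.IsNormal Q) (hf : F.Mor P f) :
    ∃ g, F.Mor (P ⊔ Q) g ∧ (∀ x ∈ P, g x = f x) ∧ F.IsoOn Q Q g := by
  obtain ⟨φ, hφ, hφf⟩ := hf
  obtain ⟨ψ, hψ, h1, h2⟩ := hQ.2 P ⊤ φ hφ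
  have hg : F.Mor (P ⊔ Q) (total ψ) := mor_of_mem_hom hψ fun x => (total_apply _ x).symm
  refine ⟨total ψ, hg, fun x hx => ?_, isoOn_of_forall (hg.mono le_sup_right) ?_ ?_⟩
  · rw [total_of_mem _ ((le_sup_left : P ≤ P ⊔ Q) hx), ← hφf ⟨x, hx⟩, ← h1]
    rfl
  · intro x hx
    rw [total_of_mem _ ((le_sup_right : Q ≤ P ⊔ Q) hx)]
    have : ψ ⟨x, (le_sup_right : Q ≤ P ⊔ Q) hx⟩ ∈ (Q.subgroupOf (⊤ ⊔ Q)) := by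
      rw [← h2]
      exact ⟨_, hx, rfl⟩
    exact this
  · intro y hy
    have : (⟨y, (le_sup_right : Q ≤ ⊤ ⊔ Q) hy⟩ : (⊤ ⊔ Q : Subgroup S)) ∈
        (Q.subgroupOf (P ⊔ Q)).map ψ := by
      rw [h2]
      exact hy
    obtain ⟨x, hx, hxy⟩ := this
    exact ⟨x, hx, by rw [total_apply, hxy]⟩

theorem isNormal_of_forall (hQ : Q.Normal)
    (h : ∀ P f, F.Mor P f → ∃ g, F.Mor (P ⊔ Q) g ∧ (∀ x ∈ P, g x = f x) ∧ F.IsoOn Q Q g) :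
    F.IsNormal Q := by
  refine ⟨hQ, fun P R φ hφ => ?_⟩
  obtain ⟨g, hg, hgf, hgQ⟩ := h P (total φ) (mor_of_mem_hom hφ fun x => (total_apply _ x).symm)
  have hgR : ∀ x ∈ P ⊔ Q, g x ∈ R ⊔ Q := by
    intro x hx
    obtain ⟨y, hy, z, hz, rfl⟩ := Subgroup.mem_sup_of_normal_right.1 hx
    rw [hg.map_mul (le_sup_left (a := P) hy) (le_sup_right (a := P) hz)]
    refine Subgroup.mul_mem_sup ?_ (hgQ.mem hz)
    rw [hgf y hy, total_of_mem _ hy]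
    exact (φ _).2
  refine ⟨MonoidHom.mk' (fun x => ⟨g x, hgR x x.2⟩) fun x y => Subtype.ext (hg.map_mul x.2 y.2),
    mem_hom_of_mor hg fun x => rfl, fun x => ?_, ?_⟩
  · rw [← total_apply φ x, ← hgf x x.2]
    rfl
  · ext y
    constructor
    · rintro ⟨x, hx, rfl⟩
      exact hgQ.mem hx
    · intro hy
      obtain ⟨x, hx, hxy⟩ := hgQ.exists_eq hy
      exact ⟨⟨x, le_sup_right (a := P) hx⟩, hx, Subtype.ext hxy⟩

theorem IsNormal.isoOn (hQ : F.IsNormal Q) (hf : F.Mor P f) (h : Q ≤ P) : F.IsoOn Q Q f := by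
  obtain ⟨g, -, hgf, hg⟩ := hQ.exists_extension hf
  exact hg.congr fun x hx => hgf x (h hx)

theorem IsNormal.isFullyAutomized [Finite S] [Fact p.Prime] (hS : IsPGroup p S)
    (hF : F.IsSaturated p) (hQ : F.IsNormal Q) : F.IsFullyAutomized p Q ∧ F.IsReceptive Q :=
  have := hQ.1
  hF.isFullyAutomized_of_invariant hS fun _ hf _ hx => (hQ.isoOn hf le_top).mem hx

end FusionSystem

/-! ### Strongly embedded subgroups and chain stabilizers -/

theorem IsPGroup.dvd_orderOf_of_mem {p : ℕ} [Fact p.Prime] {G : Type*} [Group G]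
    {P : Subgroup G} (hP : IsPGroup p P) {x : G} (hxP : x ∈ P) (hx : x ≠ 1) : p ∣ orderOf x := by
  rw [← Subgroup.orderOf_mk x hxP]
  exact hP.dvd_orderOf fun h => hx (congrArg Subtype.val h)

theorem IsPGroup.exists_mem_normalizer {p : ℕ} [Fact p.Prime] {G : Type*} [Group G] [Finite G]
    (hG : IsPGroup p G) {P R : Subgroup G} (hPR : P < R) :
    ∃ r ∈ R, r ∉ P ∧ r ∈ Subgroup.normalizer (P : Set G) := by
  have : Group.IsNilpotent R := (hG.to_subgroup R).isNilpotent
  have hlt : P.subgroupOf R < ⊤ := by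
    rw [lt_top_iff_ne_top, Ne, Subgroup.subgroupOf_eq_top]
    exact hPR.not_ge
  obtain ⟨x, hx, hxP⟩ := SetLike.exists_of_lt (Group.normalizerCondition_of_isNilpotent _ hlt)
  refine ⟨x, x.2, hxP, ?_⟩
  rw [Subgroup.mem_normalizer_iff] at hx ⊢
  intro n
  constructor
  · intro hn
    exact (hx ⟨n, hPR.le hn⟩).1 hn
  · intro hn
    have hnR : n ∈ R := by
      have := R.mul_mem (R.mul_mem (R.inv_mem x.2) (hPR.le hn)) x.2
      simpa [mul_assoc] using this
    exact (hx ⟨n, hnR⟩).2 hn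

section StronglyEmbedded

variable {G : Type u} [Group G] {p : ℕ} {H : Subgroup G}

theorem IsStronglyEmbedded.mem_of_commute (hH : IsStronglyEmbedded p H) {y g : G} (hy : y ∈ H)
    (hp : p ∣ orderOf y) (hg : g * y = y * g) : g ∈ H := by
  by_contra hgH
  refine hH.2.2 g hgH (hp.trans ?_)
  rw [← Subgroup.orderOf_mk y (H := H ⊓ H.map (MulAut.conj g).toMonoidHom)
    ⟨hy, y, hy, by simp [MulAut.conj_apply, hg]⟩]
  exact orderOf_dvd_natCard _

theorem IsStronglyEmbedded.not_le_of_normal (hH : IsStronglyEmbedded p H) {A : Subgroup G}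
    [hA : A.Normal] (hp : p ∣ Nat.card A) : ¬ A ≤ H := by
  intro hAH
  refine hH.1 (eq_top_iff.2 fun g _ => ?_)
  by_contra hgH
  refine hH.2.2 g hgH (hp.trans (Subgroup.card_dvd_of_le (le_inf hAH fun a ha => ?_)))
  refine ⟨g⁻¹ * a * g, hAH ?_, by simp [MulAut.conj_apply, mul_assoc]⟩
  simpa using hA.conj_mem a ha g⁻¹

/-- A strongly embedded subgroup contains a Sylow subgroup: it contains an element `y` of order
`p`, hence a central element of a Sylow subgroup through `y`, hence that Sylow subgroup. -/
theorem IsStronglyEmbedded.exists_sylow_le [Finite G] [Fact p.Prime] (hH : IsStronglyEmbedded p H) :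
    ∃ T : Sylow p G, (T : Subgroup G) ≤ H := by
  obtain ⟨y, hy⟩ := exists_prime_orderOf_dvd_card' p hH.2.1
  have hyp : orderOf (y : G) = p := by rw [← hy, Subgroup.orderOf_coe]
  have hz : IsPGroup p (Subgroup.zpowers (y : G)) := by
    apply IsPGroup.of_card (n := 1)
    rw [Nat.card_zpowers, hyp, pow_one]
  obtain ⟨T, hT⟩ := hz.exists_le_sylow
  have hyT : (y : G) ∈ T := hT (Subgroup.mem_zpowers _)
  have hy1 : (y : G) ≠ 1 := by
    intro h
    rw [h, orderOf_one] at hyp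
    exact (Fact.out : p.Prime).one_lt.ne hyp
  have : Nontrivial T := ⟨⟨⟨y, hyT⟩, 1, fun h => hy1 (congrArg Subtype.val h)⟩⟩
  have := T.isPGroup'.center_nontrivial
  obtain ⟨z, hz1⟩ := exists_ne (1 : Subgroup.center T)
  have hzc : ∀ t ∈ T, t * (z : T) = (z : T) * t := fun t ht =>
    congrArg Subtype.val (Subgroup.mem_center_iff.1 z.2 ⟨t, ht⟩)
  have hzT : p ∣ orderOf ((z : T) : G) := T.isPGroup'.dvd_orderOf_of_mem (z : T).2 fun h =>
    hz1 (Subtype.ext (Subtype.ext h))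
  have hzH : ((z : T) : G) ∈ H :=
    hH.mem_of_commute y.2 (hyp ▸ dvd_rfl) (hzc y hyT).symm
  exact ⟨T, fun t ht => hH.mem_of_commute hzH hzT (hzc t ht)⟩

theorem IsStronglyEmbedded.eq_bot_of_isPGroup [Finite G] [Fact p.Prime]
    (hH : IsStronglyEmbedded p H) {A : Subgroup G} [hA : A.Normal] (hp : IsPGroup p A) : A = ⊥ := by
  by_contra hne
  obtain ⟨T, hT⟩ := hH.exists_sylow_le
  obtain ⟨T', hT'⟩ := hp.exists_le_sylow
  obtain ⟨g, hg⟩ := MulAction.exists_smul_eq G T' T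
  obtain ⟨a, ha1⟩ := A.ne_bot_iff_exists_ne_one.1 hne
  have hpA : p ∣ Nat.card A :=
    (hp.dvd_orderOf ha1).trans (orderOf_dvd_natCard a)
  refine hH.not_le_of_normal hpA (le_trans (fun x hx => ?_) hT)
  rw [← hg]
  have h1 : g⁻¹ * x * g ∈ (T' : Subgroup G) := hT' (by simpa using hA.conj_mem x hx g⁻¹)
  have h2 := Subgroup.smul_mem_pointwise_smul _ (MulAut.conj g) _ h1
  have h3 : MulAut.conj g • (g⁻¹ * x * g) = x := by simp [MulAut.conj_apply, mul_assoc]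
  rwa [h3] at h2

end StronglyEmbedded

/-- The automorphisms of `G` that stabilize the chain `G ≥ X₁ ≥ X₂ ≥ 1`. -/
def chainStabilizer {G : Type*} [Group G] (X₁ X₂ : Subgroup G) (h : X₂ ≤ X₁) :
    Subgroup (MulAut G) where
  carrier := {α | (∀ x, α x * x⁻¹ ∈ X₁) ∧ (∀ x ∈ X₁, α x * x⁻¹ ∈ X₂) ∧ ∀ x ∈ X₂, α x = x}
  mul_mem' := by
    rintro α β ⟨a1, a2, a3⟩ ⟨b1, b2, b3⟩
    have key : ∀ x, (α * β) x * x⁻¹ = α (β x * x⁻¹) * (β x * x⁻¹)⁻¹ * (β x * x⁻¹) *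
        (α x * x⁻¹) := fun x => by
      rw [MulAut.mul_apply, map_mul, map_inv]
      group
    refine ⟨fun x => ?_, fun x hx => ?_, fun x hx => ?_⟩
    · rw [key]
      exact X₁.mul_mem (X₁.mul_mem (h (a2 _ (b1 x))) (b1 x)) (a1 x)
    · rw [key, a3 _ (b2 x hx)]
      exact X₂.mul_mem (by simpa using b2 x hx) (a2 x hx)
    · rw [MulAut.mul_apply, b3 x hx, a3 x hx]
  one_mem' := by simp [X₁.one_mem, X₂.one_mem]
  inv_mem' := by
    rintro α ⟨a1, a2, a3⟩
    have key : ∀ x, α⁻¹ x * x⁻¹ = (α (α⁻¹ x) * (α⁻¹ x)⁻¹)⁻¹ := fun x => by simp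
    have h1 : ∀ x, α⁻¹ x * x⁻¹ ∈ X₁ := fun x => by
      rw [key]
      exact X₁.inv_mem (a1 _)
    refine ⟨h1, fun x hx => ?_, fun x hx => ?_⟩
    · rw [key]
      refine X₂.inv_mem (a2 _ ?_)
      simpa using X₁.mul_mem (h1 x) hx
    · nth_rw 1 [← a3 x hx]
      simp

theorem pow_apply_of_apply_eq {G : Type*} [Group G] (α : MulAut G) {x y : G} (hx : α x = y * x)
    (hy : α y = y) (n : ℕ) : (α ^ n) x = y ^ n * x := by
  induction n with
  | zero => simp
  | succ n ih => rw [pow_succ', MulAut.mul_apply, ih, map_mul, map_pow, hx, hy, pow_succ, mul_assoc]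

/-- In a finite `p`-group, chain stabilizers are `p`-groups. -/
theorem isPGroup_chainStabilizer {p : ℕ} [Fact p.Prime] {G : Type*} [Group G] [Finite G]
    (hG : IsPGroup p G) {X₁ X₂ : Subgroup G} (h : X₂ ≤ X₁) :
    IsPGroup p (chainStabilizer X₁ X₂ h) := by
  obtain ⟨n, hn⟩ := IsPGroup.iff_card.1 hG
  have hpow : ∀ y : G, y ^ p ^ n = 1 := fun y => by rw [← hn, pow_card_eq_one']
  rintro ⟨α, a1, a2, a3⟩
  have h1 : ∀ x ∈ X₁, (α ^ p ^ n) x = x := fun x hx => by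
    rw [pow_apply_of_apply_eq α (y := α x * x⁻¹) (by simp) (a3 _ (a2 x hx)), hpow, one_mul]
  refine ⟨n + n, Subtype.ext (MulEquiv.ext fun x => ?_)⟩
  have h2 : (α ^ p ^ n) x * x⁻¹ ∈ X₁ :=
    ((chainStabilizer X₁ X₂ h).pow_mem (x := α) ⟨a1, a2, a3⟩ _).1 x
  change (α ^ p ^ (n + n)) x = x
  rw [pow_add, pow_mul,
    pow_apply_of_apply_eq (α ^ p ^ n) (y := (α ^ p ^ n) x * x⁻¹) (by simp) (h1 _ h2), hpow, one_mul]

namespace FusionSystem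

variable {S : Type u} [Group S] {F : FusionSystem S} {P Q R E N : Subgroup S} {f g : S → S} {p : ℕ}

/-! ### Essential subgroups -/

theorem IsEssential.le_inn [Finite S] [Fact p.Prime] (hE : F.IsEssential p E)
    {Γ : Subgroup (F.aut E)} [hΓ : Γ.Normal] (hp : IsPGroup p Γ) :
    Γ ≤ (inn E).subgroupOf (F.aut E) := by
  obtain ⟨-, -, H, hH⟩ := hE
  have : (Γ.map (QuotientGroup.mk' ((inn E).subgroupOf (F.aut E)))).Normal :=
    hΓ.map _ (QuotientGroup.mk'_surjective _)
  have h1 := hH.eq_bot_of_isPGroup (hp.map (QuotientGroup.mk' ((inn E).subgroupOf (F.aut E))))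
  rw [Subgroup.map_eq_bot_iff, QuotientGroup.ker_mk'] at h1
  exact h1

theorem IsEssential.mem_of_mem_inn (hE : F.IsEssential p E) {α : MulAut E} (hα : α ∈ inn E)
    {s : S} (hs : ∀ x : E, (α x : S) = s * x * s⁻¹) : s ∈ E := by
  obtain ⟨t, ht, h⟩ := mem_inn_iff.1 hα
  have h1 : t⁻¹ * s ∈ Subgroup.centralizer (E : Set S) := by
    rw [Subgroup.mem_centralizer_iff]
    intro x hx
    have := (hs ⟨x, hx⟩).symm.trans (h ⟨x, hx⟩)
    simp only at this
    rw [mul_inv_eq_iff_eq_mul] at this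
    rw [mul_assoc, this]
    group
  have := E.mul_mem ht (hE.1.centralizer_le h1)
  simpa using this

/-- An element of `S` that stabilizes a chain of `Aut_F(E)`-invariant subgroups of an essential
subgroup `E` lies in `E`, because the stabilizer of such a chain is a normal `p`-subgroup of
`Aut_F(E)`. -/
theorem IsEssential.mem_of_chain [Finite S] [Fact p.Prime] (hS : IsPGroup p S)
    (hE : F.IsEssential p E) {X₁ X₂ : Subgroup S} (h₂₁ : X₂ ≤ X₁) (h₁ : X₁ ≤ E)
    (i₁ : ∀ f, F.IsoOn E E f → ∀ x ∈ X₁, f x ∈ X₁) (i₂ : ∀ f, F.IsoOn E E f → ∀ x ∈ X₂, f x ∈ X₂)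
    {s : S} (c₁ : ∀ x ∈ E, s * x * s⁻¹ * x⁻¹ ∈ X₁) (c₂ : ∀ x ∈ X₁, s * x * s⁻¹ * x⁻¹ ∈ X₂)
    (c₃ : ∀ x ∈ X₂, s * x * s⁻¹ = x) : s ∈ E := by
  let C := chainStabilizer (X₁.subgroupOf E) (X₂.subgroupOf E)
    (Subgroup.comap_mono h₂₁)
  have hC : IsPGroup p C := isPGroup_chainStabilizer (hS.to_subgroup E) _
  have hmap : ∀ α : F.aut E, ∀ x : E, (((α : MulAut E) x : E) : S) = total (α : MulAut E) x :=
    fun α x => (total_apply _ x).symm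
  have i₁' : ∀ α : F.aut E, ∀ x : E, (x : S) ∈ X₁ → (((α : MulAut E) x : E) : S) ∈ X₁ :=
    fun α x hx => hmap α x ▸ i₁ _ (isoOn_total α) _ hx
  have i₂' : ∀ α : F.aut E, ∀ x : E, (x : S) ∈ X₂ → (((α : MulAut E) x : E) : S) ∈ X₂ :=
    fun α x hx => hmap α x ▸ i₂ _ (isoOn_total α) _ hx
  have hN : (C.subgroupOf (F.aut E)).Normal := by
    constructor
    rintro α ⟨a1, a2, a3⟩ γ
    have key : ∀ x : E, ((γ * α * γ⁻¹ : F.aut E) : MulAut E) x * x⁻¹ = (γ : MulAut E)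
        ((α : MulAut E) (((γ⁻¹ : F.aut E) : MulAut E) x) * (((γ⁻¹ : F.aut E) : MulAut E) x)⁻¹) := by
      intro x
      simp [MulAut.mul_apply]
    refine ⟨fun x => ?_, fun x hx => ?_, fun x hx => ?_⟩
    · exact (congrArg (· ∈ X₁.subgroupOf E) (key x)).mpr (i₁' γ _ (a1 _))
    · exact (congrArg (· ∈ X₂.subgroupOf E) (key x)).mpr (i₂' γ _ (a2 _ (i₁' γ⁻¹ x hx)))
    · have h1 := key x
      rw [← mul_inv_eq_one]
      refine h1.trans ?_
      have h2 := a3 _ (i₂' γ⁻¹ x hx)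
      change (α : MulAut E) (((γ⁻¹ : F.aut E) : MulAut E) x) = _ at h2
      rw [h2, mul_inv_cancel, _root_.map_one]
  have hp : IsPGroup p (C.subgroupOf (F.aut E)) :=
    hC.comap_of_injective _ (Subgroup.subtype_injective _)
  have hs : F.IsoOn E E fun x => s * x * s⁻¹ := isoOn_self (F.mor_conj E s) fun x hx => by
    have := E.mul_mem (h₁ (c₁ x hx)) hx
    simpa using this
  have hmem : (⟨hs.equiv, hs.mem_aut⟩ : F.aut E) ∈ C.subgroupOf (F.aut E) :=
    ⟨fun x => c₁ x x.2, fun x hx => c₂ x hx, fun x hx => Subtype.ext (c₃ x hx)⟩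
  exact hE.mem_of_mem_inn (hE.le_inn hp hmem) fun x => rfl

/-- A normal subgroup of `F` lies in each essential subgroup `E`, because the automorphisms of
`E` that it induces form a normal `p`-subgroup of `Aut_F(E)`. -/
theorem IsEssential.le_of_isNormal [Finite S] [Fact p.Prime] (hS : IsPGroup p S)
    (hE : F.IsEssential p E) (hN : F.IsNormal N) : N ≤ E := by
  let Γ : Subgroup (F.aut E) :=
    { carrier := {α | ∃ n ∈ N, ∀ x : E, (((α : MulAut E) x : E) : S) = n * x * n⁻¹}
      mul_mem' := by
        rintro α β ⟨m, hm, h1⟩ ⟨n, hn, h2⟩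
        refine ⟨m * n, N.mul_mem hm hn, fun x => ?_⟩
        refine (h1 ((β : MulAut E) x)).trans ?_
        rw [h2]
        group
      one_mem' := ⟨1, N.one_mem, fun x => by simp⟩
      inv_mem' := by
        rintro α ⟨n, hn, h⟩
        refine ⟨n⁻¹, N.inv_mem hn, fun x => ?_⟩
        have h1 := h (((α⁻¹ : F.aut E) : MulAut E) x)
        have h2 : (α : MulAut E) (((α⁻¹ : F.aut E) : MulAut E) x) = x := by simp
        rw [h2] at h1
        rw [h1]
        group }
  have hΓ : Γ.Normal := by
    constructor
    rintro α ⟨n, hn, h⟩ γ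
    obtain ⟨g, hg, hgγ, hgN⟩ := hN.exists_extension (isoOn_total γ).1
    refine ⟨g n, hgN.mem hn, fun x => ?_⟩
    obtain ⟨y, rfl⟩ := (γ : MulAut E).surjective x
    have h1 : ((γ * α * γ⁻¹ : F.aut E) : MulAut E) ((γ : MulAut E) y) =
        (γ : MulAut E) ((α : MulAut E) y) := by simp [MulAut.mul_apply]
    rw [h1, ← total_apply (γ : MulAut E), ← total_apply (γ : MulAut E), h, ← hgγ y y.2,
      ← hg.map_conj ((le_sup_right : N ≤ E ⊔ N) hn) ((le_sup_left : E ≤ E ⊔ N) y.2)]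
    refine (hgγ _ ?_).symm
    rw [← h]
    exact ((α : MulAut E) y).2
  have hp : IsPGroup p Γ := by
    rintro ⟨α, n, hn, h⟩
    obtain ⟨k, hk⟩ := hS n
    refine ⟨k, Subtype.ext (Subtype.ext (MulEquiv.ext fun x => Subtype.ext ?_))⟩
    have : ∀ m : ℕ, ((((α : MulAut E) ^ m) x : E) : S) = n ^ m * x * (n ^ m)⁻¹ := by
      intro m
      induction m with
      | zero => simp
      | succ m ih =>
        rw [pow_succ', MulAut.mul_apply, h, ih]
        group
    change ((((α : MulAut E) ^ p ^ k) x : E) : S) = x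
    rw [this, hk]
    simp
  by_contra hle
  obtain ⟨r, hr, hrE, hrN⟩ := hS.exists_mem_normalizer (left_lt_sup.2 hle)
  have := hN.1
  obtain ⟨e, he, n, hn, rfl⟩ := Subgroup.mem_sup_of_normal_right.1 hr
  have hnE : n ∈ Subgroup.normalizer (E : Set S) := by
    have := mul_mem (inv_mem (Subgroup.le_normalizer he)) hrN
    simpa using this
  have hα := F.autBase_le E ⟨⟨n, hnE⟩, rfl⟩
  exact hrE (E.mul_mem he (hE.mem_of_mem_inn (hE.le_inn hp
    (x := ⟨_, hα⟩) ⟨n, hn, fun x => rfl⟩) fun x => rfl))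

theorem IsEssential.ne_top [Finite S] [Fact p.Prime] (hS : IsPGroup p S) (hF : F.IsSaturated p)
    (hE : F.IsEssential p E) : E ≠ ⊤ := by
  rintro rfl
  obtain ⟨T, hT⟩ := (hF.isFullyAutomized_of_invariant hS (Q := ⊤) fun _ _ _ _ =>
    Subgroup.mem_top _).1
  obtain ⟨-, -, H, hH⟩ := hE
  have h1 : autBase (⊤ : Subgroup S) = inn ⊤ := by
    refine le_antisymm ?_ (inn_le_autBase _)
    rintro _ ⟨s, rfl⟩
    exact mem_inn_iff.2 ⟨s, Subgroup.mem_top _, fun x => rfl⟩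
  rw [h1] at hT
  apply T.not_dvd_index
  rw [hT]
  exact hH.2.1.trans (Subgroup.card_subgroup_dvd_card H)

end FusionSystem

namespace FusionSystem

variable {S : Type u} [Group S] {F : FusionSystem S} {P Q R E N D : Subgroup S}
  {f g : S → S} {p : ℕ}

/-! ### Alperin's fusion theorem -/

/-- If `Q < S` is centric, fully automized and receptive, and a proper subgroup `H` of `Aut_F(Q)`
contains every automorphism that extends to a strictly larger subgroup of `S`, then `Q` is
essential: the image of `H` in `Out_F(Q)` is strongly embedded. -/
theorem isEssential_of_extendable_mem [Finite S] [Fact p.Prime] (hS : IsPGroup p S)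
    (hQ : F.IsFullyAutomized p Q) (hQ' : F.IsReceptive Q)
    (hc : Subgroup.centralizer (Q : Set S) ≤ Q) (hne : Q ≠ ⊤) {H : Subgroup (F.aut Q)}
    (hH : H ≠ ⊤) (hext : ∀ χ : F.aut Q, ∀ R, Q < R → ∀ g, F.Mor R g →
      (∀ x : Q, (((χ : MulAut Q) x : Q) : S) = g x) → χ ∈ H) : F.IsEssential p Q := by
  refine ⟨hQ'.isCentric hc, isFullyNormalized_of_isReceptive hS hQ hQ', ?_⟩
  obtain ⟨r₀, -, hr₀, hr₀N⟩ := hS.exists_mem_normalizer (lt_top_iff_ne_top.2 hne)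
  have hQN : Q < Subgroup.normalizer (Q : Set S) :=
    SetLike.lt_iff_le_and_exists.2 ⟨Subgroup.le_normalizer, r₀, hr₀N, hr₀⟩
  let I := (inn Q).subgroupOf (F.aut Q)
  let π := QuotientGroup.mk' I
  have hπ : Function.Surjective π := QuotientGroup.mk'_surjective I
  have hker : π.ker = I := QuotientGroup.ker_mk' I
  have hbase : (autBase Q).subgroupOf (F.aut Q) ≤ H := by
    rintro α hα
    obtain ⟨s, hs⟩ := Subgroup.mem_subgroupOf.1 hα
    exact hext α _ hQN _ (F.mor_conj _ s) fun x => by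
      rw [← hs]
      rfl
  have hIB : I ≤ (autBase Q).subgroupOf (F.aut Q) := Subgroup.comap_mono (inn_le_autBase Q)
  have hcomap : (H.map π).comap π = H := by
    rw [Subgroup.comap_map_eq, hker, sup_eq_left]
    exact hIB.trans hbase
  obtain ⟨T, hT⟩ := hQ
  let T' : Sylow p (F.Out Q) := T.mapSurjective hπ
  have hT' : (T' : Subgroup (F.Out Q)) = (T : Subgroup (F.aut Q)).map π := rfl
  have hTH : (T' : Subgroup (F.Out Q)) ≤ H.map π := by
    rw [hT', hT]
    exact Subgroup.map_mono hbase
  -- every `p`-element of the image of `H` is conjugate in it to an element of `T'`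
  have hconj : ∀ y ∈ H.map π, IsPGroup p (Subgroup.zpowers y) →
      ∃ h ∈ H.map π, h * y * h⁻¹ ∈ (T' : Subgroup (F.Out Q)) := by
    intro y hy hyp
    have hy2 : IsPGroup p (Subgroup.zpowers (⟨y, hy⟩ : H.map π)) := by
      have : Subgroup.zpowers (⟨y, hy⟩ : H.map π) =
          (Subgroup.zpowers y).comap (H.map π).subtype := by
        ext z
        simp only [Subgroup.mem_zpowers_iff, Subgroup.mem_comap, Subtype.ext_iff]
        rfl
      rw [this]
      exact hyp.comap_of_injective _ (Subgroup.subtype_injective _)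
    obtain ⟨U, hU⟩ := hy2.exists_le_sylow
    obtain ⟨h, hh⟩ := MulAction.exists_smul_eq (H.map π) U (T'.subtype hTH)
    refine ⟨h, h.2, ?_⟩
    have h1 := Subgroup.smul_mem_pointwise_smul _ (MulAut.conj h) _
      (hU (Subgroup.mem_zpowers _))
    have h2 : MulAut.conj h • (⟨y, hy⟩ : H.map π) ∈ ((T'.subtype hTH : Sylow p (H.map π)) :
        Subgroup (H.map π)) := by
      rw [← hh]
      exact h1
    exact h2
  refine ⟨H.map π, ?_, ?_, fun g hg hdvd => hg ?_⟩
  · intro h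
    rw [h, Subgroup.comap_top] at hcomap
    exact hH hcomap.symm
  · let α : F.aut Q := ⟨Q.normalizerMonoidHom ⟨r₀, hr₀N⟩, F.autBase_le Q ⟨_, rfl⟩⟩
    have hα : α ∈ (autBase Q).subgroupOf (F.aut Q) := ⟨_, rfl⟩
    have h1 : π α ≠ 1 := by
      intro h
      rw [← MonoidHom.mem_ker, hker] at h
      obtain ⟨t, ht, h2⟩ := mem_inn_iff.1 (Subgroup.mem_subgroupOf.1 h)
      have h3 : t⁻¹ * r₀ ∈ Subgroup.centralizer (Q : Set S) := by
        rw [Subgroup.mem_centralizer_iff]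
        intro x hx
        have h4 : r₀ * x * r₀⁻¹ = t * x * t⁻¹ := h2 ⟨x, hx⟩
        rw [mul_inv_eq_iff_eq_mul] at h4
        rw [mul_assoc, h4]
        group
      have := Q.mul_mem ht (hc h3)
      exact hr₀ (by simpa using this)
    have h2 : π α ∈ (T' : Subgroup (F.Out Q)) := by
      rw [hT', hT]
      exact ⟨α, hα, rfl⟩
    refine (T'.isPGroup'.dvd_orderOf_of_mem h2 h1).trans ?_
    rw [← Subgroup.orderOf_mk _ (hTH h2)]
    exact orderOf_dvd_natCard _
  · -- an element of order `p` of the intersection yields an element `t` of `T'` that some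
    -- `h₁ * g * h₂⁻¹` maps into `T'`; a lift of the latter then extends to a larger subgroup
    obtain ⟨⟨y, hyH, z, hzH, hzy⟩, hy⟩ := exists_prime_orderOf_dvd_card' p hdvd
    have hyo : orderOf y = p := by rw [← hy, ← Subgroup.orderOf_coe]
    have hzo : orderOf z = p := by
      rw [← hyo, ← hzy]
      exact (orderOf_injective (MulAut.conj g).toMonoidHom (MulAut.conj g).injective z).symm
    have hzp : ∀ w : F.Out Q, orderOf w = p → IsPGroup p (Subgroup.zpowers w) := fun w hw =>
      IsPGroup.of_card (n := 1) (by rw [Nat.card_zpowers, hw, pow_one])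
    obtain ⟨h₁, hh₁, hyT⟩ := hconj y hyH (hzp y hyo)
    obtain ⟨h₂, hh₂, hzT⟩ := hconj z hzH (hzp z hzo)
    obtain ⟨χ, hχ⟩ := hπ (h₁ * g * h₂⁻¹)
    rw [hT', hT] at hyT hzT
    obtain ⟨τ, hτ, hτz⟩ := hzT
    obtain ⟨⟨r, hrN⟩, hr⟩ := Subgroup.mem_subgroupOf.1 hτ
    have hr' : ∀ x : Q, (((τ : MulAut Q) x : Q) : S) = r * x * r⁻¹ := fun x => by
      rw [show (τ : MulAut Q) = _ from hr.symm]
      rfl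
    have hrQ : r ∉ Q := by
      intro hrQ
      have h1 : τ ∈ I := mem_inn_iff.2 ⟨r, hrQ, hr'⟩
      rw [← hker, MonoidHom.mem_ker, hτz, conj_eq_one_iff] at h1
      rw [h1, orderOf_one] at hzo
      exact (Fact.out : p.Prime).one_lt.ne hzo
    have hmem : χ * τ * χ⁻¹ ∈ (autBase Q).subgroupOf (F.aut Q) := by
      obtain ⟨σ, hσ, hσy⟩ := hyT
      have h1 : (χ * τ * χ⁻¹)⁻¹ * σ ∈ I := by
        rw [← hker, MonoidHom.mem_ker]
        simp only [_root_.map_mul, _root_.map_inv, hσy, hτz, hχ]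
        rw [← hzy]
        simp only [MulEquiv.coe_toMonoidHom, MulAut.conj_apply]
        group
      have h2 := Subgroup.mul_mem _ hσ (Subgroup.inv_mem _ (hIB h1))
      simpa [mul_assoc] using h2
    have hχH : χ ∈ H := by
      obtain ⟨q, hq⟩ := mem_autBase_iff.1 (Subgroup.mem_subgroupOf.1 hmem)
      have hq' : ∀ x ∈ Q, total (χ : MulAut Q) (r * x * r⁻¹) =
          q * total (χ : MulAut Q) x * q⁻¹ := by
        intro x hx
        have h1 := hq ((χ : MulAut Q) ⟨x, hx⟩)
        have h2 : ((χ * τ * χ⁻¹ : F.aut Q) : MulAut Q) ((χ : MulAut Q) ⟨x, hx⟩) =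
            (χ : MulAut Q) ((τ : MulAut Q) ⟨x, hx⟩) := by simp [MulAut.mul_apply]
        rw [h2, ← total_apply (χ : MulAut Q), ← total_apply (χ : MulAut Q), hr'] at h1
        exact h1
      -- the elements of `N_S(Q)` along which `χ` extends
      let R : Subgroup S :=
        { carrier := {s | s ∈ Subgroup.normalizer (Q : Set S) ∧ ∃ q : S, ∀ x ∈ Q,
            total (χ : MulAut Q) (s * x * s⁻¹) = q * total (χ : MulAut Q) x * q⁻¹}
          mul_mem' := by
            rintro s t ⟨hs, q, hq⟩ ⟨ht, q', hq'⟩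
            refine ⟨mul_mem hs ht, q * q', fun x hx => ?_⟩
            have h1 := hq _ ((Subgroup.mem_normalizer_iff.1 ht x).1 hx)
            rw [hq' x hx] at h1
            rw [show s * t * x * (s * t)⁻¹ = s * (t * x * t⁻¹) * s⁻¹ by group, h1]
            group
          one_mem' := ⟨one_mem _, 1, by simp⟩
          inv_mem' := by
            rintro s ⟨hs, q, hq⟩
            refine ⟨inv_mem hs, q⁻¹, fun x hx => ?_⟩
            have h1 := hq _ ((Subgroup.mem_normalizer_iff.1 (inv_mem hs) x).1 hx)
            rw [show s * (s⁻¹ * x * s⁻¹⁻¹) * s⁻¹ = x by group] at h1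
            rw [h1]
            group }
      have hrR : r ∈ R := ⟨hrN, q, hq'⟩
      have hQR : Q < R := SetLike.lt_iff_le_and_exists.2
        ⟨fun s hs => ⟨Subgroup.le_normalizer hs, total (χ : MulAut Q) s, fun x hx =>
          (isoOn_total χ).1.map_conj hs hx⟩, r, hrR, hrQ⟩
      obtain ⟨g', hg', hgχ⟩ := hQ'.exists_extension (R := R) (isoOn_total χ)
        (fun s hs x hx => (Subgroup.mem_normalizer_iff.1 hs.1 x).1 hx) fun s hs => hs.2
      exact hext χ R hQR g' hg' fun x => by rw [hgχ x x.2, total_apply]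
    have h1 : h₁ * g * h₂⁻¹ ∈ H.map π := hχ ▸ ⟨χ, hχH, rfl⟩
    have h2 := Subgroup.mul_mem _ (Subgroup.mul_mem _ (Subgroup.inv_mem _ hh₁) h1) hh₂
    simpa [mul_assoc] using h2

/-- **Alperin's fusion theorem**, as an induction principle: a class `C` of morphisms of a
saturated fusion system that is closed under restriction, composition and inversion, and that
contains the automorphisms of `S` and of the essential subgroups, contains all morphisms. -/
theorem IsSaturated.morphism_induction [Finite S] [Fact p.Prime] (hS : IsPGroup p S)
    (hF : F.IsSaturated p) (C : Subgroup S → (S → S) → Prop)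
    (congr : ∀ P f g, (∀ x ∈ P, f x = g x) → C P f → C P g)
    (mono : ∀ P R f, R ≤ P → C P f → C R f)
    (comp : ∀ P Q f g, (∀ x ∈ P, f x ∈ Q) → C P f → C Q g → C P fun x => g (f x))
    (symm : ∀ P Q f g, F.IsoOn P Q f → F.IsoOn Q P g → (∀ x ∈ P, g (f x) = x) → C P f → C Q g)
    (base : ∀ R f, R = ⊤ ∨ F.IsEssential p R → F.IsoOn R R f → C R f) :
    ∀ P f, F.Mor P f → C P f := by
  intro P
  induction hn : Nat.card S - Nat.card P using Nat.strong_induction_on generalizing P with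
  | _ n ih =>
  have step : ∀ P₁ R : Subgroup S, Nat.card P₁ = Nat.card P → P₁ < R → ∀ g, F.Mor R g →
      C R g := by
    intro P₁ R h1 h2 g hg
    refine ih (Nat.card S - Nat.card R) ?_ R rfl g hg
    have h3 := Set.ncard_lt_ncard (SetLike.coe_ssubset_coe.2 h2) (Set.toFinite _)
    have h4 := Subgroup.card_le_card_group R
    rw [← Nat.card_coe_set_eq, ← Nat.card_coe_set_eq] at h3
    change Nat.card P₁ < Nat.card R at h3
    omega
  intro f hf
  by_cases hP : P = ⊤
  · subst hP
    exact base ⊤ f (Or.inl rfl) (isoOn_self hf fun _ _ => Subgroup.mem_top _)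
  obtain ⟨Q, θ, hθ, hQ, hQ'⟩ := hF.exists_isoOn P
  have hne : ∀ P₁ : Subgroup S, Nat.card P₁ = Nat.card P → P₁ ≠ ⊤ := by
    rintro _ h1 rfl
    exact hP (Subgroup.eq_top_of_card_eq P (by rw [← h1, Subgroup.card_top]))
  have haut : ∀ χ, F.IsoOn Q Q χ → C Q χ := by
    by_cases hess : F.IsEssential p Q
    · exact fun χ hχ => base Q χ (Or.inr hess) hχ
    by_cases hc : Subgroup.centralizer (Q : Set S) ≤ Q
    · let H : Subgroup (F.aut Q) :=
        { carrier := {α | C Q (total (α : MulAut Q))}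
          mul_mem' := by
            rintro α β hα hβ
            refine congr Q _ _ (fun x hx => ?_) (comp Q Q _ _ (fun x => (isoOn_total β).mem) hβ hα)
            rw [total_of_mem _ hx, total_apply, total_of_mem _ hx]
            rfl
          one_mem' := by
            refine congr Q id _ (fun x hx => ?_) (mono ⊤ Q _ le_top
              (base ⊤ id (Or.inl rfl) (isoOn_self (F.mor_id _) fun _ _ => Subgroup.mem_top _)))
            rw [total_of_mem _ hx]
            rfl
          inv_mem' := by
            rintro α hα
            refine symm Q Q _ _ (isoOn_total α) (isoOn_total α⁻¹) (fun x hx => ?_) hα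
            rw [total_of_mem _ hx, total_apply]
            simp }
      have hH : H = ⊤ := by
        by_contra hH
        refine hess (isEssential_of_extendable_mem hS hQ hQ' hc (hne Q hθ.card_eq.symm) hH ?_)
        intro χ R hR g hg hχ
        refine congr Q g _ (fun x hx => ?_) (mono R Q g hR.le (step Q R hθ.card_eq.symm hR g hg))
        rw [total_of_mem _ hx, hχ]
      intro χ hχ
      have h1 : (⟨hχ.equiv, hχ.mem_aut⟩ : F.aut Q) ∈ H := hH ▸ Subgroup.mem_top _
      refine congr Q _ _ (fun x hx => ?_) h1
      rw [total_of_mem _ hx]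
      rfl
    · intro χ hχ
      -- `χ` extends to `C_S(Q)Q > Q`
      obtain ⟨c, hc1, hc2⟩ := SetLike.not_le_iff_exists.1 hc
      let R : Subgroup S :=
        { carrier := {s | ∃ q ∈ Q, ∀ x ∈ Q, s * x * s⁻¹ = q * x * q⁻¹}
          mul_mem' := by
            rintro s t ⟨q, hq, h1⟩ ⟨r, hr, h2⟩
            refine ⟨q * r, Q.mul_mem hq hr, fun x hx => ?_⟩
            have h3 := h1 _ (Q.mul_mem (Q.mul_mem hr hx) (Q.inv_mem hr))
            rw [← h2 x hx] at h3
            rw [show s * t * x * (s * t)⁻¹ = s * (t * x * t⁻¹) * s⁻¹ by group, h3, h2 x hx]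
            group
          one_mem' := ⟨1, Q.one_mem, by simp⟩
          inv_mem' := by
            rintro s ⟨q, hq, h1⟩
            refine ⟨q⁻¹, Q.inv_mem hq, fun x hx => ?_⟩
            have h2 := h1 _ (Q.mul_mem (Q.mul_mem (Q.inv_mem hq) hx) hq)
            rw [show q * (q⁻¹ * x * q) * q⁻¹ = x by group] at h2
            nth_rw 1 [← h2]
            group }
      have hcR : c ∈ R := ⟨1, Q.one_mem, fun x hx => by
        rw [← Subgroup.mem_centralizer_iff.1 hc1 x hx]
        simp⟩
      have hQR : Q < R := SetLike.lt_iff_le_and_exists.2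
        ⟨fun q hq => ⟨q, hq, fun x _ => rfl⟩, c, hcR, hc2⟩
      obtain ⟨g, hg, hgχ⟩ := hQ'.exists_extension (R := R) hχ
        (fun r hr x hx => by
          obtain ⟨q, hq, h1⟩ := hr
          rw [h1 x hx]
          exact Q.mul_mem (Q.mul_mem hq hx) (Q.inv_mem hq))
        fun r hr => by
          obtain ⟨q, hq, h1⟩ := hr
          refine ⟨χ q, fun x hx => ?_⟩
          rw [h1 x hx, hχ.1.map_conj hq hx]
      exact congr Q g χ hgχ (mono R Q g hQR.le (step Q R hθ.card_eq.symm hQR g hg))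
  have hiso : ∀ P₁ k, F.IsoOn P₁ Q k → C P₁ k := by
    intro P₁ k hk
    have hcard : Nat.card P₁ = Nat.card P := hk.card_eq.trans hθ.card_eq.symm
    obtain ⟨χ, g, hχ, hg, hgk⟩ := hk.exists_normalizer_extension hS hQ hQ'
    obtain ⟨χ', hχ', h1, h2⟩ := hχ.symm
    obtain ⟨r, -, hr, hrN⟩ := hS.exists_mem_normalizer (lt_top_iff_ne_top.2 (hne P₁ hcard))
    have hlt : P₁ < Subgroup.normalizer (P₁ : Set S) :=
      SetLike.lt_iff_le_and_exists.2 ⟨Subgroup.le_normalizer, r, hrN, hr⟩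
    refine congr P₁ (fun x => χ' (g x)) k (fun x hx => ?_) (comp P₁ Q g χ' (fun x hx => ?_)
      (mono _ P₁ g hlt.le (step P₁ _ hcard hlt g hg)) (haut χ' hχ'))
    · rw [hgk x hx, h1 _ (hk.mem hx)]
    · rw [hgk x hx]
      exact hχ.mem (hk.mem hx)
  obtain ⟨f', hf', h1, h2⟩ := hf.isoOn.symm
  have h3 := hθ.comp hf'
  obtain ⟨k, hk, h4, h5⟩ := h3.symm
  refine congr P (fun x => k (θ x)) f (fun x hx => ?_) (comp P Q θ k (fun x => hθ.mem)
    (hiso P θ hθ) (symm _ _ _ k h3 hk h4 (hiso _ _ h3)))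
  have := h4 (f x) (hf.isoOn.mem hx)
  rwa [h1 x hx] at this

/-- A normal subgroup of `S` that is contained in every essential subgroup and invariant under
its automorphisms and those of `S` is normal in `F`. -/
theorem IsSaturated.isNormal_of_invariant [Finite S] [Fact p.Prime] (hS : IsPGroup p S)
    (hF : F.IsSaturated p) (hD : D.Normal)
    (h : ∀ R, R = ⊤ ∨ F.IsEssential p R → D ≤ R ∧ ∀ f, F.IsoOn R R f → ∀ x ∈ D, f x ∈ D) :
    F.IsNormal D := by
  refine isNormal_of_forall hD (hF.morphism_induction hS
    (fun P f => ∃ g, F.Mor (P ⊔ D) g ∧ (∀ x ∈ P, g x = f x) ∧ F.IsoOn D D g) ?_ ?_ ?_ ?_ ?_)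
  · rintro P f f' hff ⟨g, hg, h1, h2⟩
    exact ⟨g, hg, fun x hx => (h1 x hx).trans (hff x hx), h2⟩
  · rintro P R f hRP ⟨g, hg, h1, h2⟩
    exact ⟨g, hg.mono (sup_le_sup_right hRP D), fun x hx => h1 x (hRP hx), h2⟩
  · rintro P Q f f' hPQ ⟨g, hg, h1, h2⟩ ⟨g', hg', h1', h2'⟩
    refine ⟨fun x => g' (g x), hg'.comp hg fun x hx => ?_, fun x hx => ?_, h2'.comp h2⟩
    · obtain ⟨y, hy, z, hz, rfl⟩ := Subgroup.mem_sup_of_normal_right.1 hx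
      rw [hg.map_mul (le_sup_left (a := P) hy) (le_sup_right (a := P) hz), h1 y hy]
      exact Subgroup.mul_mem_sup (hPQ y hy) (h2.mem hz)
    · change g' (g x) = f' (f x)
      rw [h1 x hx, h1' _ (hPQ x hx)]
  · rintro P Q f f' hf hf' hff ⟨g, hg, h1, h2⟩
    have hPQ : F.IsoOn (P ⊔ D) (Q ⊔ D) g := by
      refine isoOn_of_forall hg (fun x hx => ?_) (fun y hy => ?_)
      · obtain ⟨y, hy, z, hz, rfl⟩ := Subgroup.mem_sup_of_normal_right.1 hx
        rw [hg.map_mul (le_sup_left (a := P) hy) (le_sup_right (a := P) hz), h1 y hy]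
        exact Subgroup.mul_mem_sup (hf.mem hy) (h2.mem hz)
      · obtain ⟨y, hyQ, z, hz, rfl⟩ := Subgroup.mem_sup_of_normal_right.1 hy
        obtain ⟨x, hx, rfl⟩ := hf.exists_eq hyQ
        obtain ⟨w, hw, rfl⟩ := h2.exists_eq hz
        refine ⟨x * w, Subgroup.mul_mem_sup hx hw, ?_⟩
        rw [hg.map_mul (le_sup_left (a := P) hx) (le_sup_right (a := P) hw), h1 x hx]
    obtain ⟨k, hk, h3, h4⟩ := hPQ.symm
    refine ⟨k, hk.1, fun y hy => ?_, isoOn_of_forall (hk.1.mono le_sup_right) ?_ ?_⟩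
    · obtain ⟨x, hx, rfl⟩ := hf.exists_eq hy
      rw [hff x hx, ← h1 x hx, h3 x (le_sup_left (a := P) hx)]
    · intro y hy
      obtain ⟨x, hx, rfl⟩ := h2.exists_eq hy
      rwa [h3 x (le_sup_right (a := P) hx)]
    · intro x hx
      exact ⟨g x, h2.mem hx, h3 x (le_sup_right (a := P) hx)⟩
  · intro R f hR hf
    obtain ⟨hDR, hinv⟩ := h R hR
    rw [sup_eq_left.2 hDR]
    exact ⟨f, hf.1, fun _ _ => rfl, isoOn_self (hf.1.mono hDR) (hinv f hf)⟩

end FusionSystem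

/-! ### Uniqueness of extensions from a normal centric subgroup -/

namespace FusionSystem

variable {S : Type u} [Group S] {F : FusionSystem S} {P Q R E N D : Subgroup S}
  {f g : S → S} {p : ℕ}

/-- An automorphism of `P` in `F` that is trivial on the normal centric subgroup `Q` is conjugation
by an element of `Q`.  Such automorphisms stabilize the chain `P ≥ C_S(Q) ≥ 1`, so they form a
normal `p`-subgroup of `Aut_F(P)` and lie in its Sylow subgroup `Aut_S(P)`. -/
theorem IsNormal.exists_conj_of_isoOn [Finite S] [Fact p.Prime] (hS : IsPGroup p S)
    (hQ : F.IsNormal Q) (hc : Subgroup.centralizer (Q : Set S) ≤ Q) (hQP : Q ≤ P)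
    (hP : F.IsFullyAutomized p P) (hf : F.IsoOn P P f) (h : ∀ x ∈ Q, f x = x) :
    ∃ s ∈ Q, ∀ u ∈ P, f u = s * u * s⁻¹ := by
  let Γ : Subgroup (F.aut P) :=
    { carrier := {α | ∀ x : P, (x : S) ∈ Q → (α : MulAut P) x = x}
      mul_mem' := fun {α β} hα hβ x hx => by
        have := hβ x hx
        rw [Subgroup.coe_mul, MulAut.mul_apply, this, hα x hx]
      one_mem' := fun x _ => rfl
      inv_mem' := fun {α} hα x hx => by
        have := hα x hx
        nth_rw 1 [← this]
        simp }
  have hΓ : Γ.Normal := by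
    constructor
    intro α hα γ x hx
    have h1 : (((γ⁻¹ : F.aut P) : MulAut P) x : S) ∈ Q := by
      rw [← total_apply ((γ⁻¹ : F.aut P) : MulAut P)]
      exact (hQ.isoOn (isoOn_total γ⁻¹).1 hQP).mem hx
    have h2 := hα _ h1
    have h3 : ((γ * α * γ⁻¹ : F.aut P) : MulAut P) x =
      (γ : MulAut P) ((α : MulAut P) (((γ⁻¹ : F.aut P) : MulAut P) x)) := rfl
    rw [h3, h2]
    simp
  let C := (Subgroup.centralizer (Q : Set S)).subgroupOf P
  have hle : Γ ≤ (chainStabilizer C C le_rfl).subgroupOf (F.aut P) := by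
    intro α hα
    refine ⟨fun x => ?_, fun x hx => ?_, fun x hx => hα x (hc hx)⟩
    · refine Subgroup.mem_centralizer_iff.2 fun y hy => ?_
      have h1 := hα (x⁻¹ * ⟨y, hQP hy⟩ * x) (by simpa using hQ.1.conj_mem y hy (x : S)⁻¹)
      have h2 := hα ⟨y, hQP hy⟩ hy
      rw [_root_.map_mul, _root_.map_mul, _root_.map_inv, h2] at h1
      have h3 : (((α : MulAut P) x : P) : S)⁻¹ * y * ((α : MulAut P) x : P) = (x : S)⁻¹ * y * x :=
        congrArg Subtype.val h1
      have h4 : y * ((α : MulAut P) x : P) = ((α : MulAut P) x : P) * ((x : S)⁻¹ * y * x) := by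
        rw [← h3]
        group
      change y * (((α : MulAut P) x : P) * (x : S)⁻¹) = ((α : MulAut P) x : P) * (x : S)⁻¹ * y
      rw [← mul_assoc, h4]
      group
    · have h1 : ((F.aut P).subtype α) x = x := hα x (hc hx)
      rw [h1, mul_inv_cancel]
      exact one_mem _
  have hp : IsPGroup p Γ := ((isPGroup_chainStabilizer (hS.to_subgroup P) _).comap_of_injective _
    (Subgroup.subtype_injective _)).to_le hle
  obtain ⟨T, hT⟩ := hP
  have hmem : (⟨hf.equiv, hf.mem_aut⟩ : F.aut P) ∈ Γ := fun x hx => Subtype.ext (h x hx)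
  have h1 := hp.le_sylow_of_normal T hmem
  rw [hT] at h1
  obtain ⟨s, hs⟩ := mem_autBase_iff.1 (Subgroup.mem_subgroupOf.1 h1)
  refine ⟨s, hc (Subgroup.mem_centralizer_iff.2 fun x hx => ?_), fun u hu => hs ⟨u, hu⟩⟩
  have h2 : f x = s * x * s⁻¹ := hs ⟨x, hQP hx⟩
  rw [h x hx] at h2
  nth_rw 1 [h2]
  group

/-- Morphisms that agree on a normal centric subgroup `Q` differ by conjugation with an element
of `Z(Q)`. -/
theorem IsNormal.exists_conj_of_eqOn [Finite S] [Fact p.Prime] (hS : IsPGroup p S)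
    (hF : F.IsSaturated p) (hQ : F.IsNormal Q) (hc : Subgroup.centralizer (Q : Set S) ≤ Q)
    (hQP : Q ≤ P) (hf : F.Mor P f) (hg : F.Mor P g) (h : ∀ x ∈ Q, f x = g x) :
    ∃ z ∈ Subgroup.centralizer (Q : Set S), ∀ u ∈ P, g u = z * f u * z⁻¹ := by
  have hfQ := hQ.isoOn hf hQP
  have hgf : ∀ u ∈ P, g u ∈ hf.im := by
    intro u hu
    have h1 : (f u)⁻¹ * g u ∈ Subgroup.centralizer (Q : Set S) := by
      rw [Subgroup.mem_centralizer_iff]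
      intro y hy
      obtain ⟨x, hx, rfl⟩ := hfQ.exists_eq hy
      have h2 := h _ (hQ.1.conj_mem x hx u)
      rw [hf.map_conj hu (hQP hx), hg.map_conj hu (hQP hx), ← h x hx] at h2
      have h3 : f x = (f u)⁻¹ * (g u * f x * (g u)⁻¹) * f u := by
        rw [← h2]
        group
      nth_rw 1 [h3]
      group
    obtain ⟨x, hx, hxu⟩ := hfQ.exists_eq (hc h1)
    refine ⟨u * x, P.mul_mem hu (hQP hx), ?_⟩
    rw [hf.map_mul hu (hQP hx), hxu, mul_inv_cancel_left]
  obtain ⟨f', hf', hl, hr⟩ := hf.isoOn.symm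
  have hχ : F.IsoOn P P fun u => f' (g u) :=
    isoOn_self (hf'.1.comp hg hgf) fun u hu => hf'.mem (hgf u hu)
  obtain ⟨P₁, θ, hθ, hP₁, -⟩ := hF.exists_isoOn P
  obtain ⟨θ', hθ', hθl, hθr⟩ := hθ.symm
  have hQP₁ : Q ≤ P₁ := fun x hx => by
    obtain ⟨y, hy, rfl⟩ := (hQ.isoOn hθ.1 hQP).exists_eq hx
    exact hθ.mem (hQP hy)
  obtain ⟨s, hs, hsu⟩ := hQ.exists_conj_of_isoOn hS hc hQP₁ hP₁ (hθ.comp (hχ.comp hθ'))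
    fun x hx => by
    have h1 := (hQ.isoOn hθ'.1 hQP₁).mem hx
    change θ (f' (g (θ' x))) = x
    rw [← h _ h1, hl _ (hQP h1), hθr x (hQP₁ hx)]
  have key : ∀ u ∈ P, g u = f (θ' s) * f u * (f (θ' s))⁻¹ := by
    intro u hu
    have h1 : θ (f' (g (θ' (θ u)))) = s * θ u * s⁻¹ := hsu (θ u) (hθ.mem hu)
    rw [hθl u hu] at h1
    have h2 := hθl _ (hf'.mem (hgf u hu))
    rw [h1, hθ'.1.map_conj (hQP₁ hs) (hθ.mem hu), hθl u hu] at h2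
    rw [← hr _ (hgf u hu), ← h2, hf.map_conj (hθ'.mem (hQP₁ hs)) hu]
  refine ⟨_, Subgroup.mem_centralizer_iff.2 fun y hy => ?_, key⟩
  obtain ⟨x, hx, rfl⟩ := hfQ.exists_eq hy
  have h1 := key x (hQP hx)
  rw [← h x hx] at h1
  nth_rw 1 [h1]
  group

/-! ### A biset for a normal centric subgroup -/

/-- The map `S → Aut_F(Q)` given by conjugation on a normal subgroup `Q`. -/
def conjAut (F : FusionSystem S) (Q : Subgroup S) [Q.Normal] : S →* F.aut Q :=
  (MulAut.conjNormal : S →* MulAut Q).codRestrict (F.aut Q) fun s =>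
    F.conj_mem _ s fun _ => rfl

theorem conjAut_apply [Q.Normal] (s : S) (x : Q) :
    (((F.conjAut Q s : MulAut Q) x : Q) : S) = s * x * s⁻¹ := rfl

/-- The action of `Aut_F(Q)` on the elements of `Q`, extended by the identity to `S`. -/
noncomputable def ap (a : F.aut Q) : S → S := total (a : MulAut Q)

theorem isoOn_ap (a : F.aut Q) : F.IsoOn Q Q (ap a) := isoOn_total a

theorem ap_mem (a : F.aut Q) {x : S} (hx : x ∈ Q) : ap a x ∈ Q := (isoOn_ap a).mem hx

theorem ap_one (x : S) : ap (1 : F.aut Q) x = x := by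
  by_cases hx : x ∈ Q <;> simp [ap, total, hx]

theorem ap_mul (a b : F.aut Q) {x : S} (hx : x ∈ Q) : ap (a * b) x = ap a (ap b x) := by
  have h : ap b x = ((b : MulAut Q) ⟨x, hx⟩ : Q) := total_of_mem _ hx
  rw [h, ap, ap, total_apply, total_of_mem _ hx]
  rfl

theorem ap_conjAut [Q.Normal] (s : S) {x : S} (hx : x ∈ Q) :
    ap (F.conjAut Q s) x = s * x * s⁻¹ := total_of_mem _ hx

theorem aut_ext {a b : F.aut Q} (h : ∀ x ∈ Q, ap a x = ap b x) : a = b :=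
  Subtype.ext (MulEquiv.ext fun x => Subtype.ext (by
    have := h x x.2
    rwa [ap, ap, total_apply, total_apply] at this))

theorem conjAut_eq_one_iff [Q.Normal] {s : S} :
    F.conjAut Q s = 1 ↔ s ∈ Subgroup.centralizer (Q : Set S) := by
  rw [Subgroup.mem_centralizer_iff]
  constructor
  · intro h x hx
    have h1 := ap_conjAut (F := F) s hx
    rw [h, ap_one] at h1
    nth_rw 1 [h1]
    group
  · intro h
    refine aut_ext fun x hx => ?_
    rw [ap_conjAut s hx, ap_one, ← h x hx]
    simp

theorem range_conjAut [Q.Normal] :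
    (F.conjAut Q).range = (autBase Q).subgroupOf (F.aut Q) := by
  ext a
  rw [Subgroup.mem_subgroupOf, mem_autBase_iff]
  constructor
  · rintro ⟨s, rfl⟩
    exact ⟨s, fun x => rfl⟩
  · rintro ⟨s, hs⟩
    refine ⟨s, aut_ext fun x hx => ?_⟩
    rw [ap_conjAut s hx, ap, total_of_mem _ hx]
    exact (hs ⟨x, hx⟩).symm

/-- An `S`-`S`-biset over `Aut_F(Q)` with the properties that a model of `F` has as a biset, the map
`proj` being the action by conjugation on `Q`: the right action is free, the fibres of `proj` lie
in single right orbits, left and right multiplication by `Q` are related through `proj`, and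
the relation `u x = x s` between `u` and `s` is given by a morphism of `F`. -/
structure ModelBiset (F : FusionSystem S) (Q : Subgroup S) [Q.Normal] where
  /-- the underlying set -/
  X : Type u
  finite : Finite X
  /-- the left action -/
  l : S → X → X
  /-- the right action -/
  r : X → S → X
  /-- the map to `Aut_F(Q)` -/
  proj : X → F.aut Q
  l_one : ∀ x, l 1 x = x
  l_mul : ∀ s t x, l (s * t) x = l s (l t x)
  r_one : ∀ x, r x 1 = x
  r_mul : ∀ x s t, r x (s * t) = r (r x s) t
  l_r : ∀ s x t, l s (r x t) = r (l s x) t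
  proj_l : ∀ s x, proj (l s x) = F.conjAut Q s * proj x
  proj_r : ∀ x s, proj (r x s) = proj x * F.conjAut Q s
  proj_surjective : Function.Surjective proj
  exists_r_eq : ∀ x y, proj x = proj y → ∃ s, r x s = y
  r_injective : ∀ x s t, r x s = r x t → s = t
  l_coe : ∀ q ∈ Q, ∀ x, l q x = r x (ap (proj x)⁻¹ q)
  exists_mor : ∀ x, ∃ R ρ, F.Mor R ρ ∧ ∀ u s, l u x = r x s ↔ u ∈ R ∧ s = ρ u

/-- The inverse of `t ∈ Aut_F(Q)` extends to the group of all `w ∈ S` such that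
`t⁻¹ c_w t ∈ Aut_S(Q)`. -/
theorem IsReceptive.exists_extension_inv [hn : Q.Normal] (hQ : F.IsReceptive Q) (t : F.aut Q) :
    ∃ R ψ, F.Mor R ψ ∧ Q ≤ R ∧ (∀ w, w ∈ R ↔ ∃ v, F.conjAut Q w * t = t * F.conjAut Q v) ∧
      (∀ q ∈ Q, ψ q = ap t⁻¹ q) ∧ ∀ w ∈ R, F.conjAut Q w * t = t * F.conjAut Q (ψ w) := by
  let R : Subgroup S := (F.conjAut Q).range.comap
    ((MulAut.conj t⁻¹).toMonoidHom.comp (F.conjAut Q))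
  have hR : ∀ w, w ∈ R ↔ ∃ v, F.conjAut Q w * t = t * F.conjAut Q v := by
    intro w
    refine exists_congr fun v => ?_
    change F.conjAut Q v = t⁻¹ * F.conjAut Q w * t⁻¹⁻¹ ↔ _
    rw [inv_inv, mul_assoc, eq_inv_mul_iff_mul_eq, eq_comm]
  have hQR : Q ≤ R := by
    intro q hq
    refine (hR q).2 ⟨ap t⁻¹ q, aut_ext fun x hx => ?_⟩
    rw [ap_mul _ _ hx, ap_mul _ _ hx, ap_conjAut _ hx, ap_conjAut _ (ap_mem t hx),
      (isoOn_ap t).1.map_conj (ap_mem _ hq) hx, ← ap_mul _ _ hq, mul_inv_cancel, ap_one]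
  obtain ⟨ψ, hψ, hψQ⟩ := hQ.exists_extension (R := R) (isoOn_ap t⁻¹)
    (fun w _ x hx => hn.conj_mem x hx w) fun w hw => by
      obtain ⟨v, hv⟩ := (hR w).1 hw
      refine ⟨v, fun x hx => ?_⟩
      have h1 : t⁻¹ * F.conjAut Q w = F.conjAut Q v * t⁻¹ := by
        rw [inv_mul_eq_iff_eq_mul, ← mul_assoc, ← hv, mul_inv_cancel_right]
      rw [← ap_conjAut (F := F) w hx, ← ap_mul _ _ hx, h1, ap_mul _ _ hx,
        ap_conjAut _ (ap_mem _ hx)]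
  refine ⟨R, ψ, hψ, hQR, hR, hψQ, fun w hw => ?_⟩
  have h2 : t⁻¹ * F.conjAut Q w = F.conjAut Q (ψ w) * t⁻¹ := by
    refine aut_ext fun x hx => ?_
    rw [ap_mul _ _ hx, ap_mul _ _ hx, ap_conjAut _ hx, ap_conjAut _ (ap_mem _ hx),
      ← hψQ _ (hn.conj_mem x hx w), ← hψQ x hx, hψ.map_conj hw (hQR hx)]
  rw [inv_mul_eq_iff_eq_mul, ← mul_assoc] at h2
  rw [h2, inv_mul_cancel_right]

end FusionSystem

namespace FusionSystem

variable {S : Type u} [Group S] {F : FusionSystem S} {P Q R E N D : Subgroup S}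
  {f g : S → S} {p : ℕ}

/-- The biset is the disjoint union, over the double cosets `Aut_S(Q) t Aut_S(Q)` in `Aut_F(Q)`, of
the quotients of `S × S` that identify `(s w, s')` with `(s, ψ(w) s')`, where `ψ` extends `t⁻¹`. -/
theorem IsReceptive.nonempty_modelBiset [Finite S] [Q.Normal] (hQ : F.IsReceptive Q) :
    Nonempty (ModelBiset F Q) := by
  choose R ψ hψ hQR hR hψQ hψR using fun t => hQ.exists_extension_inv t
  let B : Subgroup (F.aut Q) := (F.conjAut Q).range
  let D := DoubleCoset.Quotient (B : Set (F.aut Q)) B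
  let t : D → F.aut Q := Quotient.out
  let st : Setoid (D × S × S) :=
    { r := fun a b => a.1 = b.1 ∧ ∃ w ∈ R (t a.1), b.2.1 = a.2.1 * w ∧
        a.2.2 = ψ (t a.1) w * b.2.2
      iseqv :=
        { refl := fun a => ⟨rfl, 1, one_mem _, by simp, by simp [(hψ _).map_one]⟩
          symm := by
            rintro ⟨d, s, s'⟩ ⟨e, u, u'⟩ ⟨h1, w, hw, h2, h3⟩
            simp only at h1 h2 h3 hw
            subst h1
            refine ⟨rfl, w⁻¹, inv_mem hw, by simp [h2], ?_⟩
            simp [h3, (hψ _).map_inv hw]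
          trans := by
            rintro ⟨d, s, s'⟩ ⟨e, u, u'⟩ ⟨k, v, v'⟩ ⟨h1, w, hw, h2, h3⟩ ⟨h4, x, hx, h5, h6⟩
            simp only at h1 h2 h3 h4 h5 h6 hw hx
            subst h1 h4
            refine ⟨rfl, w * x, mul_mem hw hx, by simp [h2, h5, mul_assoc], ?_⟩
            simp [h3, h6, (hψ _).map_mul hw hx, mul_assoc] } }
  let pr : D × S × S → F.aut Q := fun a => F.conjAut Q a.2.1 * t a.1 * F.conjAut Q a.2.2
  have hpr : ∀ a b, st a b → pr a = pr b := by
    rintro ⟨d, s, s'⟩ ⟨e, u, u'⟩ ⟨h1, w, hw, h2, h3⟩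
    simp only at h1 h2 h3 hw
    subst h1
    simp only [pr, h2, h3, map_mul]
    rw [mul_assoc (F.conjAut Q s) _ (t d), hψR _ w hw]
    simp only [mul_assoc]
  refine ⟨{
    X := Quotient st
    finite := by
      have : Finite D := Quotient.finite _
      exact Quotient.finite _
    l := fun s => Quotient.map (fun a => (a.1, s * a.2.1, a.2.2)) (by
      rintro a b ⟨h1, w, hw, h2, h3⟩
      exact ⟨h1, w, hw, by simp [h2, mul_assoc], h3⟩)
    r := fun x s => Quotient.map (fun a => (a.1, a.2.1, a.2.2 * s)) (by
      rintro a b ⟨h1, w, hw, h2, h3⟩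
      exact ⟨h1, w, hw, h2, by simp [h3, mul_assoc]⟩) x
    proj := Quotient.lift pr hpr
    l_one := by
      rintro ⟨a⟩
      exact congrArg (Quotient.mk st) (by simp)
    l_mul := by
      rintro s t ⟨a⟩
      exact congrArg (Quotient.mk st) (by simp [mul_assoc])
    r_one := by
      rintro ⟨a⟩
      exact congrArg (Quotient.mk st) (by simp)
    r_mul := by
      rintro ⟨a⟩ s t
      exact congrArg (Quotient.mk st) (by simp [mul_assoc])
    l_r := by
      rintro s ⟨a⟩ t
      rfl
    proj_l := by
      rintro s ⟨a⟩
      change pr _ = _ * pr _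
      simp [pr, mul_assoc]
    proj_r := by
      rintro ⟨a⟩ s
      change pr _ = pr _ * _
      simp [pr, mul_assoc]
    proj_surjective := ?_
    exists_r_eq := ?_
    r_injective := ?_
    l_coe := ?_
    exists_mor := ?_ }⟩
  · intro a
    have h1 : DoubleCoset.mk B B (t (DoubleCoset.mk B B a)) = DoubleCoset.mk B B a :=
      Quotient.out_eq _
    obtain ⟨_, ⟨s, rfl⟩, _, ⟨s', rfl⟩, h2⟩ := (DoubleCoset.eq B B _ _).1 h1
    exact ⟨Quotient.mk st (DoubleCoset.mk B B a, s, s'), h2.symm⟩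
  · rintro ⟨d, s, s'⟩ ⟨e, u, u'⟩ (h : pr _ = pr _)
    have hde : d = e := by
      have h1 : ∀ (d : D) (s s' : S), DoubleCoset.mk B B (pr (d, s, s')) = d := by
        intro d s s'
        refine Eq.trans ?_ (Quotient.out_eq d)
        exact ((DoubleCoset.eq B B _ _).2 ⟨_, ⟨s, rfl⟩, _, ⟨s', rfl⟩, rfl⟩).symm
      rw [← h1 d s s', h, h1]
    subst hde
    simp only [pr] at h
    have h2 : F.conjAut Q (s⁻¹ * u) * t d = t d * F.conjAut Q (s' * u'⁻¹) := by
      simp only [map_mul, map_inv]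
      rw [mul_assoc, inv_mul_eq_iff_eq_mul, ← mul_assoc, ← mul_assoc, h]
      group
    have hw : s⁻¹ * u ∈ R (t d) := (hR _ _).2 ⟨_, h2⟩
    exact ⟨s'⁻¹ * ψ (t d) (s⁻¹ * u) * u', Quotient.sound
      ⟨rfl, s⁻¹ * u, hw, by simp, by simp [mul_assoc]⟩⟩
  · rintro ⟨d, s, s'⟩ u v h
    obtain ⟨-, w, -, h2, h3⟩ := Quotient.exact h
    simp only [left_eq_mul] at h2
    subst h2
    simpa [(hψ _).map_one] using h3
  · rintro q hq ⟨d, s, s'⟩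
    have hn : Q.Normal := inferInstance
    have h1 : s⁻¹ * q * s ∈ Q := by simpa using hn.conj_mem q hq s⁻¹
    have h3 : ap (pr (d, s, s'))⁻¹ q = s'⁻¹ * ψ (t d) (s⁻¹ * q * s) * s' := by
      have h4 : (pr (d, s, s'))⁻¹ = F.conjAut Q s'⁻¹ * ((t d)⁻¹ * F.conjAut Q s⁻¹) := by
        simp [pr, mul_assoc]
      rw [h4, ap_mul _ _ hq, ap_mul _ _ hq, ap_conjAut _ hq, inv_inv, hψQ _ _ h1,
        ap_conjAut _ (ap_mem _ h1), inv_inv]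
    change Quotient.mk st _ = Quotient.mk st (d, s, s' * ap (pr (d, s, s'))⁻¹ q)
    rw [h3]
    refine Quotient.sound ⟨rfl, (s⁻¹ * q * s)⁻¹, inv_mem (hQR _ h1), by simp [mul_assoc], ?_⟩
    rw [(hψ _).map_inv (hQR _ h1)]
    simp [mul_assoc]
  · rintro ⟨d, s, s'⟩
    -- the conjugate `s R s⁻¹` with the map `u ↦ s'⁻¹ ψ(s⁻¹ u s) s'`
    let R' : Subgroup S := (R (t d)).comap (MulAut.conj s⁻¹).toMonoidHom
    have hmem : ∀ u, u ∈ R' ↔ s⁻¹ * u * s ∈ R (t d) := fun u => by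
      change s⁻¹ * u * s⁻¹⁻¹ ∈ R (t d) ↔ _
      rw [inv_inv]
    refine ⟨R', fun u => s'⁻¹ * ψ (t d) (s⁻¹ * u * s) * s', ?_, fun u v => ?_⟩
    · have h1 : F.Mor R' fun u => ψ (t d) (s⁻¹ * u * s⁻¹⁻¹) :=
        (hψ (t d)).comp (F.mor_conj R' s⁻¹) fun u hu => hu
      have h2 := (F.mor_conj ⊤ s'⁻¹).comp h1 fun _ _ => Subgroup.mem_top _
      simpa only [inv_inv] using h2
    · constructor
      · intro h
        obtain ⟨-, w, hw, h2, h3⟩ := Quotient.exact h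
        simp only at h2 h3 hw
        have h4 : s⁻¹ * u * s = w⁻¹ := by
          rw [eq_inv_iff_mul_eq_one, mul_assoc, mul_assoc, ← mul_assoc u, ← h2, inv_mul_cancel]
        refine ⟨(hmem u).2 (h4 ▸ inv_mem hw), ?_⟩
        change v = s'⁻¹ * ψ (t d) (s⁻¹ * u * s) * s'
        rw [h4, (hψ _).map_inv hw]
        calc v = s'⁻¹ * ((ψ (t d) w)⁻¹ * (ψ (t d) w * (s' * v))) := by group
          _ = s'⁻¹ * ((ψ (t d) w)⁻¹ * s') := by rw [← h3]
          _ = _ := by group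
      · rintro ⟨hu, rfl⟩
        have hu' := (hmem u).1 hu
        refine Quotient.sound ⟨rfl, (s⁻¹ * u * s)⁻¹, inv_mem hu', by simp [mul_assoc], ?_⟩
        rw [(hψ _).map_inv hu']
        simp [mul_assoc]

namespace ModelBiset

variable [Q.Normal] (M : ModelBiset F Q)

theorem l_inv_l (s : S) (x : M.X) : M.l s⁻¹ (M.l s x) = x := by
  rw [← M.l_mul, inv_mul_cancel, M.l_one]

theorem r_r_inv (s : S) (x : M.X) : M.r (M.r x s) s⁻¹ = x := by
  rw [← M.r_mul, mul_inv_cancel, M.r_one]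

/-- The biset is `F`-stable: a morphism `f` of `F` on `P ≥ Q` with restriction `a` to `Q` is
induced by a permutation of the biset that lies over left multiplication by `a`. -/
theorem exists_perm [Finite S] [Fact p.Prime] (hS : IsPGroup p S) (hF : F.IsSaturated p)
    (hQ : F.IsNormal Q) (hc : Subgroup.centralizer (Q : Set S) ≤ Q) (hQP : Q ≤ P)
    (hf : F.Mor P f) (a : F.aut Q) (ha : ∀ x ∈ Q, ap a x = f x) :
    ∃ σ : Equiv.Perm M.X, (∀ x, M.proj (σ x) = a * M.proj x) ∧
      (∀ x s, σ (M.r x s) = M.r (σ x) s) ∧ ∀ u ∈ P, ∀ x, σ (M.l u x) = M.l (f u) (σ x) := by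
  have hfa : ∀ u ∈ P, a * F.conjAut Q u = F.conjAut Q (f u) * a := by
    intro u hu
    refine aut_ext fun x hx => ?_
    have hux := hQ.1.conj_mem x hx u
    rw [ap_mul _ _ hx, ap_mul _ _ hx, ap_conjAut _ hx, ap_conjAut _ (ap_mem _ hx),
      ha x hx, ha _ hux, hf.map_conj hu (hQP hx)]
  -- each point `x` has an image `y` whose stabilizer in `P × S` fits
  have hpt : ∀ x, ∃ y, M.proj y = a * M.proj x ∧
      ∀ u ∈ P, ∀ s, M.l u x = M.r x s → M.l (f u) y = M.r y s := by
    intro x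
    obtain ⟨y₀, hy₀⟩ := M.proj_surjective (a * M.proj x)
    obtain ⟨R₁, ρ₁, hρ₁, h1⟩ := M.exists_mor x
    obtain ⟨R₂, ρ₂, hρ₂, h2⟩ := M.exists_mor y₀
    have hR : ∀ u ∈ P ⊓ R₁, f u ∈ R₂ := by
      intro u hu
      have h3 := (h1 u _).2 ⟨hu.2, rfl⟩
      have h4 : M.proj (M.l (f u) y₀) = M.proj (M.r y₀ (ρ₁ u)) := by
        rw [M.proj_l, M.proj_r, hy₀, ← mul_assoc, ← hfa u hu.1, mul_assoc, mul_assoc,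
          ← M.proj_l, ← M.proj_r, h3]
      obtain ⟨s, hs⟩ := M.exists_r_eq _ _ h4.symm
      rw [← M.r_mul] at hs
      exact ((h2 _ _).1 hs.symm).1
    have hQR : Q ≤ R₁ := fun q hq => ((h1 _ _).1 (M.l_coe q hq x)).1
    obtain ⟨z, hz, hzu⟩ := hQ.exists_conj_of_eqOn hS hF hc (le_inf hQP hQR)
      (hρ₁.mono inf_le_right) (hρ₂.comp (hf.mono inf_le_left) hR) fun q hq => by
        rw [← ((h1 _ _).1 (M.l_coe q hq x)).2, ← ha q hq,
          ← ((h2 _ _).1 (M.l_coe _ (ap_mem a hq) y₀)).2, ← ap_mul _ _ hq, hy₀, mul_inv_rev,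
          inv_mul_cancel_right]
    refine ⟨M.r y₀ z, ?_, fun u hu s hs => ?_⟩
    · rw [M.proj_r, hy₀, conjAut_eq_one_iff.2 hz, mul_one]
    · obtain ⟨hu1, rfl⟩ := (h1 _ _).1 hs
      rw [M.l_r, (h2 (f u) _).2 ⟨hR u ⟨hu, hu1⟩, rfl⟩, hzu u ⟨hu, hu1⟩, ← M.r_mul, ← M.r_mul]
      group
  choose y hy hyu using hpt
  -- choose representatives of the orbits of `P × S`
  let st : Setoid M.X :=
    { r := fun x x' => ∃ u ∈ P, ∃ s, x = M.l u (M.r x' s)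
      iseqv :=
        { refl := fun x => ⟨1, P.one_mem, 1, by rw [M.r_one, M.l_one]⟩
          symm := by
            rintro x x' ⟨u, hu, s, rfl⟩
            refine ⟨u⁻¹, P.inv_mem hu, s⁻¹, ?_⟩
            rw [← M.l_r, r_r_inv, l_inv_l]
          trans := by
            rintro x x' x'' ⟨u, hu, s, rfl⟩ ⟨v, hv, t, rfl⟩
            refine ⟨u * v, P.mul_mem hu hv, t * s, ?_⟩
            rw [M.l_mul, M.r_mul, M.l_r v _ s] } }
  have hrep : ∀ x : M.X, ∃ u ∈ P, ∃ s, x = M.l u (M.r (Quotient.mk st x).out s) := fun x =>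
    Setoid.symm (Quotient.exact (Quotient.out_eq (Quotient.mk st x)))
  choose u hu s hx using hrep
  let σ : M.X → M.X := fun x => M.l (f (u x)) (M.r (y (Quotient.mk st x).out) (s x))
  have hσ : ∀ x x₀, x₀ = (Quotient.mk st x).out → ∀ v ∈ P, ∀ t, x = M.l v (M.r x₀ t) →
      σ x = M.l (f v) (M.r (y x₀) t) := by
    rintro x x₀ hx₀ v hv t h
    have h1 : M.l (v⁻¹ * u x) x₀ = M.r x₀ (t * (s x)⁻¹) := by
      have h2 := (hx x).symm.trans h
      rw [← hx₀, M.l_r, M.l_r] at h2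
      have h3 := congrArg (fun z => M.r (M.l v⁻¹ z) (s x)⁻¹) h2
      simp only [M.l_r, ← M.l_mul, ← M.r_mul, mul_inv_cancel, M.r_one, inv_mul_cancel,
        M.l_one] at h3
      exact h3
    have h2 := hyu x₀ _ (P.mul_mem (P.inv_mem hv) (hu x)) _ h1
    rw [hf.map_mul (P.inv_mem hv) (hu x), hf.map_inv hv] at h2
    have h3 := congrArg (fun z => M.r (M.l (f v) z) (s x)) h2
    simp only [← M.l_mul, M.l_r, ← M.r_mul, mul_inv_cancel_left, inv_mul_cancel_right] at h3
    change M.l (f (u x)) (M.r (y (Quotient.mk st x).out) (s x)) = _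
    rw [← hx₀, M.l_r, M.l_r, h3]
  have h1 : ∀ x, M.proj (σ x) = a * M.proj x := by
    intro x
    nth_rw 2 [hx x]
    change M.proj (M.l (f (u x)) (M.r (y (Quotient.mk st x).out) (s x))) = _
    rw [M.proj_l, M.proj_r, hy, M.proj_l, M.proj_r, ← mul_assoc a, hfa _ (hu x)]
    simp only [mul_assoc]
  have h2 : ∀ x t, σ (M.r x t) = M.r (σ x) t := by
    intro x t
    have h3 : Quotient.mk st (M.r x t) = Quotient.mk st x :=
      Quotient.sound ⟨1, P.one_mem, t, by rw [M.l_one]⟩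
    rw [hσ (M.r x t) (Quotient.mk st x).out (by rw [h3]) (u x) (hu x) (s x * t) (by
      nth_rw 1 [hx x]
      rw [M.r_mul, M.l_r (u x) _ t]), hσ x _ rfl (u x) (hu x) (s x) (hx x), M.r_mul, M.l_r _ _ t]
  have h3 : ∀ v ∈ P, ∀ x, σ (M.l v x) = M.l (f v) (σ x) := by
    intro v hv x
    have h3 : Quotient.mk st (M.l v x) = Quotient.mk st x :=
      Quotient.sound ⟨v, hv, 1, by rw [M.r_one]⟩
    rw [hσ (M.l v x) (Quotient.mk st x).out (by rw [h3]) (v * u x) (P.mul_mem hv (hu x)) (s x) (by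
      nth_rw 1 [hx x]
      rw [M.l_mul]), hσ x _ rfl (u x) (hu x) (s x) (hx x), hf.map_mul hv (hu x), M.l_mul]
  have hinj : Function.Injective σ := by
    intro x x' hxx
    obtain ⟨t, rfl⟩ := M.exists_r_eq x x' (mul_left_cancel (by rw [← h1, ← h1, hxx]))
    rw [h2] at hxx
    nth_rw 1 [← M.r_one (σ x)] at hxx
    rw [← M.r_injective _ _ _ hxx, M.r_one]
  have := M.finite
  exact ⟨Equiv.ofBijective σ (Finite.injective_iff_bijective.1 hinj), h1, h2, h3⟩

end ModelBiset

end FusionSystem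

namespace FusionSystem

variable {S : Type u} [Group S] {F : FusionSystem S} {P Q R E N D : Subgroup S}
  {f g : S → S} {p : ℕ}

/-! ### The model of a constrained fusion system -/

namespace ModelBiset

open scoped IsMulCommutative

variable [Q.Normal] (M : ModelBiset F Q)

/-- The group of pairs of an `a ∈ Aut_F(Q)` and a permutation of the biset that commutes with the
right action and lies over left multiplication by `a`. -/
def permGroup : Subgroup (F.aut Q × Equiv.Perm M.X) where
  carrier := {e | ∀ x, M.proj (e.2 x) = e.1 * M.proj x ∧ ∀ s, e.2 (M.r x s) = M.r (e.2 x) s}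
  mul_mem' := by
    rintro ⟨a, σ⟩ ⟨b, τ⟩ h1 h2 x
    simp only [Prod.mk_mul_mk, Equiv.Perm.mul_apply]
    refine ⟨?_, fun s => ?_⟩
    · rw [(h1 _).1, (h2 x).1, mul_assoc]
    · rw [(h2 x).2, (h1 _).2]
  one_mem' := by simp
  inv_mem' := by
    rintro ⟨a, σ⟩ h x
    simp only [Prod.inv_mk]
    have hσ : ∀ y, σ (σ⁻¹ y) = y := σ.apply_symm_apply
    refine ⟨?_, fun s => ?_⟩
    · rw [eq_inv_mul_iff_mul_eq, ← (h _).1, hσ]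
    · rw [Equiv.Perm.inv_eq_iff_eq, (h _).2, hσ]

variable {M}

theorem apply_l {e : F.aut Q × Equiv.Perm M.X} (he : e ∈ M.permGroup) {q : S} (hq : q ∈ Q)
    (x : M.X) : e.2 (M.l q x) = M.l (ap e.1 q) (e.2 x) := by
  rw [M.l_coe q hq, (he x).2, M.l_coe _ (ap_mem _ hq), (he x).1, ← ap_mul _ _ hq, mul_inv_rev,
    inv_mul_cancel_right]

theorem l_injective {q q' : S} (hq : q ∈ Q) (hq' : q' ∈ Q) {x : M.X} (h : M.l q x = M.l q' x) :
    q = q' := by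
  rw [M.l_coe q hq, M.l_coe q' hq'] at h
  exact (isoOn_ap _).1.injOn hq hq' (M.r_injective _ _ _ h)

theorem exists_center_eq (hc : Subgroup.centralizer (Q : Set S) ≤ Q)
    {e : F.aut Q × Equiv.Perm M.X} (he : e ∈ M.permGroup) (he1 : e.1 = 1) (x : M.X) :
    ∃ w : Subgroup.center Q, e.2 x = M.l (w : Q) x := by
  have h1 : M.proj x = M.proj (e.2 x) := by rw [(he x).1, he1, one_mul]
  obtain ⟨s, hs⟩ := M.exists_r_eq _ _ h1
  have hsQ : s ∈ Q := by
    refine hc (conjAut_eq_one_iff (F := F).1 ?_)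
    rw [← hs, M.proj_r, left_eq_mul] at h1
    exact h1
  have hq := ap_mem (M.proj x) hsQ
  have h2 : M.l (ap (M.proj x) s) x = e.2 x := by
    rw [M.l_coe _ hq, ← ap_mul _ _ hsQ, inv_mul_cancel, ap_one, hs]
  have h3 : ap (M.proj x) s ∈ Subgroup.centralizer (Q : Set S) := by
    rw [← conjAut_eq_one_iff (F := F)]
    rw [← h2, M.proj_l, right_eq_mul] at h1
    exact h1
  refine ⟨⟨⟨_, hq⟩, Subgroup.mem_center_iff.2 fun y => Subtype.ext ?_⟩, h2.symm⟩
  exact Subgroup.mem_centralizer_iff.1 h3 y y.2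

open Classical in
/-- The element `w` of `Z(Q)` with `σ x = w x`, if it exists. -/
noncomputable def shift (σ : Equiv.Perm M.X) (x : M.X) : Subgroup.center Q :=
  if h : ∃ w : Subgroup.center Q, σ x = M.l (w : Q) x then h.choose else 1

theorem shift_eq {σ : Equiv.Perm M.X} {x : M.X} {w : Subgroup.center Q}
    (h : σ x = M.l (w : Q) x) : shift σ x = w := by
  have h1 : ∃ w : Subgroup.center Q, σ x = M.l (w : Q) x := ⟨w, h⟩
  have h2 := h.symm.trans h1.choose_spec
  rw [shift, dif_pos h1]
  exact Subtype.ext (Subtype.ext (l_injective (w : Q).2 (h1.choose : Q).2 h2).symm)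

theorem shift_congr (hc : Subgroup.centralizer (Q : Set S) ≤ Q)
    {e : F.aut Q × Equiv.Perm M.X} (he : e ∈ M.permGroup) (he1 : e.1 = 1) {x y : M.X}
    (h : (M.proj x : F.aut Q ⧸ (F.conjAut Q).range) = M.proj y) :
    shift e.2 x = shift e.2 y := by
  obtain ⟨s, hs⟩ := QuotientGroup.eq.1 h
  rw [eq_inv_mul_iff_mul_eq, ← M.proj_r] at hs
  obtain ⟨t, rfl⟩ := M.exists_r_eq _ _ hs
  obtain ⟨w, hw⟩ := exists_center_eq hc he he1 x
  rw [shift_eq hw, shift_eq (w := w)]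
  rw [(he _).2, (he _).2, hw, M.l_r, M.l_r]

variable (M) in
/-- A point of the biset over each coset of `Aut_S(Q)` in `Aut_F(Q)`. -/
noncomputable def point (c : F.aut Q ⧸ (F.conjAut Q).range) : M.X :=
  (M.proj_surjective c.out).choose

variable (M) in
theorem coe_proj_point (c : F.aut Q ⧸ (F.conjAut Q).range) :
    (M.proj (M.point c) : F.aut Q ⧸ (F.conjAut Q).range) = c := by
  rw [point, (M.proj_surjective c.out).choose_spec]
  exact Quotient.out_eq c

variable [Fintype (F.aut Q ⧸ (F.conjAut Q).range)]

/-- For `σ` over the identity, the product of the shifts over the cosets of `Aut_S(Q)`.  This is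
the norm map from the module induced from `Z(Q)` to `Z(Q)`. -/
noncomputable def norm (σ : Equiv.Perm M.X) : Subgroup.center Q :=
  ∏ c, shift σ (M.point c)

theorem norm_mul (hc : Subgroup.centralizer (Q : Set S) ≤ Q)
    {e e' : F.aut Q × Equiv.Perm M.X} (he : e ∈ M.permGroup) (he1 : e.1 = 1)
    (he' : e' ∈ M.permGroup) (he1' : e'.1 = 1) :
    norm (e.2 * e'.2) = norm e.2 * norm e'.2 := by
  rw [norm, norm, norm, ← Finset.prod_mul_distrib]
  refine Finset.prod_congr rfl fun c _ => ?_
  obtain ⟨w, hw⟩ := exists_center_eq hc he he1 (M.point c)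
  obtain ⟨w', hw'⟩ := exists_center_eq hc he' he1' (M.point c)
  rw [shift_eq hw, shift_eq hw', mul_comm]
  apply shift_eq
  rw [Equiv.Perm.mul_apply, hw', apply_l he (w' : Q).2, he1, ap_one, hw, ← M.l_mul]
  rfl

theorem norm_one (M : ModelBiset F Q) : norm (1 : Equiv.Perm M.X) = 1 := by
  refine Finset.prod_eq_one fun c _ => shift_eq ?_
  simp [M.l_one]

theorem norm_conj (hc : Subgroup.centralizer (Q : Set S) ≤ Q)
    {e e' : F.aut Q × Equiv.Perm M.X} (he : e ∈ M.permGroup) (he' : e' ∈ M.permGroup)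
    (he1' : e'.1 = 1) (h : norm e'.2 = 1) : norm (e * e' * e⁻¹).2 = 1 := by
  have key : ∀ c, shift (e * e' * e⁻¹).2 (M.point c) =
      Subgroup.centerCongr (e.1 : MulAut Q) (shift e'.2 (M.point (e.1⁻¹ • c))) := by
    intro c
    have hy := exists_center_eq hc he' he1' (e.2⁻¹ (M.point c))
    obtain ⟨w, hw⟩ := hy
    have h1 : shift e'.2 (M.point (e.1⁻¹ • c)) = w := by
      rw [← shift_eq hw]
      apply shift_congr hc he' he1'
      have h2 : M.proj (e.2⁻¹ (M.point c)) = e.1⁻¹ * M.proj (M.point c) :=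
        ((inv_mem he : e⁻¹ ∈ M.permGroup) _).1
      rw [h2, coe_proj_point]
      nth_rw 1 [← M.coe_proj_point c]
      rfl
    rw [h1]
    apply shift_eq
    change e.2 (e'.2 (e.2⁻¹ (M.point c))) = _
    rw [hw, apply_l he (w : Q).2,
      show e.2 (e.2⁻¹ (M.point c)) = M.point c from e.2.apply_symm_apply _]
    congr 1
    exact total_apply _ _
  rw [norm, Finset.prod_congr rfl fun c _ => key c, ← map_prod,
    Fintype.prod_equiv (MulAction.toPerm e.1⁻¹) (fun c => shift e'.2 (M.point (e.1⁻¹ • c)))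
      (fun c => shift e'.2 (M.point c)) fun c => rfl, ← norm, h, _root_.map_one]

/-- The elements of norm one in the kernel of the map from `M.permGroup` to `Aut_F(Q)`. -/
def normOne (M : ModelBiset F Q) (hc : Subgroup.centralizer (Q : Set S) ≤ Q) :
    Subgroup M.permGroup where
  carrier := {e | e.1.1 = 1 ∧ norm e.1.2 = 1}
  mul_mem' := by
    rintro ⟨e, he⟩ ⟨e', he'⟩ ⟨h1, h2⟩ ⟨h1', h2'⟩
    simp only at h1 h2 h1' h2'
    refine ⟨?_, ?_⟩
    · simp [h1, h1']
    · change norm (e.2 * e'.2) = 1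
      rw [norm_mul hc he h1 he' h1', h2, h2', one_mul]
  one_mem' := ⟨rfl, M.norm_one⟩
  inv_mem' := by
    rintro ⟨e, he⟩ ⟨h1, h2⟩
    simp only at h1 h2
    have h3 : (e⁻¹).1 = 1 := by simp [h1]
    refine ⟨h3, ?_⟩
    have h4 := norm_mul hc he h1 (inv_mem he : e⁻¹ ∈ M.permGroup) h3
    rw [h2, one_mul] at h4
    change norm (e⁻¹).2 = 1
    rw [← h4, Prod.snd_inv, mul_inv_cancel, M.norm_one]

instance normOne_normal (M : ModelBiset F Q) (hc : Subgroup.centralizer (Q : Set S) ≤ Q) :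
    (M.normOne hc).Normal := by
  constructor
  rintro ⟨e', he'⟩ ⟨h1, h2⟩ ⟨e, he⟩
  refine ⟨?_, norm_conj hc he he' h1 h2⟩
  change e.1 * e'.1 * e.1⁻¹ = 1
  rw [show e'.1 = 1 from h1, mul_one, mul_inv_cancel]

theorem exists_quotient_normOne [Finite M.X] [Finite S]
    (hc : Subgroup.centralizer (Q : Set S) ≤ Q) :
    ∃ (G : Type u) (_ : Group G) (_ : Finite G) (m : M.permGroup →* G) (π : G →* F.aut Q),
      Function.Surjective m ∧ (∀ e, m e = 1 ↔ e ∈ M.normOne hc) ∧ ∀ e, π (m e) = e.1.1 :=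
  ⟨M.permGroup ⧸ M.normOne hc, inferInstance, inferInstance, QuotientGroup.mk' _,
    QuotientGroup.lift _ ((MonoidHom.fst _ _).comp M.permGroup.subtype) fun _ he => he.1,
    QuotientGroup.mk'_surjective _, QuotientGroup.eq_one_iff, fun _ => rfl⟩

end ModelBiset

open scoped IsMulCommutative in
/-- The group-theoretic core of the existence of models: an extension `G` of `Aut_F(Q)` by `Z(Q)`
that contains `S`, acts on `Q` in the expected way, and induces all morphisms of `F` defined on
overgroups of `Q`. -/
theorem IsNormal.exists_extensionGroup [Finite S] [Fact p.Prime] (hS : IsPGroup p S)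
    (hF : F.IsSaturated p) [Q.Normal] (hQ : F.IsNormal Q)
    (hc : Subgroup.centralizer (Q : Set S) ≤ Q) :
    ∃ (G : Type u) (_ : Group G) (_ : Finite G) (ι : S →* G) (π : G →* F.aut Q),
      Function.Injective ι ∧ (∀ s, π (ι s) = F.conjAut Q s) ∧ Function.Surjective π ∧
      (∀ g, π g = 1 → ∃ z ∈ Subgroup.centralizer (Q : Set S), ι z = g) ∧
      (∀ g, ∀ q ∈ Q, g * ι q * g⁻¹ = ι (ap (π g) q)) ∧
      ∀ P f, Q ≤ P → F.Mor P f → ∃ g, (∀ x ∈ Q, ap (π g) x = f x) ∧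
        ∀ u ∈ P, g * ι u * g⁻¹ = ι (f u) := by
  obtain ⟨hQa, hQr⟩ := hQ.isFullyAutomized hS hF
  obtain ⟨M⟩ := hQr.nonempty_modelBiset
  have := M.finite
  have : Fintype (F.aut Q ⧸ (F.conjAut Q).range) := Fintype.ofFinite _
  have hcop : (Nat.card (Subgroup.center Q)).Coprime (F.conjAut Q).range.index := by
    obtain ⟨T, hT⟩ := hQa
    rw [range_conjAut, ← hT]
    obtain ⟨n, hn⟩ := IsPGroup.iff_card.1 ((hS.to_subgroup Q).to_subgroup (Subgroup.center Q))
    rw [hn]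
    exact ((Nat.Prime.coprime_iff_not_dvd Fact.out).2 T.not_dvd_index).pow_left n
  let L : S →* Equiv.Perm M.X :=
    MonoidHom.toHomPerm
      { toFun := fun s x => M.l s x
        map_one' := funext M.l_one
        map_mul' := fun s t => funext (M.l_mul s t) }
  have hL : ∀ s, (F.conjAut Q s, L s) ∈ M.permGroup := fun s x =>
    ⟨M.proj_l s x, fun t => M.l_r s x t⟩
  let j : S →* M.permGroup := ((F.conjAut Q).prod L).codRestrict _ hL
  have hnorm : ∀ w : Subgroup.center Q, ModelBiset.norm (L (w : Q)) =
      w ^ (F.conjAut Q).range.index := by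
    intro w
    rw [ModelBiset.norm, Finset.prod_congr rfl fun c _ => ModelBiset.shift_eq (w := w) rfl,
      Finset.prod_const, Finset.card_univ, ← Nat.card_eq_fintype_card]
    rfl
  have hcen : ∀ w : Subgroup.center Q, ((w : Q) : S) ∈ Subgroup.centralizer (Q : Set S) := by
    intro w
    rw [Subgroup.mem_centralizer_iff]
    exact fun y hy => congrArg Subtype.val (Subgroup.mem_center_iff.1 w.2 ⟨y, hy⟩)
  obtain ⟨G, _, hG, m, π, hm, hker, hπ⟩ := ModelBiset.exists_quotient_normOne (M := M) hc
  let ι : S →* G := m.comp j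
  have hmor : ∀ P f, Q ≤ P → F.Mor P f → ∃ g, (∀ x ∈ Q, ap (π g) x = f x) ∧
        ∀ u ∈ P, g * ι u * g⁻¹ = ι (f u) := by
    intro P f hQP hf
    have hfQ := hQ.isoOn hf hQP
    let a : F.aut Q := ⟨hfQ.equiv, hfQ.mem_aut⟩
    have ha : ∀ x ∈ Q, ap a x = f x := fun x hx => total_of_mem _ hx
    obtain ⟨σ, h1, h2, h3⟩ := M.exists_perm hS hF hQ hc hQP hf a ha
    let e : M.permGroup := ⟨(a, σ), fun x => ⟨h1 x, h2 x⟩⟩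
    refine ⟨m e, fun x hx => by rw [hπ, ← ha x hx], fun u hu => ?_⟩
    have h4 : e * j u * e⁻¹ = j (f u) := by
      rw [mul_inv_eq_iff_eq_mul]
      refine Subtype.ext (Prod.ext ?_ (Equiv.ext fun x => h3 u hu x))
      change a * F.conjAut Q u = F.conjAut Q (f u) * a
      refine aut_ext fun x hx => ?_
      have hux := hQ.1.conj_mem x hx u
      rw [ap_mul _ _ hx, ap_mul _ _ hx, ap_conjAut _ hx, ap_conjAut _ (ap_mem _ hx),
        ha x hx, ha _ hux, hf.map_conj hu (hQP hx)]
    have h5 := congrArg m h4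
    rw [map_mul, map_mul, map_inv] at h5
    exact h5
  refine ⟨G, inferInstance, hG, ι, π, ?_, fun s => hπ _, ?_, ?_, ?_, hmor⟩
  · rw [injective_iff_map_eq_one]
    intro s hs
    obtain ⟨h1, h2⟩ := (hker (j s)).1 hs
    have hsc := conjAut_eq_one_iff.1 h1
    let w : Subgroup.center Q := ⟨⟨s, hc hsc⟩, Subgroup.mem_center_iff.2 fun y => Subtype.ext
      (Subgroup.mem_centralizer_iff.1 hsc y y.2)⟩
    have h3 : w ^ (F.conjAut Q).range.index = 1 := (hnorm w).symm.trans h2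
    have h4 : w = 1 := (powCoprime hcop).injective (by simpa using h3)
    exact congrArg (fun v : Subgroup.center Q => ((v : Q) : S)) h4
  · intro a
    obtain ⟨g, hg, -⟩ := hmor Q (ap a) le_rfl (isoOn_ap a).1
    exact ⟨g, aut_ext hg⟩
  · intro g hg
    obtain ⟨e, rfl⟩ := hm g
    have he : e.1.1 = 1 := (hπ e).symm.trans hg
    obtain ⟨w, hw⟩ := (powCoprime hcop).surjective (ModelBiset.norm e.1.2)
    rw [powCoprime_apply] at hw
    refine ⟨(w : Q), hcen w, ?_⟩
    rw [← inv_mul_eq_one]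
    change (m (j (w : Q)))⁻¹ * m e = 1
    rw [← map_inv, ← map_mul, hker]
    have hκ : F.conjAut Q ((w : Q) : S) = 1 := conjAut_eq_one_iff.2 (hcen w)
    have h1 : ((j (w : Q))⁻¹).1.1 = 1 := by
      change (F.conjAut Q ((w : Q) : S))⁻¹ = 1
      rw [hκ, inv_one]
    refine ⟨?_, ?_⟩
    · change ((j (w : Q))⁻¹).1.1 * e.1.1 = 1
      rw [h1, he, one_mul]
    · change ModelBiset.norm (((j (w : Q))⁻¹).1.2 * e.1.2) = 1
      rw [ModelBiset.norm_mul hc ((j (w : Q))⁻¹).2 h1 e.2 he, ← hw, ← hnorm]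
      have h2 := ModelBiset.norm_mul hc ((j (w : Q))⁻¹).2 h1 (j (w : Q)).2 hκ
      rw [show ModelBiset.norm (L (w : Q)) = ModelBiset.norm (j (w : Q)).1.2 from rfl, ← h2]
      change ModelBiset.norm ((L (w : Q))⁻¹ * L (w : Q)) = 1
      rw [inv_mul_cancel, M.norm_one]
  · intro g q hq
    obtain ⟨e, rfl⟩ := hm g
    have h1 : e * j q * e⁻¹ = j (ap e.1.1 q) := by
      rw [mul_inv_eq_iff_eq_mul]
      refine Subtype.ext (Prod.ext ?_ (Equiv.ext fun x => ModelBiset.apply_l e.2 hq x))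
      change e.1.1 * F.conjAut Q q = F.conjAut Q (ap e.1.1 q) * e.1.1
      refine aut_ext fun x hx => ?_
      rw [ap_mul _ _ hx, ap_mul _ _ hx, ap_conjAut _ hx, ap_conjAut _ (ap_mem _ hx),
        (isoOn_ap _).1.map_conj hq hx]
    have h5 := congrArg m h1
    rw [map_mul, map_mul, map_inv] at h5
    rw [hπ]
    exact h5

/-- **Existence of models**: a saturated fusion system with a normal centric subgroup is the fusion
system of a finite group `G` with `C_G(O_p(G)) ≤ O_p(G)`. -/
theorem IsNormal.hasModel [Finite S] [Fact p.Prime] (hS : IsPGroup p S)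
    (hF : F.IsSaturated p) (hQ : F.IsNormal Q) (hQc : F.IsCentric Q) : F.HasModel p := by
  have hn : Q.Normal := hQ.1
  have hc := hQc.centralizer_le
  obtain ⟨G, _, hG, ι, π, hι, hπι, hπ, hker, hact, hmor⟩ := hQ.exists_extensionGroup hS hF hc
  obtain ⟨hQa, hQr⟩ := hQ.isFullyAutomized hS hF
  refine ⟨G, inferInstance, hG, ι, ⟨hι, ?_, ?_⟩, ?_⟩
  · have hp : IsPGroup p ι.range := hS.of_surjective ι.rangeRestrict ι.rangeRestrict_surjective
    have h1 : ι.range = (F.conjAut Q).range.comap π := by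
      ext g
      constructor
      · rintro ⟨s, rfl⟩
        exact ⟨s, (hπι s).symm⟩
      · rintro ⟨s, hs⟩
        obtain ⟨z, -, hz⟩ := hker ((ι s)⁻¹ * g) (by rw [map_mul, map_inv, hπι, hs, inv_mul_cancel])
        exact ⟨s * z, by rw [map_mul, hz, mul_inv_cancel_left]⟩
    have h2 : ¬ p ∣ ι.range.index := by
      obtain ⟨T, hT⟩ := hQa
      rw [h1, Subgroup.index_comap_of_surjective _ hπ, range_conjAut, ← hT]
      exact T.not_dvd_index
    exact ⟨hp.toSylow h2, rfl⟩
  · apply FusionSystem.ext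
    funext P R
    ext φ
    constructor
    · intro hφ
      obtain ⟨g, hg, hgφ, -⟩ := hQ.exists_extension
        (mor_of_mem_hom hφ fun x => (total_apply φ x).symm)
      obtain ⟨k, -, hk⟩ := hmor _ g le_sup_right hg
      refine ⟨k, fun x => ?_⟩
      rw [hk x (le_sup_left (a := P) x.2), hgφ x x.2, total_apply]
    · rintro ⟨g, hg⟩
      have hconj : ∀ r ∈ P ⊔ Q, ∃ q, g * ι r * g⁻¹ = ι q := by
        intro r hr
        obtain ⟨u, hu, n, hn, rfl⟩ := Subgroup.mem_sup_of_normal_right.1 hr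
        refine ⟨φ ⟨u, hu⟩ * ap (π g) n, ?_⟩
        rw [map_mul, map_mul, hg, ← hact g n hn]
        group
      obtain ⟨ψ, hψ, hψQ⟩ := hQr.exists_extension (R := P ⊔ Q) (isoOn_ap (π g))
        (fun r _ x hx => hn.conj_mem x hx r) fun r hr => by
          obtain ⟨q, hq⟩ := hconj r hr
          refine ⟨q, fun x hx => hι ?_⟩
          rw [← hact g _ (hn.conj_mem x hx r)]
          simp only [map_mul, map_inv, ← hact g x hx, ← hq]
          group
      obtain ⟨k, hkQ, hk⟩ := hmor _ ψ le_sup_right hψ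
      have h1 : π k = π g := aut_ext fun x hx => by rw [hkQ x hx, hψQ x hx]
      obtain ⟨z, hz, hzk⟩ := hker (k⁻¹ * g) (by rw [map_mul, map_inv, h1, inv_mul_cancel])
      have hzm : z ∈ P ⊔ Q := le_sup_right (a := P) (hc hz)
      refine mem_hom_of_mor ((hψ.comp (F.mor_conj P z) fun x hx =>
        mul_mem (mul_mem hzm (le_sup_left (a := P) hx)) (inv_mem hzm))) fun x => hι ?_
      rw [hg x, ← hk _ (mul_mem (mul_mem hzm (le_sup_left (a := P) x.2)) (inv_mem hzm))]
      simp only [map_mul, map_inv, hzk]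
      group
  · have h1 : Q.map ι ≤ groupOp p G := by
      refine le_sSup ⟨⟨?_⟩, (hS.to_subgroup Q).map ι⟩
      rintro _ ⟨q, hq, rfl⟩ g
      exact ⟨_, ap_mem _ hq, (hact g q hq).symm⟩
    intro g hg
    have h2 : π g = 1 := by
      refine aut_ext fun x hx => hι ?_
      rw [ap_one, ← hact g x hx, ← Subgroup.mem_centralizer_iff.1 hg _ (h1 ⟨x, hx, rfl⟩)]
      group
    obtain ⟨z, hz, rfl⟩ := hker g h2
    exact h1 ⟨z, hc hz, rfl⟩

end FusionSystem

/-! ### A concrete description of the Sylow subgroup -/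

/-- The Sylow subgroup `V ⋊ K` of `SU₄`: the field `K` acts, as upper unitriangular matrices of size
two, by congruence on the space `V` of skew-Hermitian matrices `(a, b; -star b, c)`. -/
@[ext]
structure UnitaryUnipotent (K : Type*) [Field K] [StarRing K] where
  /-- the coordinate of the quotient by `V` -/
  x : K
  /-- the off-diagonal entry of the skew-Hermitian matrix -/
  b : K
  /-- the first diagonal entry of the skew-Hermitian matrix -/
  a : K
  /-- the second diagonal entry of the skew-Hermitian matrix -/
  c : K
  star_a : star a = -a
  star_c : star c = -c

namespace UnitaryUnipotent

variable {K : Type*} [Field K] [StarRing K]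

instance : Mul (UnitaryUnipotent K) where
  mul g h :=
    { x := g.x + h.x
      b := g.b + h.b + g.x * h.c
      a := g.a + h.a + (star g.x * h.b - g.x * star h.b) + g.x * star g.x * h.c
      c := g.c + h.c
      star_a := by
        simp only [star_add, star_sub, star_mul', star_star, g.star_a, h.star_a, h.star_c]
        ring
      star_c := by
        rw [star_add, g.star_c, h.star_c]
        ring }

instance : One (UnitaryUnipotent K) where
  one := ⟨0, 0, 0, 0, by simp, by simp⟩

instance : Inv (UnitaryUnipotent K) where
  inv g :=
    { x := -g.x
      b := -g.b + g.x * g.c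
      a := -g.a + (star g.x * g.b - g.x * star g.b) - g.x * star g.x * g.c
      c := -g.c
      star_a := by
        simp only [star_add, star_sub, star_neg, star_mul', star_star, g.star_a, g.star_c]
        ring
      star_c := by rw [star_neg, g.star_c] }

@[simp] theorem mul_x (g h : UnitaryUnipotent K) : (g * h).x = g.x + h.x := rfl
@[simp] theorem mul_b (g h : UnitaryUnipotent K) : (g * h).b = g.b + h.b + g.x * h.c := rfl
@[simp] theorem mul_a (g h : UnitaryUnipotent K) : (g * h).a =
    g.a + h.a + (star g.x * h.b - g.x * star h.b) + g.x * star g.x * h.c := rfl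
@[simp] theorem mul_c (g h : UnitaryUnipotent K) : (g * h).c = g.c + h.c := rfl
@[simp] theorem one_x : (1 : UnitaryUnipotent K).x = 0 := rfl
@[simp] theorem one_b : (1 : UnitaryUnipotent K).b = 0 := rfl
@[simp] theorem one_a : (1 : UnitaryUnipotent K).a = 0 := rfl
@[simp] theorem one_c : (1 : UnitaryUnipotent K).c = 0 := rfl
@[simp] theorem inv_x (g : UnitaryUnipotent K) : g⁻¹.x = -g.x := rfl
@[simp] theorem inv_b (g : UnitaryUnipotent K) : g⁻¹.b = -g.b + g.x * g.c := rfl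
@[simp] theorem inv_a (g : UnitaryUnipotent K) : g⁻¹.a =
    -g.a + (star g.x * g.b - g.x * star g.b) - g.x * star g.x * g.c := rfl
@[simp] theorem inv_c (g : UnitaryUnipotent K) : g⁻¹.c = -g.c := rfl

instance : Group (UnitaryUnipotent K) :=
  Group.ofLeftAxioms
    (fun g h k => by
      ext <;> simp only [mul_x, mul_b, mul_a, mul_c, star_add, star_mul', k.star_c] <;> ring)
    (fun g => by ext <;> simp)
    fun g => by
      ext <;> simp only [mul_x, mul_b, mul_a, mul_c, inv_x, inv_b, inv_a, inv_c, one_x, one_b,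
        one_a, one_c, star_neg] <;> ring

instance [Finite K] : Finite (UnitaryUnipotent K) :=
  Finite.of_injective (fun g => (g.x, g.b, g.a, g.c)) fun g h e => by
    simp only [Prod.mk.injEq] at e
    exact UnitaryUnipotent.ext e.1 e.2.1 e.2.2.1 e.2.2.2

theorem pow_x (g : UnitaryUnipotent K) (n : ℕ) : (g ^ n).x = n * g.x := by
  induction n with
  | zero => simp
  | succ n ih => rw [pow_succ, mul_x, ih]; push_cast; ring

theorem pow_c (g : UnitaryUnipotent K) (n : ℕ) : (g ^ n).c = n * g.c := by
  induction n with
  | zero => simp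
  | succ n ih => rw [pow_succ, mul_c, ih]; push_cast; ring

theorem pow_b (g : UnitaryUnipotent K) (hx : g.x = 0) (n : ℕ) : (g ^ n).b = n * g.b := by
  induction n with
  | zero => simp
  | succ n ih => rw [pow_succ, mul_b, ih, pow_x, hx]; push_cast; ring

theorem pow_a (g : UnitaryUnipotent K) (hx : g.x = 0) (n : ℕ) : (g ^ n).a = n * g.a := by
  induction n with
  | zero => simp
  | succ n ih => rw [pow_succ, mul_a, ih, pow_x, hx]; push_cast; simp; ring

theorem isPGroup (p : ℕ) [CharP K p] : IsPGroup p (UnitaryUnipotent K) := by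
  intro g
  have hx : (g ^ p).x = 0 := by rw [pow_x, CharP.cast_eq_zero, zero_mul]
  refine ⟨2, ?_⟩
  rw [sq, pow_mul]
  ext
  · simp [pow_x]
  · simp [pow_b _ hx]
  · simp [pow_a _ hx]
  · simp [pow_c]

/-! ### The embedding into the special unitary group -/

open Matrix

/-- The matrix of an element with respect to a basis in which the Hermitian form is
antidiagonal. -/
def toMatrix (g : UnitaryUnipotent K) : Matrix (Fin 4) (Fin 4) K :=
  !![1, g.x, g.b, g.a - star g.x * g.b;
     0, 1, g.c, -(star g.x * g.c) - star g.b;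
     0, 0, 1, -star g.x;
     0, 0, 0, 1]

/-- The antidiagonal Hermitian form. -/
def antidiag (K : Type*) [Field K] : Matrix (Fin 4) (Fin 4) K :=
  !![0, 0, 0, 1; 0, 0, 1, 0; 0, 1, 0, 0; 1, 0, 0, 0]

/-- The change of basis from the antidiagonal form to the standard form, for `t` of norm `-1`. -/
def baseChange (t : K) : Matrix (Fin 4) (Fin 4) K :=
  !![1, t, 0, 0; 0, 0, 1, t; 0, 0, 1 / 2, -(t / 2); 1 / 2, -(t / 2), 0, 0]

theorem matrix_ext {L : Type*} {A B : Matrix (Fin 4) (Fin 4) L}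
    (h00 : A 0 0 = B 0 0) (h01 : A 0 1 = B 0 1) (h02 : A 0 2 = B 0 2) (h03 : A 0 3 = B 0 3)
    (h10 : A 1 0 = B 1 0) (h11 : A 1 1 = B 1 1) (h12 : A 1 2 = B 1 2) (h13 : A 1 3 = B 1 3)
    (h20 : A 2 0 = B 2 0) (h21 : A 2 1 = B 2 1) (h22 : A 2 2 = B 2 2) (h23 : A 2 3 = B 2 3)
    (h30 : A 3 0 = B 3 0) (h31 : A 3 1 = B 3 1) (h32 : A 3 2 = B 3 2)
    (h33 : A 3 3 = B 3 3) : A = B := by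
  ext i j
  fin_cases i <;> fin_cases j <;> assumption

theorem toMatrix_apply (g : UnitaryUnipotent K) :
    g.toMatrix 0 0 = 1 ∧ g.toMatrix 0 1 = g.x ∧ g.toMatrix 0 2 = g.b ∧
      g.toMatrix 0 3 = g.a - star g.x * g.b ∧
      g.toMatrix 1 0 = 0 ∧ g.toMatrix 1 1 = 1 ∧ g.toMatrix 1 2 = g.c ∧
      g.toMatrix 1 3 = -(star g.x * g.c) - star g.b ∧
      g.toMatrix 2 0 = 0 ∧ g.toMatrix 2 1 = 0 ∧ g.toMatrix 2 2 = 1 ∧ g.toMatrix 2 3 = -star g.x ∧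
      g.toMatrix 3 0 = 0 ∧ g.toMatrix 3 1 = 0 ∧ g.toMatrix 3 2 = 0 ∧ g.toMatrix 3 3 = 1 :=
  ⟨rfl, rfl, rfl, rfl, rfl, rfl, rfl, rfl, rfl, rfl, rfl, rfl, rfl, rfl, rfl, rfl⟩

theorem antidiag_apply {L : Type*} [Field L] :
    antidiag L 0 0 = 0 ∧ antidiag L 0 1 = 0 ∧ antidiag L 0 2 = 0 ∧ antidiag L 0 3 = 1 ∧
      antidiag L 1 0 = 0 ∧ antidiag L 1 1 = 0 ∧ antidiag L 1 2 = 1 ∧ antidiag L 1 3 = 0 ∧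
      antidiag L 2 0 = 0 ∧ antidiag L 2 1 = 1 ∧ antidiag L 2 2 = 0 ∧ antidiag L 2 3 = 0 ∧
      antidiag L 3 0 = 1 ∧ antidiag L 3 1 = 0 ∧ antidiag L 3 2 = 0 ∧ antidiag L 3 3 = 0 :=
  ⟨rfl, rfl, rfl, rfl, rfl, rfl, rfl, rfl, rfl, rfl, rfl, rfl, rfl, rfl, rfl, rfl⟩

theorem baseChange_apply {L : Type*} [Field L] (t : L) :
    baseChange t 0 0 = 1 ∧ baseChange t 0 1 = t ∧ baseChange t 0 2 = 0 ∧ baseChange t 0 3 = 0 ∧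
      baseChange t 1 0 = 0 ∧ baseChange t 1 1 = 0 ∧ baseChange t 1 2 = 1 ∧ baseChange t 1 3 = t ∧
      baseChange t 2 0 = 0 ∧ baseChange t 2 1 = 0 ∧ baseChange t 2 2 = 1 / 2 ∧
      baseChange t 2 3 = -(t / 2) ∧
      baseChange t 3 0 = 1 / 2 ∧ baseChange t 3 1 = -(t / 2) ∧ baseChange t 3 2 = 0 ∧
      baseChange t 3 3 = 0 :=
  ⟨rfl, rfl, rfl, rfl, rfl, rfl, rfl, rfl, rfl, rfl, rfl, rfl, rfl, rfl, rfl, rfl⟩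

theorem toMatrix_mul (g h : UnitaryUnipotent K) :
    (g * h).toMatrix = g.toMatrix * h.toMatrix := by
  apply matrix_ext <;>
    simp only [Matrix.mul_apply, Fin.sum_univ_four, toMatrix_apply, mul_x, mul_b, mul_a, mul_c,
      star_add, star_mul', h.star_c] <;>
    ring

theorem toMatrix_one : (1 : UnitaryUnipotent K).toMatrix = 1 := by
  apply matrix_ext <;> simp [toMatrix_apply]

theorem toMatrix_unitary (g : UnitaryUnipotent K) :
    g.toMatrixᴴ * antidiag K * g.toMatrix = antidiag K := by
  apply matrix_ext <;>
    simp only [Matrix.mul_apply, Fin.sum_univ_four, toMatrix_apply, antidiag_apply,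
      Matrix.conjTranspose_apply, star_zero, star_one, star_neg, star_sub, star_mul', star_star,
      g.star_a, g.star_c] <;>
    ring

theorem toMatrix_injective : Function.Injective (toMatrix : UnitaryUnipotent K → _) := by
  intro g h e
  have e' : ∀ i j, g.toMatrix i j = h.toMatrix i j := fun i j => by rw [e]
  have h1 : g.x = h.x := e' 0 1
  have h2 : g.b = h.b := e' 0 2
  have h3 : g.c = h.c := e' 1 2
  have h4 : g.a - star g.x * g.b = h.a - star h.x * h.b := e' 0 3
  rw [h1, h2, sub_left_inj] at h4
  exact UnitaryUnipotent.ext h1 h2 h4 h3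

theorem det_toMatrix (g : UnitaryUnipotent K) : g.toMatrix.det = 1 := by
  rw [Matrix.det_of_isUpperTriangular]
  · simp [toMatrix, Fin.prod_univ_four]
  · intro i j hij
    fin_cases i <;> fin_cases j <;> first | rfl | exact absurd hij (by decide)

theorem baseChange_unitary (h2 : (2 : K) ≠ 0) {t : K} (ht : star t * t = -1) :
    (baseChange t)ᴴ * antidiag K * baseChange t = 1 := by
  have h3 : star (2 : K) = 2 := by simp
  have h4 : (2 : K)⁻¹ * 2 = 1 := inv_mul_cancel₀ h2
  have h5 : star ((1 : K) / 2) = 1 / 2 := by rw [star_div₀, star_one, h3]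
  have h6 : star (t / 2) = star t / 2 := by rw [star_div₀, h3]
  apply matrix_ext <;>
    simp only [Matrix.mul_apply, Fin.sum_univ_four, baseChange_apply, antidiag_apply,
      Matrix.conjTranspose_apply, star_zero, star_one, star_neg, h5, h6, Matrix.one_apply,
      Fin.reduceEq, if_true, if_false] <;>
    ring_nf
  all_goals first | linear_combination h4 | linear_combination -(star t * t) * h4 - ht

/-- An upper unitriangular matrix that preserves the antidiagonal form is of the form
`toMatrix g`. -/
theorem exists_toMatrix_eq {N : Matrix (Fin 4) (Fin 4) K} (hN : Nᴴ * antidiag K * N = antidiag K)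
    (hd : ∀ i, N i i = 1) (ht : ∀ i j, j < i → N i j = 0) :
    ∃ g : UnitaryUnipotent K, g.toMatrix = N := by
  have hN' : ∀ i j, (Nᴴ * antidiag K * N) i j = antidiag K i j := fun i j => by rw [hN]
  have d0 := hd 0
  have d1 := hd 1
  have d2 := hd 2
  have d3 := hd 3
  have t10 := ht 1 0 (by decide)
  have t20 := ht 2 0 (by decide)
  have t30 := ht 3 0 (by decide)
  have t21 := ht 2 1 (by decide)
  have t31 := ht 3 1 (by decide)
  have t32 := ht 3 2 (by decide)
  have e13 := hN' 1 3
  have e22 := hN' 2 2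
  have e23 := hN' 2 3
  have e33 := hN' 3 3
  simp only [Matrix.mul_apply, Fin.sum_univ_four, antidiag_apply, Matrix.conjTranspose_apply,
    d1, d2, d3, t21, t31, t32, star_zero, star_one, mul_zero, zero_mul, mul_one, one_mul,
    add_zero, zero_add] at e13 e22 e23 e33
  have s23 : N 2 3 = -star (N 0 1) := by linear_combination e13
  have s12 : star (N 1 2) = -N 1 2 := by linear_combination e22
  have s13 : N 1 3 = -(star (N 0 1) * N 1 2) - star (N 0 2) := by
    rw [s23, s12] at e23
    linear_combination e23
  refine ⟨⟨N 0 1, N 0 2, N 0 3 + star (N 0 1) * N 0 2, N 1 2, ?_, s12⟩, ?_⟩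
  · rw [s23, s13] at e33
    simp only [star_sub, star_neg, star_mul', star_star, s12] at e33
    simp only [star_add, star_mul', star_star]
    linear_combination e33
  · apply matrix_ext <;>
      simp only [toMatrix_apply, d0, d1, d2, d3, t10, t20, t30, t21, t31, t32, s23, s13]
    ring

theorem diag_pow {L : Type*} [Field L] {N : Matrix (Fin 4) (Fin 4) L}
    (ht : ∀ i j, j < i → N i j = 0) (n : ℕ) :
    (∀ i j, j < i → (N ^ n) i j = 0) ∧ ∀ i, (N ^ n) i i = N i i ^ n := by
  have t10 := ht 1 0 (by decide)
  have t20 := ht 2 0 (by decide)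
  have t30 := ht 3 0 (by decide)
  have t21 := ht 2 1 (by decide)
  have t31 := ht 3 1 (by decide)
  have t32 := ht 3 2 (by decide)
  induction n with
  | zero =>
    refine ⟨fun i j hij => ?_, fun i => by simp⟩
    rw [pow_zero, Matrix.one_apply_ne hij.ne']
  | succ n ih =>
    obtain ⟨ih, ihd⟩ := ih
    have i10 := ih 1 0 (by decide)
    have i20 := ih 2 0 (by decide)
    have i30 := ih 3 0 (by decide)
    have i21 := ih 2 1 (by decide)
    have i31 := ih 3 1 (by decide)
    have i32 := ih 3 2 (by decide)
    refine ⟨fun i j hij => ?_, fun i => ?_⟩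
    · rw [pow_succ, Matrix.mul_apply, Fin.sum_univ_four]
      fin_cases i <;> fin_cases j <;> simp at hij <;> simp [*]
    · rw [pow_succ, Matrix.mul_apply, Fin.sum_univ_four, pow_succ, ← ihd]
      fin_cases i <;> simp [*]

/-- A matrix of `p`-power order that preserves the antidiagonal form and normalizes the group of
all `toMatrix g` belongs to it: it fixes the flag of that group, hence is triangular, and its
diagonal entries are `p`-power roots of unity. -/
theorem exists_toMatrix_eq_of_normalizes {p k : ℕ} [Fact p.Prime] [CharP K p] {δ : K} (hδ : δ ≠ 0)
    (hδs : star δ = -δ) {N : Matrix (Fin 4) (Fin 4) K} (hN : Nᴴ * antidiag K * N = antidiag K)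
    (hk : N ^ p ^ k = 1)
    (hn : ∀ g : UnitaryUnipotent K, ∃ h : UnitaryUnipotent K,
      g.toMatrix * N = N * h.toMatrix) : ∃ g : UnitaryUnipotent K, g.toMatrix = N := by
  let gx : UnitaryUnipotent K := ⟨1, 0, 0, 0, by simp, by simp⟩
  let gc : UnitaryUnipotent K := ⟨0, 0, 0, δ, by simp, hδs⟩
  obtain ⟨h, hx⟩ := hn gx
  obtain ⟨h', hc⟩ := hn gc
  have hx' : ∀ i j, (gx.toMatrix * N) i j = (N * h.toMatrix) i j := fun i j => by rw [hx]
  have hc' : ∀ i j, (gc.toMatrix * N) i j = (N * h'.toMatrix) i j := fun i j => by rw [hc]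
  have t30 : N 3 0 = 0 := by
    have := hx' 2 0
    simpa [toMatrix_apply, gx, gc, Matrix.mul_apply, Fin.sum_univ_four] using this
  have t20 : N 2 0 = 0 := by
    have := hc' 1 0
    simpa [toMatrix_apply, gx, gc, Matrix.mul_apply, Fin.sum_univ_four, t30, hδ] using this
  have t10 : N 1 0 = 0 := by
    have := hx' 0 0
    simpa [toMatrix_apply, gx, gc, Matrix.mul_apply, Fin.sum_univ_four, t30, t20] using this
  have t31 : N 3 1 = 0 := by
    have := hx' 2 1
    simpa [toMatrix_apply, gx, gc, Matrix.mul_apply, Fin.sum_univ_four, t30, t20, t10] using this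
  have t21 : N 2 1 = 0 := by
    have := hc' 1 1
    simpa [toMatrix_apply, gx, gc, Matrix.mul_apply, Fin.sum_univ_four, t30, t20, t10, t31,
      hδ] using this
  have t32 : N 3 2 = 0 := by
    have := hx' 2 2
    simpa [toMatrix_apply, gx, gc, Matrix.mul_apply, Fin.sum_univ_four, t30, t20, t10, t31,
      t21] using this
  have ht : ∀ i j, j < i → N i j = 0 := by
    intro i j hij
    fin_cases i <;> fin_cases j <;> simp at hij <;> assumption
  refine exists_toMatrix_eq hN (fun i => ?_) ht
  have h1 := (diag_pow ht (p ^ k)).2 i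
  rw [hk, Matrix.one_apply_eq] at h1
  have h2 : (N i i - 1) ^ p ^ k = 0 := by rw [sub_pow_char_pow, ← h1, one_pow, sub_self]
  exact sub_eq_zero.1 (pow_eq_zero_iff (pow_ne_zero _ (Fact.out : p.Prime).ne_zero) |>.1 h2)

end UnitaryUnipotent

/-! ### The field with `p ^ 2` elements -/

namespace GaloisField

variable {p : ℕ} [Fact p.Prime]

theorem star_eq (r : GaloisField p 2) : star r = r ^ p := rfl

theorem exists_intCast_of_star_eq {r : GaloisField p 2} (h : star r = r) :
    ∃ n : ℤ, (n : GaloisField p 2) = r :=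
  (mem_bot_iff_intCast p _).1 ((Subfield.mem_bot_iff_pow_eq_self _ p).2 h)

theorem exists_unit_orderOf (p : ℕ) [Fact p.Prime] :
    ∃ g : (GaloisField p 2)ˣ, orderOf g = (p - 1) * (p + 1) := by
  obtain ⟨g, hg⟩ := IsCyclic.exists_generator (α := (GaloisField p 2)ˣ)
  refine ⟨g, ?_⟩
  have h1 : 1 ≤ p := (Fact.out : p.Prime).one_le
  rw [orderOf_eq_card_of_forall_mem_zpowers hg, Nat.card_units, GaloisField.card p 2 two_ne_zero]
  zify [h1, Nat.one_le_pow 2 p h1]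
  ring

theorem exists_star_eq_neg (p : ℕ) [Fact p.Prime] :
    ∃ δ : GaloisField p 2, δ ≠ 0 ∧ star δ = -δ := by
  obtain ⟨g, hg⟩ := exists_unit_orderOf p
  have h2 : 2 ≤ p := (Fact.out : p.Prime).two_le
  refine ⟨g - star (g : GaloisField p 2), fun h => ?_, by rw [star_sub, star_star, neg_sub]⟩
  have h3 : g ^ (p - 1) = 1 := by
    have h4 : g * g ^ (p - 1) = g := by
      rw [← pow_succ', Nat.sub_add_cancel (by lia)]
      exact Units.ext (by rw [Units.val_pow_eq_pow_val]; exact (sub_eq_zero.1 h).symm)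
    exact mul_eq_left.1 h4
  have h5 := Nat.le_of_dvd (by lia) (orderOf_dvd_of_pow_eq_one h3)
  rw [hg] at h5
  nlinarith [Nat.sub_add_cancel (show 1 ≤ p by lia)]

theorem two_ne_zero_of_odd (hp : Odd p) : (2 : GaloisField p 2) ≠ 0 := by
  intro h
  have h1 : ((2 : ℕ) : GaloisField p 2) = 0 := by exact_mod_cast h
  rw [CharP.cast_eq_zero_iff _ p] at h1
  have h2 := (Nat.prime_dvd_prime_iff_eq Fact.out Nat.prime_two).1 h1
  exact absurd hp (by rw [h2]; decide)

theorem exists_star_mul_self_eq_neg_one (hp : Odd p) : ∃ t : GaloisField p 2, star t * t = -1 := by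
  obtain ⟨g, hg⟩ := exists_unit_orderOf p
  obtain ⟨m, rfl⟩ := hp
  have h2 := (Fact.out : (2 * m + 1).Prime).two_le
  have hm : 0 < m := by lia
  have h1 : (g ^ (m * (2 * m + 2)) : (GaloisField (2 * m + 1) 2)ˣ) ≠ 1 := by
    refine pow_ne_one_of_lt_orderOf (by positivity) ?_
    rw [hg]
    exact Nat.mul_lt_mul_of_pos_right (by lia) (by lia)
  have h3 : (g ^ (m * (2 * m + 2)) : (GaloisField (2 * m + 1) 2)ˣ) ^ 2 = 1 := by
    rw [← pow_mul, ← orderOf_dvd_iff_pow_eq_one, hg]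
    exact dvd_of_eq (by rw [Nat.add_sub_cancel]; ring)
  refine ⟨((g ^ m : (GaloisField (2 * m + 1) 2)ˣ) : GaloisField (2 * m + 1) 2), ?_⟩
  rw [star_eq, ← pow_succ]
  have h4 : ((g ^ m : (GaloisField (2 * m + 1) 2)ˣ) : GaloisField (2 * m + 1) 2) ^ (2 * m + 1 + 1) =
      (g ^ (m * (2 * m + 2)) : (GaloisField (2 * m + 1) 2)ˣ) := by
    rw [pow_mul, Units.val_pow_eq_pow_val _ (2 * m + 2)]
  rw [h4]
  have h5 : ((g ^ (m * (2 * m + 2)) : (GaloisField (2 * m + 1) 2)ˣ) :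
      GaloisField (2 * m + 1) 2) ^ 2 = 1 := by
    rw [← Units.val_pow_eq_pow_val, h3, Units.val_one]
  exact (sq_eq_one_iff.1 h5).resolve_left fun h => h1 (Units.ext h)

end GaloisField

/-! ### The Sylow subgroups of the special unitary group -/

namespace UnitaryUnipotent

open Matrix

section Embedding

variable {K : Type*} [Field K] [StarRing K]

theorem conjTranspose_antidiag : (antidiag K)ᴴ = antidiag K := by
  apply matrix_ext <;> simp [antidiag_apply]

variable {P : Matrix (Fin 4) (Fin 4) K}

/-- If the columns of `P` are orthonormal for the antidiagonal form, then `Pᴴ * antidiag K`, the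
inverse of `P`, carries the antidiagonal form to the standard one. -/
theorem conjTranspose_mul_antidiag_isometry (hP : Pᴴ * antidiag K * P = 1) :
    (Pᴴ * antidiag K)ᴴ * (Pᴴ * antidiag K) = antidiag K := by
  have h := mul_eq_one_comm.1 hP
  rw [conjTranspose_mul, conjTranspose_conjTranspose, conjTranspose_antidiag]
  calc antidiag K * P * (Pᴴ * antidiag K) = antidiag K * (P * (Pᴴ * antidiag K)) := by
        rw [Matrix.mul_assoc]
    _ = antidiag K := by rw [h, Matrix.mul_one]

/-- The embedding of the concrete group into the special unitary group given by a change of basis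
`P` between the antidiagonal and the standard form. -/
def toSpecialUnitary (hP : Pᴴ * antidiag K * P = 1) :
    UnitaryUnipotent K →* Matrix.specialUnitaryGroup (Fin 4) K where
  toFun g := ⟨Pᴴ * antidiag K * g.toMatrix * P, by
    rw [mem_specialUnitaryGroup_iff, mem_unitaryGroup_iff']
    constructor
    · rw [star_eq_conjTranspose, conjTranspose_mul, conjTranspose_mul (Pᴴ * antidiag K)]
      calc Pᴴ * (g.toMatrixᴴ * (Pᴴ * antidiag K)ᴴ) * (Pᴴ * antidiag K * g.toMatrix * P)
          = Pᴴ * (g.toMatrixᴴ * ((Pᴴ * antidiag K)ᴴ * (Pᴴ * antidiag K)) * g.toMatrix) * P := by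
            simp only [Matrix.mul_assoc]
        _ = 1 := by rw [conjTranspose_mul_antidiag_isometry hP, toMatrix_unitary, hP]
    · rw [det_mul, det_mul _ g.toMatrix, det_toMatrix, mul_one, ← det_mul, hP, det_one]⟩
  map_one' := Subtype.ext (by
    change Pᴴ * antidiag K * (1 : UnitaryUnipotent K).toMatrix * P = 1
    rw [toMatrix_one, Matrix.mul_one, hP])
  map_mul' g h := Subtype.ext (by
    change Pᴴ * antidiag K * (g * h).toMatrix * P =
      Pᴴ * antidiag K * g.toMatrix * P * (Pᴴ * antidiag K * h.toMatrix * P)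
    calc Pᴴ * antidiag K * (g * h).toMatrix * P
        = Pᴴ * antidiag K * g.toMatrix * (P * (Pᴴ * antidiag K)) * h.toMatrix * P := by
          rw [mul_eq_one_comm.1 hP, Matrix.mul_one, toMatrix_mul, ← Matrix.mul_assoc]
      _ = _ := by simp only [Matrix.mul_assoc])

theorem coe_toSpecialUnitary (hP : Pᴴ * antidiag K * P = 1) (g : UnitaryUnipotent K) :
    (toSpecialUnitary hP g : Matrix (Fin 4) (Fin 4) K) = Pᴴ * antidiag K * g.toMatrix * P := rfl

theorem toMatrix_mul_eq (hP : Pᴴ * antidiag K * P = 1) (g : UnitaryUnipotent K) :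
    P * (toSpecialUnitary hP g : Matrix (Fin 4) (Fin 4) K) = g.toMatrix * P := by
  rw [coe_toSpecialUnitary, ← Matrix.mul_assoc, ← Matrix.mul_assoc, mul_eq_one_comm.1 hP,
    Matrix.one_mul]

theorem toSpecialUnitary_injective (hP : Pᴴ * antidiag K * P = 1) :
    Function.Injective (toSpecialUnitary hP) := by
  intro g h e
  have h1 : g.toMatrix * P = h.toMatrix * P := by
    rw [← toMatrix_mul_eq hP, ← toMatrix_mul_eq hP, e]
  refine toMatrix_injective ?_
  have h2 := congrArg (· * (Pᴴ * antidiag K)) h1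
  simpa only [Matrix.mul_assoc _ P, mul_eq_one_comm.1 hP, Matrix.mul_one] using h2

end Embedding

/-- For odd `p`, every Sylow `p`-subgroup of `SU₄(p)` is isomorphic to the concrete group over the
field with `p ^ 2` elements. -/
theorem nonempty_sylow_mulEquiv {p : ℕ} [Fact p.Prime] (hp : Odd p)
    (S : Sylow p (Matrix.specialUnitaryGroup (Fin 4) (GaloisField p 2))) :
    Nonempty (S ≃* UnitaryUnipotent (GaloisField p 2)) := by
  obtain ⟨t, ht⟩ := GaloisField.exists_star_mul_self_eq_neg_one hp
  obtain ⟨δ, hδ, hδs⟩ := GaloisField.exists_star_eq_neg p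
  have hP := baseChange_unitary (GaloisField.two_ne_zero_of_odd hp) ht
  generalize baseChange t = P at hP
  have hPQ := mul_eq_one_comm.1 hP
  have hR : IsPGroup p (toSpecialUnitary hP).range :=
    (isPGroup p).of_surjective _ (toSpecialUnitary hP).rangeRestrict_surjective
  obtain ⟨T, hT⟩ := hR.exists_le_sylow
  have hT' : (T : Subgroup _) = (toSpecialUnitary hP).range := by
    by_contra hne
    -- A `p`-element outside the image that normalizes the image.
    obtain ⟨g, hgT, hgR, hgN⟩ : ∃ g ∈ T, g ∉ (toSpecialUnitary hP).range ∧
        g ∈ Subgroup.normalizer ((toSpecialUnitary hP).range : Set _) := by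
      have hlt : (toSpecialUnitary hP).range.subgroupOf T < ⊤ :=
        lt_top_iff_ne_top.2 fun h => hne (le_antisymm (Subgroup.subgroupOf_eq_top.1 h) hT)
      obtain ⟨r, -, hr, hrn⟩ := T.isPGroup'.exists_mem_normalizer hlt
      refine ⟨r, r.2, fun h => hr h, Subgroup.mem_normalizer_iff.2 fun x => ?_⟩
      have key := Subgroup.mem_normalizer_iff.1 hrn
      constructor
      · intro hx
        exact (key ⟨x, hT hx⟩).1 hx
      · intro hx
        have hxT : x ∈ (T : Subgroup _) := by
          have := T.mul_mem (T.mul_mem (T.inv_mem r.2) (hT hx)) r.2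
          simpa only [mul_assoc, inv_mul_cancel_left, inv_mul_cancel, mul_one] using this
        exact (key ⟨x, hxT⟩).2 hx
    obtain ⟨k, hk⟩ := T.isPGroup' ⟨g, hgT⟩
    have hk' : g.1 ^ p ^ k = 1 := by
      have h1 : g ^ p ^ k = 1 := congrArg Subtype.val hk
      have h2 := congrArg Subtype.val h1
      simpa using h2
    have hg1 : g.1ᴴ * g.1 = 1 :=
      mem_unitaryGroup_iff'.1 (mem_specialUnitaryGroup_iff.1 g.2).1
    have hmem : ∃ h : UnitaryUnipotent (GaloisField p 2),
        h.toMatrix = P * g.1 * (Pᴴ * antidiag _) := by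
      refine exists_toMatrix_eq_of_normalizes (p := p) (k := k) hδ hδs ?_ ?_ ?_
      · rw [conjTranspose_mul, conjTranspose_mul P]
        calc _ = (Pᴴ * antidiag _)ᴴ * (g.1ᴴ *
              (Pᴴ * antidiag _ * P) * g.1) * (Pᴴ * antidiag _) := by simp only [Matrix.mul_assoc]
          _ = _ := by
            rw [hP, Matrix.mul_one, hg1, Matrix.mul_one, conjTranspose_mul_antidiag_isometry hP]
      · have hconj : ∀ n : ℕ, (P * g.1 * (Pᴴ * antidiag _)) ^ n =
            P * g.1 ^ n * (Pᴴ * antidiag _) := by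
          intro n
          induction n with
          | zero => rw [pow_zero, pow_zero, Matrix.mul_one, hPQ]
          | succ n ih =>
            rw [pow_succ, pow_succ, ih]
            calc _ = P * g.1 ^ n *
                  (Pᴴ * antidiag _ * P) * g.1 * (Pᴴ * antidiag _) := by simp only [Matrix.mul_assoc]
              _ = _ := by rw [hP, Matrix.mul_one]; simp only [Matrix.mul_assoc]
        rw [hconj, hk', Matrix.mul_one, hPQ]
      · intro u
        have h1 := (Subgroup.mem_normalizer_iff''.1 hgN (toSpecialUnitary hP u)).1 ⟨u, rfl⟩
        obtain ⟨v, hv⟩ := h1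
        refine ⟨v, ?_⟩
        have h2 : toSpecialUnitary hP u * g = g * toSpecialUnitary hP v := by
          rw [hv]
          group
        have h3 : (toSpecialUnitary hP u).1 * g.1 = g.1 * (toSpecialUnitary hP v).1 :=
          congrArg Subtype.val h2
        calc u.toMatrix * (P * g.1 * (Pᴴ * antidiag _))
            = P * ((toSpecialUnitary hP u).1 * g.1) * (Pᴴ * antidiag _) := by
              rw [← Matrix.mul_assoc P, toMatrix_mul_eq]
              simp only [Matrix.mul_assoc]
          _ = P * g.1 * (Pᴴ * antidiag _) * v.toMatrix := by
              rw [h3, coe_toSpecialUnitary]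
              calc _ = P * g.1 * (Pᴴ * antidiag _) * v.toMatrix * (P * (Pᴴ * antidiag _)) := by
                    simp only [Matrix.mul_assoc]
                _ = _ := by rw [hPQ, Matrix.mul_one]
    obtain ⟨h, hh⟩ := hmem
    refine hgR ⟨h, Subtype.ext ?_⟩
    rw [coe_toSpecialUnitary, hh]
    calc Pᴴ * antidiag _ * (P * g.1 * (Pᴴ * antidiag _)) * P
        = (Pᴴ * antidiag _ * P) * g.1 * (Pᴴ * antidiag _ * P) := by simp only [Matrix.mul_assoc]
      _ = g.1 := by rw [hP, Matrix.one_mul, Matrix.mul_one]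
  have : Finite (Matrix (Fin 4) (Fin 4) (GaloisField p 2)) := by
    unfold Matrix; infer_instance
  exact ⟨(S.equiv T).trans ((MulEquiv.subgroupCongr hT').trans
    (MonoidHom.ofInjective (toSpecialUnitary_injective hP)).symm)⟩

end UnitaryUnipotent

/-! ### Subgroups of the Sylow subgroup -/

namespace GaloisField

variable {p : ℕ} [Fact p.Prime]

/-- The alternating form `star x * b - x * star b` is not degenerate. -/
theorem exists_pairing_ne (hp : Odd p) {x : GaloisField p 2} (hx : x ≠ 0) :
    ∃ b : GaloisField p 2, star x * b ≠ x * star b := by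
  obtain ⟨δ, hδ, hδs⟩ := exists_star_eq_neg p
  refine ⟨x * δ, fun h => ?_⟩
  rw [star_mul', hδs] at h
  have h1 : 2 * (star x * x * δ) = 0 := by linear_combination h
  exact mul_ne_zero (two_ne_zero_of_odd hp) (mul_ne_zero (mul_ne_zero (star_ne_zero.2 hx) hx) hδ) h1

/-- If `x` and `b` pair trivially, then they are proportional over the prime field. -/
theorem exists_intCast_mul {x b : GaloisField p 2} (hb : b ≠ 0) (h : star x * b = x * star b) :
    ∃ n : ℤ, x = n * b := by
  obtain ⟨n, hn⟩ := exists_intCast_of_star_eq (r := x / b) (by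
    rw [star_div₀, div_eq_div_iff (star_ne_zero.2 hb) hb, h])
  exact ⟨n, by rw [hn, div_mul_cancel₀ x hb]⟩

theorem exists_intCast_mul_of_skew {x b : GaloisField p 2} (hb : b ≠ 0) (hx : star x = -x)
    (hbs : star b = -b) : ∃ n : ℤ, x = n * b :=
  exists_intCast_mul hb (by rw [hx, hbs]; ring)

/-- Two elements that pair nontrivially form a basis over the prime field. -/
theorem exists_intCast_combination {x y : GaloisField p 2} (h : star x * y ≠ x * star y)
    (b : GaloisField p 2) : ∃ m k : ℤ, b = m * x + k * y := by
  have h0 : star x * y - x * star y ≠ 0 := sub_ne_zero.2 h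
  have hs : ∀ u v : GaloisField p 2, star (star u * v - u * star v) = -(star u * v - u * star v) :=
    fun u v => by
      rw [star_sub, star_mul', star_mul', star_star, star_star]
      ring
  obtain ⟨m, hm⟩ := exists_intCast_mul_of_skew h0 (hs b y) (hs x y)
  obtain ⟨k, hk⟩ := exists_intCast_mul_of_skew h0 (hs x b) (hs x y)
  refine ⟨m, k, mul_right_cancel₀ h0 ?_⟩
  linear_combination x * hm + y * hk

theorem star_intCast (n : ℤ) : star (n : GaloisField p 2) = n := by simp

theorem add_intCast_ne_zero (hp : Odd p) {δ : GaloisField p 2} (hδ : δ ≠ 0) (hδs : star δ = -δ)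
    (n : ℤ) : δ + n ≠ 0 := by
  intro h
  have h1 := congrArg star h
  rw [star_add, hδs, star_intCast, star_zero] at h1
  exact mul_ne_zero (two_ne_zero_of_odd hp) hδ (by linear_combination h - h1)

end GaloisField

namespace UnitaryUnipotent

section Field

variable {K : Type*} [Field K] [StarRing K]

theorem comm_x (g h : UnitaryUnipotent K) : (g * h * g⁻¹ * h⁻¹).x = 0 := by
  simp only [mul_x, inv_x]
  ring

theorem comm_c (g h : UnitaryUnipotent K) : (g * h * g⁻¹ * h⁻¹).c = 0 := by
  simp only [mul_c, inv_c]
  ring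

theorem comm_b (g h : UnitaryUnipotent K) :
    (g * h * g⁻¹ * h⁻¹).b = g.x * h.c - h.x * g.c := by
  simp only [mul_x, mul_b, inv_x, inv_b, inv_c]
  ring

theorem comm_a (g h : UnitaryUnipotent K) : (g * h * g⁻¹ * h⁻¹).a =
    (star g.x * h.b - g.x * star h.b) + g.x * star g.x * h.c -
      (star h.x * g.b - h.x * star g.b) - h.x * star h.x * g.c := by
  simp only [mul_x, mul_a, inv_x, inv_b, inv_a, inv_c, star_add, star_neg, star_mul', g.star_c,
    h.star_c]
  ring

theorem zpow_a (g : UnitaryUnipotent K) (hx : g.x = 0) (n : ℤ) : (g ^ n).a = n * g.a := by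
  obtain ⟨n, rfl | rfl⟩ := n.eq_nat_or_neg
  · simp [pow_a _ hx]
  · simp [pow_a _ hx, pow_x, hx]

theorem zpow_b (g : UnitaryUnipotent K) (hx : g.x = 0) (n : ℤ) : (g ^ n).b = n * g.b := by
  obtain ⟨n, rfl | rfl⟩ := n.eq_nat_or_neg
  · simp [pow_b _ hx]
  · simp [pow_b _ hx, pow_x, hx]

theorem zpow_c (g : UnitaryUnipotent K) (n : ℤ) : (g ^ n).c = n * g.c := by
  obtain ⟨n, rfl | rfl⟩ := n.eq_nat_or_neg <;> simp [pow_c]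

theorem zpow_x (g : UnitaryUnipotent K) (n : ℤ) : (g ^ n).x = n * g.x := by
  obtain ⟨n, rfl | rfl⟩ := n.eq_nat_or_neg <;> simp [pow_x]

variable {S : Type*} [Group S] (e : S ≃* UnitaryUnipotent K)

/-- The centre of the Sylow subgroup. -/
def Z : Subgroup S where
  carrier := {g | (e g).x = 0 ∧ (e g).b = 0 ∧ (e g).c = 0}
  mul_mem' := by
    rintro g h ⟨h1, h2, h3⟩ ⟨k1, k2, k3⟩
    simp [h1, h2, h3, k1, k2, k3]
  one_mem' := by simp
  inv_mem' := by
    rintro g ⟨h1, h2, h3⟩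
    simp [h1, h2, h3]

/-- The second centre of the Sylow subgroup, which is also its derived subgroup. -/
def W : Subgroup S where
  carrier := {g | (e g).x = 0 ∧ (e g).c = 0}
  mul_mem' := by
    rintro g h ⟨h1, h3⟩ ⟨k1, k3⟩
    simp [h1, h3, k1, k3]
  one_mem' := by simp
  inv_mem' := by
    rintro g ⟨h1, h3⟩
    simp [h1, h3]

/-- The abelian subgroup of index `p ^ 2`: the unipotent radical of the stabilizer of a totally
isotropic plane. -/
def V : Subgroup S where
  carrier := {g | (e g).x = 0}
  mul_mem' := by
    rintro g h (h1 : (e g).x = 0) (k1 : (e h).x = 0)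
    simp [h1, k1]
  one_mem' := by simp
  inv_mem' := by
    rintro g (h1 : (e g).x = 0)
    simp [h1]

/-- The extraspecial subgroup of index `p`: the unipotent radical of the stabilizer of an isotropic
line. -/
def Q : Subgroup S where
  carrier := {g | (e g).c = 0}
  mul_mem' := by
    rintro g h (h1 : (e g).c = 0) (k1 : (e h).c = 0)
    simp [h1, k1]
  one_mem' := by simp
  inv_mem' := by
    rintro g (h1 : (e g).c = 0)
    simp [h1]

variable {e} {g h s t : S}

theorem mem_Z : g ∈ Z e ↔ (e g).x = 0 ∧ (e g).b = 0 ∧ (e g).c = 0 := Iff.rfl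
theorem mem_W : g ∈ W e ↔ (e g).x = 0 ∧ (e g).c = 0 := Iff.rfl
theorem mem_V : g ∈ V e ↔ (e g).x = 0 := Iff.rfl
theorem mem_Q : g ∈ Q e ↔ (e g).c = 0 := Iff.rfl

theorem Z_le_W : Z e ≤ W e := fun _ h => ⟨h.1, h.2.2⟩
theorem W_le_V : W e ≤ V e := fun _ h => h.1
theorem W_le_Q : W e ≤ Q e := fun _ h => h.2

/-- The element of the Sylow subgroup with given coordinates `x` and `b`. -/
def ofXB (e : S ≃* UnitaryUnipotent K) (x b : K) : S := e.symm ⟨x, b, 0, 0, by simp, by simp⟩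

/-- The element of the Sylow subgroup with given coordinate `c`. -/
def ofC (e : S ≃* UnitaryUnipotent K) (c : K) (hc : star c = -c) : S :=
  e.symm ⟨0, 0, 0, c, by simp, hc⟩

@[simp] theorem ofXB_x (x b : K) : (e (ofXB e x b)).x = x := by simp [ofXB]
@[simp] theorem ofXB_b (x b : K) : (e (ofXB e x b)).b = b := by simp [ofXB]
@[simp] theorem ofXB_c (x b : K) : (e (ofXB e x b)).c = 0 := by simp [ofXB]
@[simp] theorem ofC_x (c : K) (hc) : (e (ofC e c hc)).x = 0 := by simp [ofC]
@[simp] theorem ofC_c (c : K) (hc) : (e (ofC e c hc)).c = c := by simp [ofC]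

theorem map_comm (g h : S) : e (g * h * g⁻¹ * h⁻¹) = e g * e h * (e g)⁻¹ * (e h)⁻¹ := by
  simp only [map_mul, map_inv]

theorem eq_one_iff : g = 1 ↔ (e g).x = 0 ∧ (e g).b = 0 ∧ (e g).a = 0 ∧ (e g).c = 0 := by
  constructor
  · rintro rfl
    simp
  · rintro ⟨h1, h2, h3, h4⟩
    apply e.injective
    rw [map_one]
    exact UnitaryUnipotent.ext h1 h2 h3 h4

theorem comm_eq_one_iff {G : Type*} [Group G] {g h : G} :
    g * h * g⁻¹ * h⁻¹ = 1 ↔ g * h = h * g := by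
  rw [mul_inv_eq_one, mul_inv_eq_iff_eq_mul]

theorem mul_comm_iff (e : S ≃* UnitaryUnipotent K) : g * h = h * g ↔
    (e g).x * (e h).c = (e h).x * (e g).c ∧
      (star (e g).x * (e h).b - (e g).x * star (e h).b) + (e g).x * star (e g).x * (e h).c =
        (star (e h).x * (e g).b - (e h).x * star (e g).b) + (e h).x * star (e h).x * (e g).c := by
  rw [← comm_eq_one_iff, eq_one_iff (e := e), map_comm, comm_x, comm_b, comm_a, comm_c]
  constructor
  · rintro ⟨-, h1, h2, -⟩
    exact ⟨by linear_combination h1, by linear_combination h2⟩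
  · rintro ⟨h1, h2⟩
    exact ⟨rfl, by linear_combination h1, by linear_combination h2, rfl⟩

theorem comm_mem_W (g h : S) : g * h * g⁻¹ * h⁻¹ ∈ W e := by
  rw [mem_W, map_comm]
  exact ⟨comm_x _ _, comm_c _ _⟩

theorem comm_mem_Z_iff : g * h * g⁻¹ * h⁻¹ ∈ Z e ↔ (e g).x * (e h).c = (e h).x * (e g).c := by
  rw [mem_Z, map_comm, comm_x, comm_b, comm_c, sub_eq_zero]
  simp

theorem comm_mem_Z (hg : g ∈ W e) (h : S) : g * h * g⁻¹ * h⁻¹ ∈ Z e := by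
  rw [comm_mem_Z_iff, hg.1, hg.2, zero_mul, mul_zero]

theorem comm_mem_Z' (hg : g ∈ W e) (h : S) : h * g * h⁻¹ * g⁻¹ ∈ Z e := by
  rw [comm_mem_Z_iff, hg.1, hg.2, zero_mul, mul_zero]

theorem mul_comm_of_mem_Z (hg : g ∈ Z e) (h : S) : g * h = h * g := by
  rw [mul_comm_iff e, hg.1, hg.2.1, hg.2.2]
  simp

theorem mul_comm_of_mem_V (hg : g ∈ V e) (hh : h ∈ V e) : g * h = h * g := by
  rw [mul_comm_iff e, mem_V.1 hg, mem_V.1 hh]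
  simp

theorem normal_of_W_le {H : Subgroup S} (h : W e ≤ H) : H.Normal :=
  ⟨fun x hx g => by
    have := H.mul_mem (h (comm_mem_W (e := e) g x)) hx
    rwa [inv_mul_cancel_right] at this⟩

end Field

variable {p : ℕ} [Fact p.Prime] {S : Type*} [Group S] {e : S ≃* UnitaryUnipotent (GaloisField p 2)}
  {g h s t : S} {H N : Subgroup S}

/-- The centre has order `p`, so it is generated by each of its nontrivial elements. -/
theorem Z_le_of_mem (hg : g ∈ Z e) (h1 : g ≠ 1) (hH : g ∈ H) : Z e ≤ H := by
  intro z hz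
  have ha : (e g).a ≠ 0 := fun h => h1 ((eq_one_iff (e := e)).2 ⟨hg.1, hg.2.1, h, hg.2.2⟩)
  obtain ⟨n, hn⟩ := GaloisField.exists_intCast_mul_of_skew ha (e z).star_a (e g).star_a
  have h2 : z = g ^ n := by
    apply e.injective
    rw [map_zpow]
    refine UnitaryUnipotent.ext ?_ ?_ ?_ ?_
    · rw [zpow_x, hg.1, hz.1, mul_zero]
    · rw [zpow_b _ hg.1, hg.2.1, hz.2.1, mul_zero]
    · rw [zpow_a _ hg.1, hn]
    · rw [zpow_c, hg.2.2, hz.2.2, mul_zero]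
  rw [h2]
  exact H.zpow_mem hH n

theorem exists_comm_ne_one (hp : Odd p) (hx : (e g).x ≠ 0) :
    ∃ w ∈ W e, g * w * g⁻¹ * w⁻¹ ≠ 1 := by
  obtain ⟨b, hb⟩ := GaloisField.exists_pairing_ne hp hx
  refine ⟨ofXB e 0 b, ⟨ofXB_x _ _, ofXB_c _ _⟩, fun h => hb ?_⟩
  rw [comm_eq_one_iff, mul_comm_iff e] at h
  simpa [sub_eq_zero] using h.2

theorem x_eq_zero_of_commute (hp : Odd p) (hg : ∀ w ∈ W e, g * w = w * g) : (e g).x = 0 := by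
  by_contra hx
  obtain ⟨w, hw, h⟩ := exists_comm_ne_one hp hx
  exact h (comm_eq_one_iff.2 (hg w hw))

/-- The centre is contained in every nontrivial normal subgroup. -/
theorem Z_le_of_normal (hp : Odd p) [hN : N.Normal] (hg : g ∈ N) (h1 : g ≠ 1) : Z e ≤ N := by
  have hcomm : ∀ g ∈ N, ∀ h, g * h * g⁻¹ * h⁻¹ ∈ N := fun g hg h => by
    have := N.mul_mem hg (hN.conj_mem _ (N.inv_mem hg) h)
    simpa only [mul_assoc] using this
  -- Elements of the second centre with nonzero `b`-coordinate have nontrivial commutators.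
  have hW : ∀ g ∈ N, g ∈ W e → (e g).b ≠ 0 → Z e ≤ N := by
    intro g hg hgW hb
    obtain ⟨x, hx⟩ := GaloisField.exists_pairing_ne hp hb
    refine Z_le_of_mem (comm_mem_Z hgW (ofXB e x 0)) (fun h => hx ?_) (hcomm g hg _)
    rw [comm_eq_one_iff, mul_comm_iff e] at h
    have h2 := h.2
    simp only [ofXB_x, ofXB_b, ofXB_c, hgW.1, hgW.2] at h2
    simp only [star_zero, mul_zero, sub_zero, add_zero] at h2
    linear_combination h2
  by_cases hx : (e g).x = 0
  · by_cases hc : (e g).c = 0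
    · by_cases hb : (e g).b = 0
      · exact Z_le_of_mem ⟨hx, hb, hc⟩ h1 hg
      · exact hW g hg ⟨hx, hc⟩ hb
    · refine hW _ (hcomm g hg (ofXB e 1 0)) (comm_mem_W _ _) ?_
      rw [map_comm, comm_b]
      simpa [hx] using hc
  · obtain ⟨w, hw, h⟩ := exists_comm_ne_one hp hx
    exact Z_le_of_mem (comm_mem_Z' hw g) h (hcomm g hg w)

/-- Abelian normal subgroups of the Sylow subgroup are contained in `V`. -/
theorem le_V_of_commute (hp : Odd p) [hN : N.Normal] (hc : ∀ g ∈ N, ∀ h ∈ N, g * h = h * g) :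
    N ≤ V e := by
  intro g hg
  by_contra hx
  rw [mem_V] at hx
  obtain ⟨δ, hδ, hδs⟩ := GaloisField.exists_star_eq_neg p
  have hw : g * ofC e δ hδs * g⁻¹ * (ofC e δ hδs)⁻¹ ∈ N := by
    have := N.mul_mem hg (hN.conj_mem _ (N.inv_mem hg) (ofC e δ hδs))
    simpa only [mul_assoc] using this
  have h := ((mul_comm_iff e).1 (hc g hg _ hw)).2
  rw [map_comm, comm_x, comm_b, comm_c, ofC_x, ofC_c] at h
  simp only [star_mul', hδs, star_zero, zero_mul, mul_zero, sub_zero, add_zero] at h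
  have h1 : 2 * (star (e g).x * (e g).x * δ) = 0 := by linear_combination h
  exact mul_ne_zero (GaloisField.two_ne_zero_of_odd hp)
    (mul_ne_zero (mul_ne_zero (star_ne_zero.2 hx) hx) hδ) h1

/-- If the images of `g` and `h` in the quotient by the second centre do not commute, then `g` and
`h` do not both commute with their commutator. -/
theorem exists_not_commute (hp : Odd p) (hgh : (e g).x * (e h).c ≠ (e h).x * (e g).c) :
    ∃ k, (k = g ∨ k = h) ∧ g * h * g⁻¹ * h⁻¹ * k * (g * h * g⁻¹ * h⁻¹)⁻¹ * k⁻¹ ≠ 1 := by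
  by_contra! hk
  have hb : (e (g * h * g⁻¹ * h⁻¹)).b ≠ 0 := by
    rw [map_comm, comm_b]
    exact sub_ne_zero.2 hgh
  have key : ∀ k, (k = g ∨ k = h) → ∃ n : ℤ, (e k).x = n * (e (g * h * g⁻¹ * h⁻¹)).b := by
    intro k hk'
    refine GaloisField.exists_intCast_mul hb ?_
    have h1 := ((mul_comm_iff e).1 (comm_eq_one_iff.1 (hk k hk'))).2
    have h2 : g * h * g⁻¹ * h⁻¹ ∈ W e := comm_mem_W g h
    rw [h2.1, h2.2] at h1
    simp only [star_zero, zero_mul, mul_zero, sub_zero, add_zero] at h1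
    linear_combination -h1
  obtain ⟨n, hn⟩ := key g (Or.inl rfl)
  obtain ⟨m, hm⟩ := key h (Or.inr rfl)
  have h1 : (e (g * h * g⁻¹ * h⁻¹)).b = (e g).x * (e h).c - (e h).x * (e g).c := by
    rw [map_comm, comm_b]
  rw [hn, hm] at h1
  have h2 : n * (e h).c - m * (e g).c = 1 := mul_left_cancel₀ hb (by linear_combination -h1)
  have h3 := congrArg star h2
  rw [star_sub, star_mul', star_mul', (e h).star_c, (e g).star_c, GaloisField.star_intCast,
    GaloisField.star_intCast, star_one] at h3
  exact GaloisField.two_ne_zero_of_odd hp (by linear_combination -h2 - h3)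

end UnitaryUnipotent

/-! ### The possible essential subgroups -/

namespace FusionSystem

open UnitaryUnipotent

variable {S : Type u} [Group S] {F : FusionSystem S} {P E : Subgroup S} {f : S → S} {p : ℕ}

theorem Mor.map_comm (h : F.Mor P f) {x y : S} (hx : x ∈ P) (hy : y ∈ P) :
    f (x * y * x⁻¹ * y⁻¹) = f x * f y * (f x)⁻¹ * (f y)⁻¹ := by
  rw [h.map_mul (P.mul_mem (P.mul_mem hx hy) (P.inv_mem hx)) (P.inv_mem hy), h.map_conj hx hy,
    h.map_inv hy]

theorem Mor.exists_preimage (h : F.Mor P f) (H : Subgroup S) :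
    ∃ H' : Subgroup S, ∀ x, x ∈ H' ↔ x ∈ P ∧ f x ∈ H :=
  ⟨{ carrier := {x | x ∈ P ∧ f x ∈ H}
     mul_mem' := fun {x y} hx hy => ⟨P.mul_mem hx.1 hy.1, by
      rw [h.map_mul hx.1 hy.1]
      exact H.mul_mem hx.2 hy.2⟩
     one_mem' := ⟨P.one_mem, by
      rw [h.map_one]
      exact H.one_mem⟩
     inv_mem' := fun {x} hx => ⟨P.inv_mem hx.1, by
      rw [h.map_inv hx.1]
      exact H.inv_mem hx.2⟩ }, fun _ => Iff.rfl⟩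

theorem IsoOn.map_mem_centralizer {R : Subgroup S} (h : F.IsoOn R R f) (hP : R ≤ P)
    (hm : F.Mor P f) {x : S} (hxP : x ∈ P) (hx : x ∈ Subgroup.centralizer (R : Set S)) :
    f x ∈ Subgroup.centralizer (R : Set S) := by
  rw [Subgroup.mem_centralizer_iff] at hx ⊢
  intro y hy
  obtain ⟨z, hz, rfl⟩ := h.exists_eq hy
  rw [← hm.map_mul (hP hz) hxP, hx z hz, hm.map_mul hxP (hP hz)]

variable [Fact p.Prime] {e : S ≃* UnitaryUnipotent (GaloisField p 2)}

/-- The centre is mapped to itself as soon as one of its nontrivial elements is mapped into it. -/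
theorem Mor.map_mem_Z (h : F.Mor P f) {z : S} (hz : z ∈ Z e) (h1 : z ≠ 1) (hP : z ∈ P)
    (hf : f z ∈ Z e) : ∀ x ∈ Z e, f x ∈ Z e := by
  obtain ⟨H, hH⟩ := h.exists_preimage (Z e)
  exact fun x hx => ((hH x).1 (Z_le_of_mem hz h1 ((hH z).2 ⟨hP, hf⟩) hx)).2

variable [Finite S]

theorem IsEssential.W_le (hp : Odd p) (hS : IsPGroup p S) (hO : F.Op ≠ ⊥)
    (hE : F.IsEssential p E) : W e ≤ E := by
  have hN := F.isGreatest_Op.1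
  have hNn : F.Op.Normal := hN.1
  obtain ⟨n, hn⟩ := Subgroup.ne_bot_iff_exists_ne_one.1 hO
  have hNE := hE.le_of_isNormal hS hN
  have hZN : Z e ≤ F.Op := Z_le_of_normal hp n.2 fun h => hn (Subtype.ext h)
  have hMV : Subgroup.centralizer (F.Op : Set S) ⊓ F.Op ≤ V e :=
    le_V_of_commute hp fun g hg h hh => (Subgroup.mem_centralizer_iff.1 hg.1 h hh.2).symm
  intro s hs
  -- `s` centralizes the chain `E ≥ Z(O_p(F)) ≥ 1`.
  refine hE.mem_of_chain hS (X₁ := Subgroup.centralizer (F.Op : Set S) ⊓ F.Op) (X₂ := ⊥) bot_le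
    (inf_le_right.trans hNE) (fun f hf x hx => ?_) (fun f hf x hx => ?_) (fun x _ => ?_)
    (fun x hx => ?_) fun x hx => ?_
  · have hfN := hN.isoOn hf.1 hNE
    exact ⟨hfN.map_mem_centralizer hNE hf.1 (hNE hx.2) hx.1, hfN.mem hx.2⟩
  · rw [Subgroup.mem_bot.1 hx, hf.1.map_one]
    exact one_mem _
  · have h := comm_mem_Z hs x
    exact ⟨Subgroup.mem_centralizer_iff.2 fun y _ => (mul_comm_of_mem_Z h y).symm, hZN h⟩
  · exact Subgroup.mem_bot.2 (comm_eq_one_iff.2 (mul_comm_of_mem_V (W_le_V hs) (hMV hx)))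
  · rw [Subgroup.mem_bot.1 hx]
    group

/-- In an essential subgroup, any two elements commute modulo the centre of `S`. -/
theorem IsEssential.comm_mem_Z (hp : Odd p) (hS : IsPGroup p S) (hF : F.IsSaturated p)
    (hE : F.IsEssential p E) (hW : W e ≤ E) {g h : S} (hg : g ∈ E) (hh : h ∈ E) :
    g * h * g⁻¹ * h⁻¹ ∈ Z e := by
  rw [comm_mem_Z_iff]
  by_contra hgh
  obtain ⟨k, hk, hζ⟩ := exists_not_commute hp hgh
  have hkE : k ∈ E := by
    rcases hk with rfl | rfl
    exacts [hg, hh]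
  -- The centre is the third term of the lower central series of `E`.
  have iZ : ∀ f, F.IsoOn E E f → ∀ x ∈ Z e, f x ∈ Z e := by
    intro f hf
    have h1 : g * h * g⁻¹ * h⁻¹ ∈ W e := comm_mem_W g h
    refine hf.1.map_mem_Z (UnitaryUnipotent.comm_mem_Z h1 k) hζ
      (hW (Z_le_W (UnitaryUnipotent.comm_mem_Z h1 k))) ?_
    rw [hf.1.map_comm (hW h1) hkE, hf.1.map_comm hg hh]
    exact UnitaryUnipotent.comm_mem_Z (comm_mem_W _ _) _
  -- The second centre of `S` is the second centre of `E`.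
  have iW : ∀ f, F.IsoOn E E f → ∀ x ∈ W e, f x ∈ W e := by
    intro f hf x hx
    have h1 : ∀ y ∈ E, f x * y * (f x)⁻¹ * y⁻¹ ∈ Z e := by
      intro y hy
      obtain ⟨z, hz, rfl⟩ := hf.exists_eq hy
      rw [← hf.1.map_comm (hW hx) hz]
      exact iZ f hf _ (UnitaryUnipotent.comm_mem_Z hx z)
    have h2 := comm_mem_Z_iff.1 (h1 g hg)
    have h3 := comm_mem_Z_iff.1 (h1 h hh)
    have h4 := sub_ne_zero.2 hgh
    constructor
    · exact (mul_eq_zero_iff_right h4).1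
        (by linear_combination (e g).x * h3 - (e h).x * h2)
    · exact (mul_eq_zero_iff_right h4).1
        (by linear_combination (e g).c * h3 - (e h).c * h2)
  refine hE.ne_top hS hF (eq_top_iff.2 fun s _ => ?_)
  exact hE.mem_of_chain hS Z_le_W hW iW iZ (fun x _ => comm_mem_W s x)
    (fun x hx => comm_mem_Z' hx s) fun x hx => by
      rw [← mul_comm_of_mem_Z hx s, mul_inv_cancel_right]

/-- The centre of `S` is invariant in every essential subgroup that is not contained in `V`. -/
theorem IsEssential.map_mem_Z (hp : Odd p) (hS : IsPGroup p S) (hF : F.IsSaturated p)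
    (hE : F.IsEssential p E) (hW : W e ≤ E) (hV : ¬E ≤ V e) :
    ∀ f, F.IsoOn E E f → ∀ x ∈ Z e, f x ∈ Z e := by
  intro f hf
  obtain ⟨g, hg, hx⟩ := SetLike.not_le_iff_exists.1 hV
  obtain ⟨w, hw, h1⟩ := exists_comm_ne_one hp hx
  have h2 : g * w * g⁻¹ * w⁻¹ ∈ Z e := comm_mem_Z' hw g
  refine hf.1.map_mem_Z h2 h1 (hW (Z_le_W h2)) ?_
  rw [hf.1.map_comm hg (hW hw)]
  exact hE.comm_mem_Z hp hS hF hW (hf.mem hg) (hf.mem (hW hw))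

/-- If `F` has a nontrivial normal subgroup, then the only possible essential subgroups are `V`
and `Q`. -/
theorem IsEssential.eq_V_or_eq_Q (hp : Odd p) (hS : IsPGroup p S) (hF : F.IsSaturated p)
    (hO : F.Op ≠ ⊥) (hE : F.IsEssential p E) : E = V e ∨ E = Q e := by
  have hW : W e ≤ E := hE.W_le hp hS hO
  have hZE : Z e ≤ E := Z_le_W.trans hW
  have hcZ : ∀ s, ∀ x ∈ Z e, s * x * s⁻¹ = x := fun s x hx => by
    rw [← mul_comm_of_mem_Z hx s, mul_inv_cancel_right]
  by_cases hV : E ≤ V e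
  · refine Or.inl (le_antisymm hV fun v hv => hE.1.centralizer_le ?_)
    exact Subgroup.mem_centralizer_iff.2 fun y hy => mul_comm_of_mem_V (hV hy) hv
  have iZ := hE.map_mem_Z hp hS hF hW hV
  have hcomm : ∀ g ∈ E, ∀ h ∈ E, (e g).x * (e h).c = (e h).x * (e g).c := fun g hg h hh =>
    comm_mem_Z_iff.1 (hE.comm_mem_Z hp hS hF hW hg hh)
  right
  by_cases hQ : E ≤ Q e
  · refine le_antisymm hQ fun s hs => ?_
    refine hE.mem_of_chain hS le_rfl hZE iZ iZ (fun x hx => ?_) (fun x hx => ?_)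
      fun x hx => hcZ s x hx
    · rw [comm_mem_Z_iff, mem_Q.1 hs, mem_Q.1 (hQ hx), mul_zero, mul_zero]
    · exact comm_mem_Z' (Z_le_W hx) s
  exfalso
  obtain ⟨g, hg, hgx⟩ := SetLike.not_le_iff_exists.1 hV
  obtain ⟨h, hh, hc⟩ := SetLike.not_le_iff_exists.1 hQ
  rw [mem_V] at hgx
  rw [mem_Q] at hc
  have hx : (e h).x ≠ 0 := fun h0 => by
    have := hcomm g hg h hh
    rw [h0, zero_mul] at this
    exact mul_ne_zero hgx hc this
  -- Modulo the second centre, `E` has order `p` and is generated by `h`.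
  have hprop : ∀ k ∈ E, ∃ n : ℤ, (e k).x = n * (e h).x ∧ (e k).c = n * (e h).c := by
    intro k hk
    obtain ⟨n, hn⟩ := GaloisField.exists_intCast_mul_of_skew hc (e k).star_c (e h).star_c
    refine ⟨n, mul_right_cancel₀ hc ?_, hn⟩
    rw [hcomm k hk h hh, hn]
    ring
  have hzW : ∀ z ∈ Subgroup.centralizer (E : Set S) ⊓ E, z ∈ W e := by
    rintro z ⟨hz, hzE⟩
    have h1 : (e z).x = 0 := x_eq_zero_of_commute hp fun w hw =>
      (Subgroup.mem_centralizer_iff.1 hz w (hW hw)).symm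
    have h2 := hcomm z hzE h hh
    rw [h1, zero_mul] at h2
    exact ⟨h1, (mul_eq_zero_iff_left hx).1 h2.symm⟩
  -- An element outside `E` that stabilizes the chain `E ≥ Z(E) ≥ Z(S)`: the `b`-coordinates of its
  -- commutators with `E` are multiples of `c ^ 2 * x`, where `c ^ 2` is fixed by `star`, so these
  -- commutators commute with `E`.
  have hs : ofXB e ((e h).c * (e h).x) 0 ∈ E := by
    refine hE.mem_of_chain hS (X₁ := Subgroup.centralizer (E : Set S) ⊓ E) (X₂ := Z e)
      (fun z hz =>
        ⟨Subgroup.mem_centralizer_iff.2 fun y _ => (mul_comm_of_mem_Z hz y).symm, hZE hz⟩)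
      inf_le_right (fun f hf x hx => ⟨hf.map_mem_centralizer le_rfl hf.1 hx.2 hx.1, hf.mem hx.2⟩) iZ
      (fun k hk => ⟨?_, hW (comm_mem_W _ _)⟩) (fun z hz => comm_mem_Z' (hzW z hz) _)
      fun x hx => hcZ _ x hx
    refine Subgroup.mem_centralizer_iff.2 ?_
    intro y hy
    obtain ⟨n, hn, hn'⟩ := hprop k hk
    obtain ⟨m, hm, hm'⟩ := hprop y hy
    rw [mul_comm_iff e, UnitaryUnipotent.map_comm, comm_x, comm_c, comm_b, ofXB_x, ofXB_c, hn', hm]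
    simp only [star_mul', star_sub, star_zero, (e h).star_c, GaloisField.star_intCast]
    constructor <;> ring
  have h1 := hcomm _ hs h hh
  rw [ofXB_x, ofXB_c, mul_zero] at h1
  exact mul_ne_zero (mul_ne_zero hc hx) hc h1

end FusionSystem

/-! ### Essential subgroups with a prescribed invariant subgroup -/

theorem IsStronglyEmbedded.false_of_commute {G : Type u} [Group G] [Finite G] {p : ℕ}
    [Fact p.Prime] {H : Subgroup G} (hH : IsStronglyEmbedded p H) {A B : Subgroup G}
    [hA : A.Normal] [hB : B.Normal] (h : ∀ a ∈ A, ∀ b ∈ B, a * b = b * a) (hpA : p ∣ Nat.card A)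
    (hpB : p ∣ Nat.card B) : False := by
  obtain ⟨T, hT⟩ := hH.exists_sylow_le
  obtain ⟨b, hb⟩ := exists_prime_orderOf_dvd_card' p hpB
  have hb' : orderOf (b : G) = p := by rw [Subgroup.orderOf_coe, hb]
  have hP : IsPGroup p (Subgroup.zpowers (b : G)) :=
    IsPGroup.of_card (n := 1) (by rw [Nat.card_zpowers, hb', pow_one])
  obtain ⟨T', hT'⟩ := hP.exists_le_sylow
  obtain ⟨g, rfl⟩ := MulAction.exists_smul_eq G T' T
  -- A conjugate of `b` lies in `H`; it is centralized by `A`.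
  have hgb : g * b * g⁻¹ ∈ H := hT (by
    rw [Sylow.coe_subgroup_smul]
    exact Subgroup.smul_mem_pointwise_smul _ (MulAut.conj g) _
      (hT' (Subgroup.mem_zpowers (b : G))))
  refine hH.not_le_of_normal hpA fun a ha => hH.mem_of_commute hgb ?_
    (h a ha _ (hB.conj_mem _ b.2 g))
  have h1 := orderOf_injective (MulAut.conj g).toMonoidHom (MulAut.conj g).injective (b : G)
  rw [MulEquiv.toMonoidHom_eq_coe, MonoidHom.coe_coe, MulAut.conj_apply, hb'] at h1
  exact dvd_of_eq h1.symm

namespace FusionSystem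

variable {S : Type u} [Group S] {F : FusionSystem S} {E X : Subgroup S} {p : ℕ}

/-- If `X` is an invariant subgroup of the essential subgroup `E`, then `S / E` cannot act
nontrivially both on `E` with commutators in `X` and on `E` fixing `X`: the automorphisms of the two
kinds form normal subgroups of `Aut_F(E)` that commute modulo inner automorphisms. -/
theorem IsEssential.mem_or_mem [Finite S] [Fact p.Prime] (hS : IsPGroup p S)
    (hE : F.IsEssential p E) [hEn : E.Normal] (hX : X ≤ E)
    (hi : ∀ f, F.IsoOn E E f → ∀ x ∈ X, f x ∈ X) {s t : S}
    (hs : ∀ x ∈ E, s * x * s⁻¹ * x⁻¹ ∈ X) (ht : ∀ x ∈ X, t * x * t⁻¹ = x) : s ∈ E ∨ t ∈ E := by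
  have hi' : ∀ a : F.aut E, ∀ x ∈ X, ap a x ∈ X := fun a => hi _ (isoOn_ap a)
  have hinv : ∀ (a : F.aut E), ∀ x ∈ E, ap a (ap a⁻¹ x) = x := fun a x hx => by
    rw [← ap_mul a a⁻¹ hx, mul_inv_cancel, ap_one]
  have hinv' : ∀ (a : F.aut E), ∀ x ∈ E, ap a⁻¹ (ap a x) = x := fun a x hx => by
    rw [← ap_mul a⁻¹ a hx, inv_mul_cancel, ap_one]
  let A : Subgroup (F.aut E) :=
    { carrier := {a | ∀ x ∈ E, ap a x * x⁻¹ ∈ X}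
      mul_mem' := fun {a b} ha hb x hx => by
        have h1 := X.mul_mem (hi' a _ (hb x hx)) (ha x hx)
        rwa [(isoOn_ap a).1.map_mul (ap_mem b hx) (E.inv_mem hx), (isoOn_ap a).1.map_inv hx,
          ← mul_assoc, inv_mul_cancel_right, ← ap_mul a b hx] at h1
      one_mem' := fun x _ => by
        rw [ap_one, mul_inv_cancel]
        exact X.one_mem
      inv_mem' := fun {a} ha x hx => by
        have h1 := X.inv_mem (ha _ (ap_mem a⁻¹ hx))
        rwa [hinv a x hx, mul_inv_rev, inv_inv] at h1 }
  let B : Subgroup (F.aut E) :=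
    { carrier := {a | ∀ x ∈ X, ap a x = x}
      mul_mem' := fun {a b} ha hb x hx => by rw [ap_mul a b (hX hx), hb x hx, ha x hx]
      one_mem' := fun x _ => ap_one x
      inv_mem' := fun {a} ha x hx => by
        nth_rw 1 [← ha x hx]
        exact hinv' a x (hX hx) }
  have hA : A.Normal := ⟨fun a ha g x hx => by
    have h1 := hi' g _ (ha _ (ap_mem g⁻¹ hx))
    rwa [(isoOn_ap g).1.map_mul (ap_mem a (ap_mem g⁻¹ hx)) (E.inv_mem (ap_mem g⁻¹ hx)),
      (isoOn_ap g).1.map_inv (ap_mem g⁻¹ hx), hinv g x hx, ← ap_mul g a (ap_mem g⁻¹ hx),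
      ← ap_mul _ g⁻¹ hx] at h1⟩
  have hB : B.Normal := ⟨fun a ha g x hx => by
    rw [ap_mul _ g⁻¹ (hX hx), ap_mul g a (ap_mem g⁻¹ (hX hx)), ha _ (hi' g⁻¹ x hx),
      hinv g x (hX hx)]⟩
  have hAB : A ⊓ B ≤ (inn E).subgroupOf (F.aut E) := by
    refine hE.le_inn ?_
    have hE' : IsPGroup p E := hS.to_subgroup E
    refine ((isPGroup_chainStabilizer hE' (le_refl (X.subgroupOf E))).comap_of_injective
      (F.aut E).subtype (Subgroup.subtype_injective _)).to_le fun a ha => ?_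
    refine ⟨fun x => ?_, fun x hx => ?_, fun x hx => ?_⟩
    · have := ha.1 x x.2
      rwa [ap, total_apply] at this
    · have := ha.1 x x.2
      rwa [ap, total_apply] at this
    · have := ha.2 x hx
      rw [ap, total_apply] at this
      exact Subtype.ext this
  by_contra! hst
  obtain ⟨-, -, H, hH⟩ := id hE
  let π := QuotientGroup.mk' ((inn E).subgroupOf (F.aut E))
  have hπ : Function.Surjective π := QuotientGroup.mk'_surjective _
  have : (A.map π).Normal := hA.map _ hπ
  have : (B.map π).Normal := hB.map _ hπ
  have hdvd : ∀ s ∉ E, ∀ C : Subgroup (F.aut E), F.conjAut E s ∈ C → p ∣ Nat.card (C.map π) := by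
    intro s hs C hC
    have h1 : IsPGroup p (π.comp (F.conjAut E)).range :=
      hS.of_surjective _ (π.comp (F.conjAut E)).rangeRestrict_surjective
    have h2 : p ∣ orderOf (π (F.conjAut E s)) := h1.dvd_orderOf_of_mem ⟨s, rfl⟩ fun h => by
      have h3 : F.conjAut E s ∈ (inn E).subgroupOf (F.aut E) := (QuotientGroup.eq_one_iff _).1 h
      exact hs (hE.mem_of_mem_inn h3 fun x => F.conjAut_apply s x)
    exact h2.trans (Subgroup.orderOf_dvd_natCard _ (Subgroup.mem_map_of_mem π hC))
  refine hH.false_of_commute (A := A.map π) (B := B.map π) ?_ (hdvd s hst.1 A fun x hx => ?_)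
    (hdvd t hst.2 B fun x hx => ?_)
  · rintro _ ⟨a, ha, rfl⟩ _ ⟨b, hb, rfl⟩
    rw [← map_mul, ← map_mul]
    refine (QuotientGroup.eq (s := (inn E).subgroupOf (F.aut E))).2 (hAB ⟨?_, ?_⟩)
    · have := A.mul_mem (hA.conj_mem _ (A.inv_mem ha) b⁻¹) ha
      simpa [mul_assoc] using this
    · have := B.mul_mem (B.inv_mem hb) (hB.conj_mem _ hb a⁻¹)
      simpa [mul_assoc] using this
  · rw [ap_conjAut s hx]
    exact hs x hx
  · rw [ap_conjAut t (hX hx)]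
    exact ht x hx

end FusionSystem

/-! ### At most one essential subgroup -/

theorem chainStabilizer_conj_mem {G : Type*} [Group G] {X₁ X₂ : Subgroup G} {h : X₂ ≤ X₁}
    {α β : MulAut G} (h₁ : ∀ x ∈ X₁, β x ∈ X₁) (h₁' : ∀ x ∈ X₁, β⁻¹ x ∈ X₁)
    (h₂ : ∀ x ∈ X₂, β x ∈ X₂) (h₂' : ∀ x ∈ X₂, β⁻¹ x ∈ X₂) (hα : α ∈ chainStabilizer X₁ X₂ h) :
    β * α * β⁻¹ ∈ chainStabilizer X₁ X₂ h := by
  have key : ∀ x, (β * α * β⁻¹) x * x⁻¹ = β (α (β⁻¹ x) * (β⁻¹ x)⁻¹) := fun x => by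
    rw [map_mul, map_inv, MulAut.apply_inv_self, MulAut.mul_apply, MulAut.mul_apply]
  refine ⟨fun x => ?_, fun x hx => ?_, fun x hx => ?_⟩
  · rw [key]
    exact h₁ _ (hα.1 _)
  · rw [key]
    exact h₂ _ (hα.2.1 _ (h₁' x hx))
  · rw [MulAut.mul_apply, MulAut.mul_apply, hα.2.2 _ (h₂' x hx), MulAut.apply_inv_self]

namespace FusionSystem

open UnitaryUnipotent

variable {S : Type u} [Group S] {F : FusionSystem S} {P E : Subgroup S} {f : S → S} {p : ℕ}

theorem Mor.map_zpow (h : F.Mor P f) {x : S} (hx : x ∈ P) (n : ℤ) : f (x ^ n) = f x ^ n := by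
  obtain ⟨φ, -, hφ⟩ := h
  have h1 := hφ (⟨x, hx⟩ ^ n)
  rw [_root_.map_zpow, Subgroup.coe_zpow, hφ ⟨x, hx⟩] at h1
  exact h1.symm

variable [Fact p.Prime] {e : S ≃* UnitaryUnipotent (GaloisField p 2)}

/-- The `c`-coordinate takes values in a one-dimensional space over the prime field. -/
theorem Mor.exists_c_eq_zero (hf : F.Mor P f) {g h : S} (hg : g ∈ P) (hh : h ∈ P) :
    (e (f g)).c = 0 ∨ ∃ n : ℤ, (e (f (h * g ^ n))).c = 0 := by
  by_cases h0 : (e (f g)).c = 0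
  · exact Or.inl h0
  obtain ⟨n, hn⟩ := GaloisField.exists_intCast_mul_of_skew h0 (e (f h)).star_c (e (f g)).star_c
  refine Or.inr ⟨-n, ?_⟩
  rw [hf.map_mul hh (P.zpow_mem hg _), hf.map_zpow hg, _root_.map_mul, _root_.map_zpow, mul_c,
    zpow_c, hn]
  push_cast
  ring

/-- The centre of `S` is the third term of the lower central series, so it is invariant. -/
theorem Mor.map_mem_Z_of_top (hp : Odd p) (hf : F.Mor ⊤ f) : ∀ x ∈ Z e, f x ∈ Z e := by
  obtain ⟨δ, hδ, hδs⟩ := GaloisField.exists_star_eq_neg p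
  have hm : ∀ x, x ∈ (⊤ : Subgroup S) := Subgroup.mem_top
  obtain ⟨k, -, hζ⟩ := exists_not_commute hp (e := e) (g := ofXB e 1 0) (h := ofC e δ hδs)
    (by simpa)
  have h1 := comm_mem_W (e := e) (ofXB e 1 0) (ofC e δ hδs)
  refine hf.map_mem_Z (UnitaryUnipotent.comm_mem_Z h1 k) hζ (hm _) ?_
  rw [hf.map_comm (hm _) (hm _), hf.map_comm (hm _) (hm _)]
  exact UnitaryUnipotent.comm_mem_Z (comm_mem_W _ _) _

variable [Finite S]

theorem Mor.map_mem_V (hp : Odd p) (hf : F.Mor ⊤ f) : ∀ x ∈ V e, f x ∈ V e := by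
  have hV : (V e).Normal := normal_of_W_le W_le_V
  have hf' : F.IsoOn ⊤ ⊤ f := isoOn_self hf fun _ _ => Subgroup.mem_top _
  have hn : (hf.mono (le_top : V e ≤ ⊤)).im.Normal := by
    constructor
    rintro _ ⟨x, hx, rfl⟩ s
    obtain ⟨t, -, rfl⟩ := hf'.exists_eq (Subgroup.mem_top s)
    exact ⟨t * x * t⁻¹, hV.conj_mem x hx t, hf.map_conj (Subgroup.mem_top t) (Subgroup.mem_top x)⟩
  have hle : (hf.mono (le_top : V e ≤ ⊤)).im ≤ V e := by
    refine le_V_of_commute hp ?_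
    rintro _ ⟨x, hx, rfl⟩ _ ⟨y, hy, rfl⟩
    rw [← hf.map_mul (Subgroup.mem_top x) (Subgroup.mem_top y), mul_comm_of_mem_V hx hy,
      hf.map_mul (Subgroup.mem_top y) (Subgroup.mem_top x)]
  exact fun x hx => hle ⟨x, hx, rfl⟩

theorem Mor.map_mem_W (hp : Odd p) (hf : F.Mor ⊤ f) : ∀ x ∈ W e, f x ∈ W e := by
  obtain ⟨δ, hδ, hδs⟩ := GaloisField.exists_star_eq_neg p
  have hm : ∀ x, x ∈ (⊤ : Subgroup S) := Subgroup.mem_top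
  intro x hx
  have h2 : ∀ y, (e (f x)).x * (e y).c = (e y).x * (e (f x)).c := by
    intro y
    obtain ⟨z, -, rfl⟩ := (isoOn_self hf fun _ _ => hm _).exists_eq (hm y)
    rw [← comm_mem_Z_iff, ← hf.map_comm (hm x) (hm z)]
    exact hf.map_mem_Z_of_top hp _ (UnitaryUnipotent.comm_mem_Z hx z)
  constructor
  · simpa [hδ] using h2 (ofC e δ hδs)
  · simpa using (h2 (ofXB e 1 0)).symm

theorem Mor.map_mem_Q (hp : Odd p) (hf : F.Mor ⊤ f) : ∀ x ∈ Q e, f x ∈ Q e := by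
  obtain ⟨δ, hδ, hδs⟩ := GaloisField.exists_star_eq_neg p
  have hm : ∀ x, x ∈ (⊤ : Subgroup S) := Subgroup.mem_top
  intro y hy
  by_contra hc
  rw [mem_Q] at hc
  -- By linearity, some element of `Q` outside `W` is mapped into `Q`.
  obtain ⟨q, hq, hqx, hqc⟩ : ∃ q ∈ Q e, (e q).x ≠ 0 ∧ (e (f q)).c = 0 := by
    rcases hf.exists_c_eq_zero (e := e) (hm (ofXB e 1 0)) (hm (ofXB e δ 0)) with h | ⟨n, h⟩
    · exact ⟨_, by simp [mem_Q], by simp, h⟩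
    · refine ⟨_, ?_, ?_, h⟩
      · simp [mem_Q, zpow_c]
      · rw [_root_.map_mul, _root_.map_zpow, mul_x, zpow_x, ofXB_x, ofXB_x, mul_one]
        exact GaloisField.add_intCast_ne_zero hp hδ hδs n
  -- Its image commutes with `f y` modulo the centre, hence lies in `W`.
  have h1 : (e (f y)).x * (e (f q)).c = (e (f q)).x * (e (f y)).c := by
    rw [← comm_mem_Z_iff, ← hf.map_comm (hm y) (hm q)]
    refine hf.map_mem_Z_of_top hp _ (comm_mem_Z_iff.2 ?_)
    rw [mem_Q.1 hy, mem_Q.1 hq, mul_zero, mul_zero]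
  rw [hqc, mul_zero] at h1
  have hfW := isoOn_self (hf.mono (le_top : W e ≤ ⊤)) (hf.map_mem_W hp)
  obtain ⟨w, hw, hwq⟩ := hfW.exists_eq (y := f q) ⟨(mul_eq_zero_iff_right hc).1 h1.symm, hqc⟩
  rw [hf.injOn (hm w) (hm q) hwq] at hw
  exact hqx hw.1

/-- If the centre of `S` is invariant in `V`, then `V` is not essential: `Aut_S(V)` is a
Sylow subgroup of `Aut_F(V)` and the stabilizer of the chain `V ≥ W ≥ Z ≥ 1`.  If `W` is invariant
too, then `S ≤ V`; if not, then some `p`-element normalizes this Sylow subgroup but is not in it. -/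
theorem not_isEssential_V_of_invariant (hp : Odd p) (hS : IsPGroup p S) (hF : F.IsSaturated p)
    (hZ : ∀ f, F.IsoOn (V e) (V e) f → ∀ x ∈ Z e, f x ∈ Z e) : ¬ F.IsEssential p (V e) := by
  intro hE
  obtain ⟨δ, hδ, hδs⟩ := GaloisField.exists_star_eq_neg p
  have hV : (V e).Normal := normal_of_W_le W_le_V
  have hZV : Z e ≤ V e := Z_le_W.trans W_le_V
  have hcZ : ∀ s, ∀ x ∈ Z e, s * x * s⁻¹ = x := fun s x hx => by
    rw [← mul_comm_of_mem_Z hx s, mul_inv_cancel_right]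
  -- `W` is not invariant.
  obtain ⟨f, hf, w₀, hw₀, hfw₀⟩ : ∃ f, F.IsoOn (V e) (V e) f ∧ ∃ w ∈ W e, f w ∉ W e := by
    by_contra! hW
    refine hE.ne_top hS hF (eq_top_iff.2 fun s _ => ?_)
    exact hE.mem_of_chain hS Z_le_W W_le_V hW hZ (fun x _ => comm_mem_W s x)
      (fun x hx => comm_mem_Z' hx s) fun x hx => hcZ s x hx
  have hc₀ : (e (f w₀)).c ≠ 0 := fun h => hfw₀ ⟨hf.mem (W_le_V hw₀), h⟩
  have hap : ∀ x ∈ V e, ap (⟨hf.equiv, hf.mem_aut⟩ : F.aut (V e)) x = f x := fun x hx =>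
    total_of_mem _ hx
  generalize (⟨hf.equiv, hf.mem_aut⟩ : F.aut (V e)) = a at hap
  have hl : ∀ x ∈ V e, ap a⁻¹ (f x) = x := fun x hx => by
    rw [← hap x hx, ← ap_mul _ _ hx, inv_mul_cancel, ap_one]
  have hr : ∀ x ∈ V e, f (ap a⁻¹ x) = x := fun x hx => by
    rw [← hap _ (ap_mem _ hx), ← ap_mul _ _ hx, mul_inv_cancel, ap_one]
  have hfZ : ∀ x ∈ V e, f x ∈ Z e → x ∈ Z e := fun x hx h => by
    rw [← hl x hx]
    exact hZ _ (isoOn_ap _) _ h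
  -- By linearity, an element of `W` outside the centre is mapped into `W`.
  obtain ⟨w, hw, hwb, hwc⟩ : ∃ w ∈ W e, (e w).b ≠ 0 ∧ (e (f w)).c = 0 := by
    rcases hf.1.exists_c_eq_zero (e := e) (g := ofXB e 0 1) (h := ofXB e 0 δ) (by simp [mem_V])
      (by simp [mem_V]) with h | ⟨n, h⟩
    · exact ⟨_, by simp [mem_W], by simp, h⟩
    · refine ⟨_, ?_, ?_, h⟩
      · simp [mem_W, zpow_c, zpow_x]
      · rw [_root_.map_mul, _root_.map_zpow, mul_b, zpow_b _ (ofXB_x _ _), ofXB_b, ofXB_b, mul_one,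
          ofXB_x, zero_mul, add_zero]
        exact GaloisField.add_intCast_ne_zero hp hδ hδs n
  have hfwV : f w ∈ V e := hf.mem (W_le_V hw)
  have hb₁ : (e (f w)).b ≠ 0 := fun h => hwb (hfZ w (W_le_V hw) ⟨hfwV, h, hwc⟩).2.1
  -- As the product of two skew elements lies in the prime field, the commutators of `s` with `V` lie
  -- in the subgroup generated by `f w` and the centre, so the conjugate `β` of the action of `s`
  -- preserves `W`.
  obtain ⟨s, hsx, hsc⟩ : ∃ s : S, (e s).x = δ * (e (f w)).b ∧ (e s).c = 0 :=
    ⟨ofXB e (δ * (e (f w)).b) 0, ofXB_x _ _, ofXB_c _ _⟩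
  have hsb : ∀ v, (e (s * v * s⁻¹ * v⁻¹)).b = δ * (e (f w)).b * (e v).c := fun v => by
    rw [UnitaryUnipotent.map_comm, comm_b, hsx, hsc, mul_zero, sub_zero]
  obtain ⟨β, hβ⟩ : ∃ β, β = a⁻¹ * F.conjAut (V e) s * a⁻¹⁻¹ := ⟨_, rfl⟩
  have hβv : ∀ v ∈ V e, ap β v * v⁻¹ = ap a⁻¹ (s * f v * s⁻¹ * (f v)⁻¹) := fun v hv => by
    have h1 : s * f v * s⁻¹ ∈ V e := hV.conj_mem _ (hf.mem hv) s
    rw [(isoOn_ap a⁻¹).1.map_mul h1 ((V e).inv_mem (hf.mem hv)),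
      (isoOn_ap a⁻¹).1.map_inv (hf.mem hv), hl v hv, hβ, inv_inv, ap_mul _ _ hv, hap v hv,
      ap_mul _ _ (hf.mem hv), ap_conjAut s (hf.mem hv)]
  have hβW : ∀ v ∈ W e, ap β v ∈ W e := by
    intro v hv
    obtain ⟨n, hn⟩ := GaloisField.exists_intCast_of_star_eq (r := δ * (e (f v)).c) (by
      rw [star_mul', hδs, (e (f v)).star_c, neg_mul_neg])
    have h1 := comm_mem_W (e := e) s (f v)
    have h2 : (f w ^ n)⁻¹ * (s * f v * s⁻¹ * (f v)⁻¹) ∈ Z e := by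
      have h3 := (W e).mul_mem ((W e).inv_mem ((W e).zpow_mem (x := f w) ⟨hfwV, hwc⟩ n)) h1
      refine ⟨h3.1, ?_, h3.2⟩
      rw [_root_.map_mul, ← zpow_neg, _root_.map_zpow, mul_b, zpow_b _ hfwV, hsb, h1.2, mul_zero,
        add_zero, mul_right_comm, ← hn]
      push_cast
      ring
    have h4 := (W e).mul_mem ((W e).zpow_mem hw n) (Z_le_W (hZ _ (isoOn_ap a⁻¹) _ h2))
    have h5 : w ^ n = ap a⁻¹ (f w ^ n) := by
      rw [(isoOn_ap a⁻¹).1.map_zpow hfwV, hl w (W_le_V hw)]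
    rw [h5, ← (isoOn_ap a⁻¹).1.map_mul ((V e).zpow_mem hfwV n) (hZV h2), mul_inv_cancel_left,
      ← hβv v (W_le_V hv)] at h4
    have h6 := (W e).mul_mem h4 hv
    rwa [inv_mul_cancel_right] at h6
  have hβW' : ∀ v ∈ W e, ap β⁻¹ v ∈ W e := by
    intro v hv
    obtain ⟨u, hu, rfl⟩ := (isoOn_self ((isoOn_ap β).1.mono W_le_V) hβW).exists_eq hv
    rwa [← ap_mul _ _ (W_le_V hu), inv_mul_cancel, ap_one]
  -- The Sylow subgroup `Aut_S(V)` of `Aut_F(V)` is the stabilizer of the chain; being a `p`-element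
  -- that normalizes it, `β` belongs to it.
  obtain ⟨⟨T, hT⟩, -⟩ := hF.isFullyAutomized_of_invariant hS fun _ hf =>
    Mor.map_mem_V (e := e) hp hf
  have hle : (Z e).subgroupOf (V e) ≤ (W e).subgroupOf (V e) := fun x hx => Z_le_W hx
  let Γ := (chainStabilizer _ _ hle).subgroupOf (F.aut (V e))
  have hΓ : Γ = T := by
    refine T.is_maximal' ((isPGroup_chainStabilizer (hS.to_subgroup (V e)) hle).comap_of_injective
      (F.aut (V e)).subtype (Subgroup.subtype_injective _)) ?_
    rw [hT, ← range_conjAut]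
    rintro _ ⟨t, rfl⟩
    refine ⟨fun x => ?_, fun x hx => ?_, fun x hx => Subtype.ext ?_⟩
    · exact comm_mem_W t (x : S)
    · exact comm_mem_Z' hx t
    · exact hcZ t x hx
  have hmem : ∀ (b : F.aut (V e)) (x : V e), (((b : MulAut (V e)) x : V e) : S) = ap b x :=
    fun b x => (total_apply _ x).symm
  have hmem' : ∀ (H : Subgroup S) (b : F.aut (V e)) (x : V e), ap b x ∈ H →
      (b : MulAut (V e)) x ∈ H.subgroupOf (V e) := fun H b x h => by
    rwa [Subgroup.mem_subgroupOf, hmem]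
  have hn : β ∈ Subgroup.normalizer (T : Set (F.aut (V e))) := by
    have key : ∀ b : F.aut (V e), (∀ v ∈ W e, ap b v ∈ W e) → (∀ v ∈ W e, ap b⁻¹ v ∈ W e) →
        ∀ γ ∈ (T : Subgroup (F.aut (V e))), b * γ * b⁻¹ ∈ (T : Subgroup (F.aut (V e))) := by
      intro b h1 h2 γ hγ
      rw [← hΓ] at hγ ⊢
      refine chainStabilizer_conj_mem (h := hle) (β := (b : MulAut (V e))) (fun x hx => ?_)
        (fun x hx => ?_) (fun x hx => ?_) (fun x hx => ?_) hγ
      · exact hmem' _ b x (h1 x hx)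
      · exact hmem' _ b⁻¹ x (h2 x hx)
      · exact hmem' _ b x (hZ _ (isoOn_ap b) x hx)
      · exact hmem' _ b⁻¹ x (hZ _ (isoOn_ap b⁻¹) x hx)
    refine Subgroup.mem_normalizer_iff.2 fun γ => ⟨key β hβW hβW' γ, fun h => ?_⟩
    have h1 := key β⁻¹ hβW' (by rwa [inv_inv]) _ h
    simpa [mul_assoc] using h1
  have hβp : IsPGroup p (Subgroup.zpowers β) := by
    refine (((hS.of_surjective _ (F.conjAut (V e)).rangeRestrict_surjective)).map
      (MulAut.conj a⁻¹).toMonoidHom).to_le ?_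
    rw [Subgroup.zpowers_le, hβ]
    exact ⟨_, ⟨s, rfl⟩, rfl⟩
  have hβT : β ∈ T := ((hβp.inf_normalizer_sylow T).le ⟨Subgroup.mem_zpowers β, hn⟩).2
  have h1 : β ∈ Γ := hΓ.symm ▸ hβT
  have h2 : ap β w₀ * w₀⁻¹ ∈ Z e := by
    rw [← hmem β ⟨w₀, W_le_V hw₀⟩]
    exact h1.2.1 ⟨w₀, W_le_V hw₀⟩ hw₀
  rw [hβv w₀ (W_le_V hw₀)] at h2
  have h3 := hZ f hf _ h2
  rw [hr _ (W_le_V (comm_mem_W _ _))] at h3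
  have h4 := h3.2.1
  rw [hsb] at h4
  exact mul_ne_zero (mul_ne_zero hδ hb₁) hc₀ h4

/-- The subgroups `V` and `Q` are not both essential. -/
theorem IsEssential.not_isEssential_V (hp : Odd p) (hS : IsPGroup p S) (hF : F.IsSaturated p)
    (hO : F.Op ≠ ⊥) (hQ : F.IsEssential p (Q e)) : ¬ F.IsEssential p (V e) := by
  intro hV
  have hN := F.isGreatest_Op.1
  have hNn : F.Op.Normal := hN.1
  have hNV := hV.le_of_isNormal hS hN
  have hNQ := hQ.le_of_isNormal hS hN
  have hNW : F.Op ≤ W e := fun x hx => ⟨hNV hx, hNQ hx⟩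
  have hcZ : ∀ s, ∀ x ∈ Z e, s * x * s⁻¹ = x := fun s x hx => by
    rw [← mul_comm_of_mem_Z hx s, mul_inv_cancel_right]
  obtain ⟨n, hn⟩ := Subgroup.ne_bot_iff_exists_ne_one.1 hO
  have hZN : Z e ≤ F.Op := Z_le_of_normal hp n.2 fun h => hn (Subtype.ext h)
  have hi : ∀ f, F.IsoOn (V e) (V e) f → ∀ x ∈ F.Op, f x ∈ F.Op := fun f hf x hx =>
    (hN.isoOn hf.1 hNV).mem hx
  by_cases hb : ∀ x ∈ F.Op, (e x).b = 0
  · have hNZ : F.Op = Z e := le_antisymm (fun x hx => ⟨hNV hx, hb x hx, hNQ hx⟩) hZN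
    rw [hNZ] at hi
    exact not_isEssential_V_of_invariant hp hS hF hi hV
  push Not at hb
  obtain ⟨x, hx, hxb⟩ := hb
  -- Elements of `W` are determined by their `b`-coordinate up to elements of the centre.
  have hmem : ∀ w ∈ W e, ∀ y ∈ F.Op, (e w).b = (e y).b → w ∈ F.Op := by
    intro w hw y hy h
    have h1 := (W e).mul_mem hw ((W e).inv_mem (hNW hy))
    have h2 : w * y⁻¹ ∈ Z e := by
      refine ⟨h1.1, ?_, h1.2⟩
      rw [_root_.map_mul, _root_.map_inv, mul_b, inv_b, inv_c, (hNW hy).2, h, hw.1]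
      ring
    have h3 := F.Op.mul_mem (hZN h2) hy
    rwa [inv_mul_cancel_right] at h3
  by_cases hpair : ∀ y ∈ F.Op, star (e x).b * (e y).b = (e x).b * star (e y).b
  · -- The group `O_p(F) / Z` has order `p`.
    -- The first of the elements `s`, `t` below is trivial on `V / O_p(F)`, the second on `O_p(F)`.
    obtain ⟨δ, hδ, hδs⟩ := GaloisField.exists_star_eq_neg p
    have hVn : (V e).Normal := normal_of_W_le W_le_V
    have h := hV.mem_or_mem hS hNV hi (s := ofXB e (δ * (e x).b) 0) (t := ofXB e (e x).b 0)
      (fun v hv => ?_) fun y hy => ?_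
    · rw [mem_V, mem_V, ofXB_x, ofXB_x] at h
      exact h.elim (mul_ne_zero hδ hxb) hxb
    · obtain ⟨n, hn⟩ := GaloisField.exists_intCast_of_star_eq (r := δ * (e v).c) (by
        rw [star_mul', hδs, (e v).star_c, neg_mul_neg])
      refine hmem _ (comm_mem_W _ _) (x ^ n) (F.Op.zpow_mem hx n) ?_
      rw [UnitaryUnipotent.map_comm, comm_b, ofXB_x, ofXB_c, _root_.map_zpow, zpow_b _ (hNV hx), hn]
      ring
    · rw [mul_inv_eq_iff_eq_mul, mul_comm_iff e, ofXB_x, ofXB_b, ofXB_c, (hNW hy).1, (hNW hy).2,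
        hpair y hy]
      simp
  · -- The group `O_p(F)` is the second centre of `S`.
    push Not at hpair
    obtain ⟨y, hy, hxy⟩ := hpair
    have hWN : W e ≤ F.Op := by
      intro w hw
      obtain ⟨m, k, hmk⟩ := GaloisField.exists_intCast_combination hxy (e w).b
      refine hmem w hw (x ^ m * y ^ k) (F.Op.mul_mem (F.Op.zpow_mem hx m) (F.Op.zpow_mem hy k)) ?_
      rw [hmk, _root_.map_mul, _root_.map_zpow, _root_.map_zpow, mul_b, zpow_x, zpow_b _ (hNV hx),
        zpow_b _ (hNV hy), (hNW hx).1]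
      ring
    have hVQ : ¬ Q e ≤ V e := fun h => by
      have h1 := mem_V.1 (h (mem_Q.2 (ofXB_c (e := e) 1 0)))
      rw [ofXB_x] at h1
      exact one_ne_zero h1
    have iZ := hQ.map_mem_Z hp hS hF (W_le_Q (e := e)) hVQ
    have iW : ∀ f, F.IsoOn (Q e) (Q e) f → ∀ x ∈ W e, f x ∈ W e := fun f hf x hx =>
      hNW ((hN.isoOn hf.1 hNQ).mem (hWN hx))
    refine hQ.ne_top hS hF (eq_top_iff.2 fun s _ => ?_)
    exact hQ.mem_of_chain hS Z_le_W W_le_Q iW iZ (fun x _ => comm_mem_W s x)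
      (fun x hx => comm_mem_Z' hx s) fun x hx => hcZ s x hx

/-- If `F` has a nontrivial normal subgroup, then it has at most one essential subgroup. -/
theorem IsEssential.unique (hp : Odd p) (hS : IsPGroup p S) (hF : F.IsSaturated p)
    (hO : F.Op ≠ ⊥) (e : S ≃* UnitaryUnipotent (GaloisField p 2)) {E E' : Subgroup S}
    (hE : F.IsEssential p E) (hE' : F.IsEssential p E') : E = E' := by
  rcases hE.eq_V_or_eq_Q (e := e) hp hS hF hO with rfl | rfl <;>
    rcases hE'.eq_V_or_eq_Q (e := e) hp hS hF hO with rfl | rfl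
  · rfl
  · exact absurd hE (hE'.not_isEssential_V hp hS hF hO)
  · exact absurd hE' (hE.not_isEssential_V hp hS hF hO)
  · rfl

/-- If `F` has a nontrivial normal subgroup, then its essential subgroup, if any, is normal in `F`:
it is invariant under `Aut_F(S)`. -/
theorem IsEssential.isNormal (hp : Odd p) (hS : IsPGroup p S) (hF : F.IsSaturated p)
    (hO : F.Op ≠ ⊥) (e : S ≃* UnitaryUnipotent (GaloisField p 2)) (hE : F.IsEssential p E) :
    F.IsNormal E := by
  have hW : W e ≤ E := hE.W_le hp hS hO
  refine hF.isNormal_of_invariant hS (normal_of_W_le hW) fun R hR => ?_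
  rcases hR with rfl | hR
  · refine ⟨le_top, fun f hf => ?_⟩
    rcases hE.eq_V_or_eq_Q (e := e) hp hS hF hO with rfl | rfl
    · exact hf.1.map_mem_V hp
    · exact hf.1.map_mem_Q hp
  · rw [hR.unique hp hS hF hO e hE]
    exact ⟨le_rfl, fun f hf x hx => hf.mem hx⟩

end FusionSystem

theorem proposition5p1 (p : ℕ) [Fact p.Prime] (hp : Odd p)
    (S : Sylow p (Matrix.specialUnitaryGroup (Fin 4) (GaloisField p 2)))
    (F : FusionSystem S) (hF : F.IsSaturated p) (hO : F.Op ≠ ⊥) :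
    (∀ E E' : Subgroup S, F.IsEssential p E → F.IsEssential p E' → E = E') ∧
      (∀ E : Subgroup S, F.IsEssential p E → F.IsNormal E ∧ F.IsCentric E) ∧
      F.IsConstrained ∧ F.HasModel p ∧ F.IsRealizable p := by
  obtain ⟨e⟩ := UnitaryUnipotent.nonempty_sylow_mulEquiv hp S
  have hS : IsPGroup p S := S.isPGroup'
  have : Finite S := Finite.of_equiv _ e.symm.toEquiv
  have hnc : ∀ E : Subgroup S, F.IsEssential p E → F.IsNormal E ∧ F.IsCentric E := fun E hE =>
    ⟨hE.isNormal hp hS hF hO e, hE.1⟩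
  obtain ⟨D, hD, hDc⟩ : F.IsConstrained := by
    by_cases hE : ∃ E, F.IsEssential p E
    · obtain ⟨E, hE⟩ := hE
      exact ⟨E, hnc E hE⟩
    · refine ⟨⊤, hF.isNormal_of_invariant hS inferInstance fun R hR => ?_, fun P hP => ?_⟩
      · obtain rfl : R = ⊤ := hR.resolve_right fun h => hE ⟨R, h⟩
        exact ⟨le_rfl, fun _ _ _ _ => Subgroup.mem_top _⟩
      · refine FusionSystem.centralizer_eq_map_center ?_
        obtain ⟨f, hf⟩ := hP.exists_isoOn
        have hP' : P = ⊤ := Subgroup.eq_top_of_card_eq P (by rw [← hf.card_eq, Subgroup.card_top])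
        rw [hP']
        exact le_top
  obtain ⟨G, hG, hGf, ι, hι, hc⟩ := hD.hasModel hS hF hDc
  exact ⟨fun E E' hE hE' => hE.unique hp hS hF hO e hE', hnc, ⟨D, hD, hDc⟩,
    ⟨G, hG, hGf, ι, hι, hc⟩, ⟨G, hG, hGf, ι, hι⟩⟩
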